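/- Let $M$ be a connected $C^\infty$ surface (Hausdorff, second countable) with a $C^\infty$ immersion $x:M\to\mathbb E^3$, equipped with the induced metric $g$, and suppose that $M$ is flat (its Gaussian curvature vanishes identically). Let $\alpha=\tfrac12\operatorname{trace}A_\xi$ be the (signed) mean curvature function of $M$ with respect to a local unit normal field $\xi$, where $A_\xi$ is the shape operator, and let $\Delta$ be the Laplace operator of $g$. Then $\Delta\alpha=0$ on all of $M$ (a condition which does not depend on the choice of $\xi$) if and only if $M$ is an open part of one of the following surfaces: 1. a plane; 2. a circular cylinder; 3. a Cornu cylinder $C\times\mathbb R$, i.e. a right cylinder on a Cornu spiral $C$: a planar curve whose signed curvature as a function of an arclength parameter $s\in\mathbb R$ is $\kappa(s)=as+b$ with real constants $a\neq 0$ and $b$; 4. a cone with vertex at a point $p$ whose rays cut the unit sphere $S^2_p(1)$ centered at $p$ in a curve $\beta(s)$, $s\in\mathbb R$ an arclength parameter, of which the signed (geodesic) curvature in $S^2_p(1)$ is $c_1\cos s+c_2\sin s$ for two nonzero constants $c_1,c_2$. Here $M$ is an open part of the surface parametrized by an immersion $F:D\to\mathbb E^3$, $D\subseteq\mathbb R^2$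 open, if every point of $M$ has an open neighbourhood $U$ with a diffeomorphism $\varphi$ of $U$ onto an open subset of $D$ such that $x|_U=F\circ\varphi$ (with the same $F$ for all points); for a cylinder on a curve $\gamma$ in the plane, $D=\mathbb R^2$ and $F(s,t)=\gamma(s)+t\,e$ with $e$ a unit normal of the plane, and for a cone, $D=\mathbb R\times(0,\infty)$ and $F(s,t)=p+t\beta(s)$. -/

import Mathlib

open scoped Manifold ContDiff

noncomputable section

namespace FlatSurface

/-- The Euclidean plane. -/
abbrev E2 : Type := EuclideanSpace ℝ (Fin 2)

/-- Euclidean three-space. -/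
abbrev E3 : Type := EuclideanSpace ℝ (Fin 3)

/-- The vector product of Euclidean three-space. -/
def cross (u v : E3) : E3 := WithLp.toLp 2 (crossProduct u.ofLp v.ofLp)

section LocalGeometry

/-- The partial derivative `∂ᵢ f` of a function of two variables. -/
def partialD {F : Type*} [NormedAddCommGroup F] [NormedSpace ℝ F]
    (i : Fin 2) (f : E2 → F) (q : E2) : F :=
  fderiv ℝ f q (EuclideanSpace.single i 1)

/-- The matrix `g` of the first fundamental form (induced metric) of a parametrized surface `y`. -/
def firstForm (y : E2 → E3) (q : E2) : Matrix (Fin 2) (Fin 2) ℝ :=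
  Matrix.of fun i j => inner ℝ (partialD i y q) (partialD j y q)

/-- The unit normal `∂₀y × ∂₁y / |∂₀y × ∂₁y|` of a parametrized surface `y`. -/
def unitNormal (y : E2 → E3) (q : E2) : E3 :=
  ‖cross (partialD 0 y q) (partialD 1 y q)‖⁻¹ • cross (partialD 0 y q) (partialD 1 y q)

/-- The matrix `hᵢⱼ = ⟨∂ᵢ∂ⱼ y, ξ⟩` of the second fundamental form of a parametrized surface `y`
with respect to its unit normal `ξ`. -/
def secondForm (y : E2 → E3) (q : E2) : Matrix (Fin 2) (Fin 2) ℝ :=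
  Matrix.of fun i j => inner ℝ (partialD i (partialD j y) q) (unitNormal y q)

/-- The Gaussian curvature `det h / det g`. -/
def gaussCurvature (y : E2 → E3) (q : E2) : ℝ :=
  (secondForm y q).det / (firstForm y q).det

/-- The mean curvature function `α = (1/2) trace (g⁻¹ h)` with respect to the unit normal `ξ`,
so that `α ξ` is the mean curvature vector. -/
def meanCurvature (y : E2 → E3) (q : E2) : ℝ :=
  (1 / 2) * ((firstForm y q)⁻¹ * secondForm y q).trace

/-- The Laplace operator `Δ f = - (det g)^(-1/2) ∑ᵢ ∂ᵢ ((det g)^(1/2) ∑ⱼ gⁱʲ ∂ⱼ f)` of the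
induced metric of a parametrized surface `y`. -/
def laplace (y : E2 → E3) (f : E2 → ℝ) (q : E2) : ℝ :=
  -((√(firstForm y q).det)⁻¹ *
    ∑ i, partialD i
      (fun r => √(firstForm y r).det * ∑ j, (firstForm y r)⁻¹ i j * partialD j f r) q)

end LocalGeometry

section Surfaces

variable {M : Type*} [TopologicalSpace M] [ChartedSpace E2 M]

/-- `x : M → E3` is an immersion of class `C^∞`. -/
def IsSmoothImmersion (x : M → E3) : Prop :=
  ContMDiff (𝓡 2) (𝓡 3) ∞ x ∧ ∀ m, Function.Injective (mfderiv (𝓡 2) (𝓡 3) x m)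

/-- The immersed surface `x` is flat: its Gaussian curvature vanishes. -/
def IsFlat (x : M → E3) : Prop :=
  ∀ e ∈ IsManifold.maximalAtlas (𝓡 2) ∞ M, ∀ q ∈ e.target, gaussCurvature (x ∘ e.symm) q = 0

/-- The mean curvature function of the immersed surface `x` is harmonic. The mean curvature
function is determined up to sign by the choice of a local unit normal field, and here each chart
uses the normal field that it induces; the condition `Δ α = 0` does not see the sign. -/
def HasHarmonicMeanCurvature (x : M → E3) : Prop :=
  ∀ e ∈ IsManifold.maximalAtlas (𝓡 2) ∞ M, ∀ q ∈ e.target,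
    laplace (x ∘ e.symm) (meanCurvature (x ∘ e.symm)) q = 0

/-- The immersed surface `x` is an open part of the surface parametrized by `F` on the open set
`D`: around every point, `M` has a chart (with values in `D`) in which `x` is `F`. -/
def IsOpenPartOf (x : M → E3) (F : E2 → E3) (D : Set E2) : Prop :=
  ∀ m : M, ∃ e ∈ IsManifold.maximalAtlas (𝓡 2) ∞ M,
    m ∈ e.source ∧ e.target ⊆ D ∧ ∀ u ∈ e.source, x u = F (e u)

end Surfaces

section Models

/-- The right cylinder over the planar curve `γ`, in Cartesian coordinates with origin `p` and
axes `b`. -/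
def rightCylinder (p : E3) (b : OrthonormalBasis (Fin 3) ℝ E3) (γ : ℝ → E2) (q : E2) : E3 :=
  p + γ (q 0) 0 • b 0 + γ (q 0) 1 • b 1 + q 1 • b 2

/-- The cone with vertex `p` over the curve `β` of the unit sphere (of the directions of its rays);
the second coordinate is the distance from the vertex. -/
def cone (p : E3) (β : ℝ → E3) (q : E2) : E3 := p + q 1 • β (q 0)

/-- The signed curvature of a planar curve parametrized by arclength. -/
def planarCurvature (γ : ℝ → E2) (s : ℝ) : ℝ :=
  deriv γ s 0 * deriv (deriv γ) s 1 - deriv γ s 1 * deriv (deriv γ) s 0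

/-- The signed (geodesic) curvature in the unit sphere `S²(1)` of a curve in it parametrized by
arclength. -/
def sphericalCurvature (β : ℝ → E3) (s : ℝ) : ℝ :=
  inner ℝ (deriv (deriv β) s) (cross (β s) (deriv β s))

/-- A curve parametrized by arclength. -/
def IsUnitSpeed {F : Type*} [NormedAddCommGroup F] [NormedSpace ℝ F] (γ : ℝ → F) : Prop :=
  ContDiff ℝ ∞ γ ∧ ∀ s, ‖deriv γ s‖ = 1

/-- A Cornu spiral: `κ(s) = a s + c` in an arclength parameter `s`, with `a ≠ 0`. -/
def IsCornuSpiral (γ : ℝ → E2) : Prop :=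
  IsUnitSpeed γ ∧ ∃ a c : ℝ, a ≠ 0 ∧ ∀ s, planarCurvature γ s = a * s + c

/-- A curve in the unit sphere, parametrized by arclength `s`, with spherical curvature
`c₁ cos s + c₂ sin s` for two nonzero constants. -/
def IsHarmonicSphericalCurve (β : ℝ → E3) : Prop :=
  IsUnitSpeed β ∧ (∀ s, ‖β s‖ = 1) ∧ ∃ c₁ c₂ : ℝ, c₁ ≠ 0 ∧ c₂ ≠ 0 ∧
    ∀ s, sphericalCurvature β s = c₁ * Real.cos s + c₂ * Real.sin s

variable {M : Type*} [TopologicalSpace M] [ChartedSpace E2 M]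

/-- `x` is an open part of a plane `{p + u v + t w}`, `v, w` orthonormal. -/
def IsOpenPartOfPlane (x : M → E3) : Prop :=
  ∃ p v w : E3, Orthonormal ℝ ![v, w] ∧
    IsOpenPartOf x (fun q => p + q 0 • v + q 1 • w) Set.univ

/-- `x` is an open part of a circular cylinder. -/
def IsOpenPartOfCircularCylinder (x : M → E3) : Prop :=
  ∃ (p : E3) (b : OrthonormalBasis (Fin 3) ℝ E3) (r : ℝ), 0 < r ∧
    IsOpenPartOf x (rightCylinder p b fun s => !₂[r * Real.cos s, r * Real.sin s]) Set.univ

/-- `x` is an open part of a Cornu cylinder. -/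
def IsOpenPartOfCornuCylinder (x : M → E3) : Prop :=
  ∃ (p : E3) (b : OrthonormalBasis (Fin 3) ℝ E3) (γ : ℝ → E2), IsCornuSpiral γ ∧
    IsOpenPartOf x (rightCylinder p b γ) Set.univ

/-- `x` is an open part of a cone whose rays cut the unit sphere about its vertex in a curve
with spherical curvature `c₁ cos s + c₂ sin s`. -/
def IsOpenPartOfHarmonicCone (x : M → E3) : Prop :=
  ∃ (p : E3) (β : ℝ → E3), IsHarmonicSphericalCurve β ∧
    IsOpenPartOf x (cone p β) {q | 0 < q 1}

end Models

end FlatSurface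

end

/-! A flat surface has local coordinates in which the induced metric is Euclidean. There the second
fundamental form is a symmetric matrix h of determinant zero satisfying the Codazzi equations, and
the hypothesis makes its trace harmonic. In the complex coordinate z, let a be half the trace and H
the trace-free part. The conditions become H_z̄ = a_z, a² = |H|² and a_zz̄ = 0. Where a ≠ 0, the
kernel of h, which is the direction of the rulings, is spanned by a unit τ with τ² = P = -H̄/a. This
system is overdetermined: repeated differentiation (`ruling_equations`) gives P_zz = 0, and then m =
-conj(P_z) is holomorphic with m_z = m². So either the rulings are parallel in the flat coordinates,
or they all lie on lines through one point z₀ outside the domain (`kernel_alternative`); other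
tangent developables are excluded.

The surface is therefore locally a cylinder (μ = 0) or a cone (μ = 1), described by a Frenet frame
with curvature κ in the direction across the rulings. With w = 1 - μ + μt one finds Δα = (κ'' +
μ²κ)/(2w³) (`IsRuledFrame.laplace_eq`), so harmonicity amounts to κ'' = -μκ: κ is affine, or of the
form c₁ cos s + c₂ sin s. Such κ live on all of ℝ, so every local piece belongs to a complete model
(`IsModel`).

For the global statement, let two models share an open piece, one of them with κ not identically
zero. Its zeros are isolated, and away from them the surface determines its rulings, so the two
models differ by an affine isometry of the parameters (`IsModel.exists_coordChange`). A clopen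
argument then places all of M in a single model (`IsModel.isOpenPartOf`). If only models with κ = 0
occur, the normal is constant along M, which lies in a plane (`isOpenPartOfPlane_of_models`). The
constants in κ separate circular cylinders, Cornu cylinders and cones; for cones a shift of s makes
both constants nonzero.

Conversely, all surfaces of the list are models, where the same formula gives Δα = 0, and this
equation is invariant under changes of coordinates (`IsReparam.laplace_meanCurvature_eq_zero`). -/

section Auxiliary

open Set Filter Topology

namespace FlatSurface

/-! ### Vector product and orthonormal frames of Euclidean three-space. -/

section Cross

theorem inner_E3 (u v : E3) : inner ℝ u v = u 0 * v 0 + u 1 * v 1 + u 2 * v 2 := by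
  simp [PiLp.inner_apply, Fin.sum_univ_three, mul_comm]

theorem cross_zero (u v : E3) : cross u v 0 = u 1 * v 2 - u 2 * v 1 := by
  simp [cross, cross_apply]

theorem cross_one (u v : E3) : cross u v 1 = u 2 * v 0 - u 0 * v 2 := by
  simp [cross, cross_apply]

theorem cross_two (u v : E3) : cross u v 2 = u 0 * v 1 - u 1 * v 0 := by
  simp [cross, cross_apply]

theorem ext_E3 {u v : E3} (h0 : u 0 = v 0) (h1 : u 1 = v 1) (h2 : u 2 = v 2) : u = v := by
  ext i; fin_cases i <;> assumption

theorem ext_E2 {u v : E2} (h0 : u 0 = v 0) (h1 : u 1 = v 1) : u = v := by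
  ext i; fin_cases i <;> assumption

theorem inner_cross_left (u v : E3) : inner ℝ u (cross u v) = 0 := by
  rw [inner_E3, cross_zero, cross_one, cross_two]; ring

theorem inner_cross_right (u v : E3) : inner ℝ v (cross u v) = 0 := by
  rw [inner_E3, cross_zero, cross_one, cross_two]; ring

theorem inner_cross_cross (u v w z : E3) : inner ℝ (cross u v) (cross w z)
    = inner ℝ u w * inner ℝ v z - inner ℝ u z * inner ℝ v w := by
  simp only [inner_E3, cross_zero, cross_one, cross_two]; ring

theorem norm_cross_sq (u v : E3) :
    ‖cross u v‖ ^ 2 = ‖u‖ ^ 2 * ‖v‖ ^ 2 - inner ℝ u v ^ 2 := by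
  rw [← real_inner_self_eq_norm_sq, inner_cross_cross, real_inner_self_eq_norm_sq,
    real_inner_self_eq_norm_sq, real_inner_comm u v]; ring

theorem cross_add_left (u v w : E3) : cross (u + v) w = cross u w + cross v w := by
  apply ext_E3 <;> simp only [cross_zero, cross_one, cross_two, PiLp.add_apply] <;> ring

theorem cross_add_right (u v w : E3) : cross u (v + w) = cross u v + cross u w := by
  apply ext_E3 <;> simp only [cross_zero, cross_one, cross_two, PiLp.add_apply] <;> ring

theorem cross_smul_left (c : ℝ) (u w : E3) : cross (c • u) w = c • cross u w := by
  apply ext_E3 <;> simp only [cross_zero, cross_one, cross_two, PiLp.smul_apply, smul_eq_mul] <;>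
    ring

theorem cross_smul_right (c : ℝ) (u w : E3) : cross u (c • w) = c • cross u w := by
  apply ext_E3 <;> simp only [cross_zero, cross_one, cross_two, PiLp.smul_apply, smul_eq_mul] <;>
    ring

theorem cross_self (u : E3) : cross u u = 0 := by
  apply ext_E3 <;> simp only [cross_zero, cross_one, cross_two, PiLp.zero_apply] <;> ring

theorem cross_anticomm (u v : E3) : cross v u = -cross u v := by
  apply ext_E3 <;> simp only [cross_zero, cross_one, cross_two, PiLp.neg_apply] <;> ring

/-- Vectors with vanishing vector product are linearly dependent. -/
theorem cross_ne_zero_of_independent {u v : E3}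
    (h : ∀ c d : ℝ, c • u + d • v = 0 → c = 0 ∧ d = 0) : cross u v ≠ 0 := by
  intro h0
  have hu : u ≠ 0 := by
    rintro rfl
    simpa using h 1 0 (by simp)
  have h1 := norm_cross_sq u v
  rw [h0, norm_zero] at h1
  -- By Lagrange's identity the squared norm of |u|²v - ⟨u,v⟩u is |u|²|u × v|², so a vanishing
  -- product yields a linear relation whose second coefficient |u|² is nonzero.
  have h2 : ‖(-inner ℝ u v) • u + (‖u‖ ^ 2) • v‖ ^ 2 = 0 := by
    rw [norm_add_sq_real, norm_smul, norm_smul, inner_smul_left, inner_smul_right]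
    simp only [Real.norm_eq_abs, mul_pow, sq_abs, conj_trivial]
    linear_combination (-‖u‖ ^ 2) * h1
  have h3 := h _ _ (norm_eq_zero.1 (pow_eq_zero_iff (two_ne_zero) |>.1 h2))
  exact hu (by simpa using h3.2)

/-- An orthonormal triple of vectors of `E3`. -/
structure IsFrame (u v w : E3) : Prop where
  uu : ‖u‖ = 1
  vv : ‖v‖ = 1
  ww : ‖w‖ = 1
  uv : inner ℝ u v = 0
  uw : inner ℝ u w = 0
  vw : inner ℝ v w = 0

namespace IsFrame

variable {u v w : E3}

theorem orthonormal (h : IsFrame u v w) : Orthonormal ℝ ![u, v, w] := by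
  obtain ⟨h1, h2, h3, h4, h5, h6⟩ := h
  refine ⟨fun i => ?_, fun i j hij => ?_⟩
  · fin_cases i <;> assumption
  · have h4' := h4; have h5' := h5; have h6' := h6
    rw [real_inner_comm] at h4' h5' h6'
    fin_cases i <;> fin_cases j <;> first | exact absurd rfl hij | assumption

/-- The orthonormal basis given by a frame. -/
noncomputable def basis (h : IsFrame u v w) : OrthonormalBasis (Fin 3) ℝ E3 :=
  OrthonormalBasis.mk h.orthonormal (by
    have := h.orthonormal.linearIndependent.span_eq_top_of_card_eq_finrank (by simp)
    rw [this])

theorem basis_zero (h : IsFrame u v w) : h.basis 0 = u := by simp [basis]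
theorem basis_one (h : IsFrame u v w) : h.basis 1 = v := by simp [basis]
theorem basis_two (h : IsFrame u v w) : h.basis 2 = w := by simp [basis]

theorem expand (h : IsFrame u v w) (z : E3) :
    z = inner ℝ z u • u + inner ℝ z v • v + inner ℝ z w • w := by
  have h1 := (h.basis.sum_repr' z).symm
  rw [Fin.sum_univ_three, h.basis_zero, h.basis_one, h.basis_two] at h1
  rw [real_inner_comm z u, real_inner_comm z v, real_inner_comm z w] at h1
  exact h1

theorem inner_expand (h : IsFrame u v w) (y z : E3) :
    inner ℝ y z = inner ℝ y u * inner ℝ z u + inner ℝ y v * inner ℝ z v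
      + inner ℝ y w * inner ℝ z w := by
  conv_lhs => rw [h.expand z]
  simp only [inner_add_right, inner_smul_right]
  ring

theorem uu' (h : IsFrame u v w) : inner ℝ u u = (1 : ℝ) := by
  rw [real_inner_self_eq_norm_sq, h.uu]; norm_num
theorem vv' (h : IsFrame u v w) : inner ℝ v v = (1 : ℝ) := by
  rw [real_inner_self_eq_norm_sq, h.vv]; norm_num
theorem ww' (h : IsFrame u v w) : inner ℝ w w = (1 : ℝ) := by
  rw [real_inner_self_eq_norm_sq, h.ww]; norm_num
theorem vu (h : IsFrame u v w) : inner ℝ v u = (0 : ℝ) := by rw [real_inner_comm, h.uv]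
theorem wu (h : IsFrame u v w) : inner ℝ w u = (0 : ℝ) := by rw [real_inner_comm, h.uw]
theorem wv (h : IsFrame u v w) : inner ℝ w v = (0 : ℝ) := by rw [real_inner_comm, h.vw]

theorem of_cross {u v : E3} (hu : ‖u‖ = 1) (hv : ‖v‖ = 1) (huv : inner ℝ u v = 0) :
    IsFrame u v (cross u v) := by
  refine ⟨hu, hv, ?_, huv, inner_cross_left _ _, inner_cross_right _ _⟩
  have h := norm_cross_sq u v
  rw [hu, hv, huv] at h
  nlinarith [norm_nonneg (cross u v)]

/-- The third vector of a frame is the vector product of the others up to sign. -/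
theorem cross_eq (h : IsFrame u v w) : cross u v = w ∨ cross u v = -w := by
  have h1 := h.expand (cross u v)
  rw [real_inner_comm, inner_cross_left, real_inner_comm v, inner_cross_right] at h1
  have h2 := (of_cross h.uu h.vv h.uv).ww
  set c := inner ℝ (cross u v) w
  rw [h1] at h2 ⊢
  simp only [zero_smul, zero_add, norm_smul, h.ww, mul_one, Real.norm_eq_abs] at h2 ⊢
  rcases eq_or_eq_neg_of_abs_eq h2 with h3 | h3 <;> rw [h3] <;> simp

end IsFrame

end Cross

/-! ### Calculus of the partial derivatives `partialD`. -/

section PartialDerivatives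

variable {F G : Type*} [NormedAddCommGroup F] [NormedSpace ℝ F]
  [NormedAddCommGroup G] [NormedSpace ℝ G] {U : Set E2} {q : E2}

theorem eq_single_add_single (v : E2) :
    v = v 0 • EuclideanSpace.single 0 1 + v 1 • EuclideanSpace.single 1 1 := by
  apply ext_E2 <;> simp

theorem clm_apply_eq (A : E2 →L[ℝ] F) (v : E2) :
    A v = v 0 • A (EuclideanSpace.single 0 1) + v 1 • A (EuclideanSpace.single 1 1) := by
  conv_lhs => rw [eq_single_add_single v]
  rw [map_add, map_smul, map_smul]

theorem fderiv_apply_eq (f : E2 → F) (q v : E2) :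
    fderiv ℝ f q v = v 0 • partialD 0 f q + v 1 • partialD 1 f q :=
  clm_apply_eq _ v

theorem partialD_congr {f g : E2 → F} (h : f =ᶠ[𝓝 q] g) (i : Fin 2) :
    partialD i f q = partialD i g q := by
  rw [partialD, partialD, h.fderiv_eq]

theorem partialD_congr_on {f g : E2 → F} (hU : IsOpen U) (h : EqOn f g U) (hq : q ∈ U)
    (i : Fin 2) : partialD i f q = partialD i g q :=
  partialD_congr (h.eventuallyEq_of_mem (hU.mem_nhds hq)) i

theorem diffAt {f : E2 → F} (hf : ContDiffOn ℝ ∞ f U) (hU : IsOpen U) (hq : q ∈ U) :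
    DifferentiableAt ℝ f q :=
  (hf.contDiffAt (hU.mem_nhds hq)).differentiableAt (by simp)

theorem contDiffOn_partialD {f : E2 → F} (hU : IsOpen U) (hf : ContDiffOn ℝ ∞ f U) (i : Fin 2) :
    ContDiffOn ℝ ∞ (partialD i f) U :=
  (hf.fderiv_of_isOpen hU (m := ∞) (by simp)).clm_apply contDiffOn_const

theorem partialD_comm {f : E2 → F} (hU : IsOpen U) (hf : ContDiffOn ℝ ∞ f U) (hq : q ∈ U)
    (i j : Fin 2) : partialD i (partialD j f) q = partialD j (partialD i f) q := by
  have hd : DifferentiableAt ℝ (fderiv ℝ f) q :=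
    ((hf.fderiv_of_isOpen hU (m := ∞) (by simp)).contDiffAt (hU.mem_nhds hq)).differentiableAt
      (by simp)
  have h1 : ∀ a b : Fin 2, partialD a (partialD b f) q
      = fderiv ℝ (fderiv ℝ f) q (EuclideanSpace.single a 1) (EuclideanSpace.single b 1) := by
    intro a b
    have := (hd.hasFDerivAt.clm_apply (hasFDerivAt_const (EuclideanSpace.single b (1 : ℝ)) q))
    have h2 := this.fderiv
    unfold partialD
    rw [h2]; simp
  rw [h1, h1]
  exact ((hf.contDiffAt (hU.mem_nhds hq)).isSymmSndFDerivAt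
    (by simpa using (WithTop.coe_le_coe.2 le_top :
      ((2 : ℕ∞) : WithTop ℕ∞) ≤ ((⊤ : ℕ∞) : WithTop ℕ∞)))) _ _

theorem partialD_const (c : F) (i : Fin 2) (q : E2) : partialD i (fun _ => c) q = 0 := by
  simp [partialD]

theorem partialD_add {f g : E2 → F} (hf : DifferentiableAt ℝ f q) (hg : DifferentiableAt ℝ g q)
    (i : Fin 2) : partialD i (fun r => f r + g r) q = partialD i f q + partialD i g q := by
  simp [partialD, fderiv_fun_add hf hg]

theorem partialD_sub {f g : E2 → F} (hf : DifferentiableAt ℝ f q) (hg : DifferentiableAt ℝ g q)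
    (i : Fin 2) : partialD i (fun r => f r - g r) q = partialD i f q - partialD i g q := by
  simp [partialD, fderiv_fun_sub hf hg]

theorem partialD_neg (f : E2 → F) (i : Fin 2) :
    partialD i (fun r => -f r) q = -partialD i f q := by
  simp [partialD, fderiv_fun_neg]

theorem partialD_smul {f : E2 → ℝ} {g : E2 → F} (hf : DifferentiableAt ℝ f q)
    (hg : DifferentiableAt ℝ g q) (i : Fin 2) :
    partialD i (fun r => f r • g r) q = f q • partialD i g q + partialD i f q • g q := by
  simp [partialD, fderiv_fun_smul hf hg]

theorem partialD_mul {f g : E2 → ℝ} (hf : DifferentiableAt ℝ f q)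
    (hg : DifferentiableAt ℝ g q) (i : Fin 2) :
    partialD i (fun r => f r * g r) q = f q * partialD i g q + partialD i f q * g q :=
  partialD_smul hf hg i

theorem partialD_cmul {f g : E2 → ℂ} (hf : DifferentiableAt ℝ f q)
    (hg : DifferentiableAt ℝ g q) (i : Fin 2) :
    partialD i (fun r => f r * g r) q = f q * partialD i g q + partialD i f q * g q := by
  simp [partialD, fderiv_fun_mul hf hg, mul_comm]

theorem partialD_clm (L : F →L[ℝ] G) {f : E2 → F} (hf : DifferentiableAt ℝ f q) (i : Fin 2) :
    partialD i (fun r => L (f r)) q = L (partialD i f q) := by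
  have : HasFDerivAt (fun r => L (f r)) (L.comp (fderiv ℝ f q)) q :=
    L.hasFDerivAt.comp q hf.hasFDerivAt
  simp [partialD, this.fderiv]

theorem partialD_inner {H : Type*} [NormedAddCommGroup H] [InnerProductSpace ℝ H] {f g : E2 → H}
    (hf : DifferentiableAt ℝ f q) (hg : DifferentiableAt ℝ g q) (i : Fin 2) :
    partialD i (fun r => inner ℝ (f r) (g r)) q
      = inner ℝ (partialD i f q) (g q) + inner ℝ (f q) (partialD i g q) := by
  simp only [partialD]
  rw [fderiv_inner_apply ℝ hf hg, add_comm]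

theorem partialD_apply {n : ℕ} {f : E2 → EuclideanSpace ℝ (Fin n)} (hf : DifferentiableAt ℝ f q)
    (i : Fin 2) (k : Fin n) : partialD i (fun r => f r k) q = partialD i f q k :=
  partialD_clm (EuclideanSpace.proj k : EuclideanSpace ℝ (Fin n) →L[ℝ] ℝ) hf i

theorem partialD_coord (i k : Fin 2) (q : E2) :
    partialD i (fun r : E2 => r k) q = if k = i then 1 else 0 := by
  have h := partialD_apply (f := fun r : E2 => r) (q := q) differentiableAt_id i k
  rw [h]
  simp [partialD]

/-- The chain rule in coordinates. -/
theorem partialD_comp {f : E2 → F} {φ : E2 → E2} (hf : DifferentiableAt ℝ f (φ q))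
    (hφ : DifferentiableAt ℝ φ q) (i : Fin 2) :
    partialD i (fun r => f (φ r)) q
      = partialD i φ q 0 • partialD 0 f (φ q) + partialD i φ q 1 • partialD 1 f (φ q) := by
  have : HasFDerivAt (fun r => f (φ r)) ((fderiv ℝ f (φ q)).comp (fderiv ℝ φ q)) q :=
    hf.hasFDerivAt.comp q hφ.hasFDerivAt
  rw [partialD, this.fderiv, ContinuousLinearMap.comp_apply, fderiv_apply_eq]
  rfl

theorem partialD_comp_real {f : ℝ → F} {φ : E2 → ℝ} (hf : DifferentiableAt ℝ f (φ q))
    (hφ : DifferentiableAt ℝ φ q) (i : Fin 2) :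
    partialD i (fun r => f (φ r)) q = partialD i φ q • deriv f (φ q) := by
  have : HasFDerivAt (fun r => f (φ r)) ((fderiv ℝ f (φ q)).comp (fderiv ℝ φ q)) q :=
    hf.hasFDerivAt.comp q hφ.hasFDerivAt
  rw [partialD, this.fderiv, ContinuousLinearMap.comp_apply, fderiv_eq_smul_deriv]
  rfl

theorem fderiv_eq_zero_of_partialD {f : E2 → F} (h0 : partialD 0 f q = 0)
    (h1 : partialD 1 f q = 0) : fderiv ℝ f q = 0 := by
  ext v
  rw [fderiv_apply_eq, h0, h1]; simp

theorem eq_of_partialD_eq_zero {f : E2 → F} (hU : IsOpen U) (hc : Convex ℝ U)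
    (hf : DifferentiableOn ℝ f U) (h : ∀ q ∈ U, ∀ i, partialD i f q = 0)
    {p q : E2} (hp : p ∈ U) (hq : q ∈ U) : f p = f q :=
  hU.is_const_of_fderiv_eq_zero hc.isPreconnected hf
    (fun r hr => fderiv_eq_zero_of_partialD (h r hr 0) (h r hr 1)) hp hq

end PartialDerivatives

/-! ### The inverse function theorem and the construction of charts of M. -/

section Charts

/-- The inverse function theorem in the smooth category. -/
theorem exists_local_diffeo {V : Set E2} (hV : IsOpen V) {φ : E2 → E2} (hφ : ContDiffOn ℝ ∞ φ V)
    {a : E2} (ha : a ∈ V) (hinj : Function.Injective (fderiv ℝ φ a)) :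
    ∃ Φ : OpenPartialHomeomorph E2 E2, a ∈ Φ.source ∧ Φ.source ⊆ V ∧ (∀ q ∈ Φ.source, Φ q = φ q) ∧
      ContDiffOn ℝ ∞ Φ Φ.source ∧ ContDiffOn ℝ ∞ Φ.symm Φ.target := by
  let f' : E2 ≃L[ℝ] E2 :=
    (LinearEquiv.ofInjectiveEndo (fderiv ℝ φ a : E2 →ₗ[ℝ] E2) hinj).toContinuousLinearEquiv
  have hf'c : (f' : E2 →L[ℝ] E2) = fderiv ℝ φ a := by ext v : 1; rfl
  have hf' : HasFDerivAt φ (f' : E2 →L[ℝ] E2) a := by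
    rw [hf'c]; exact (diffAt hφ hV ha).hasFDerivAt
  have hca : ContDiffAt ℝ ∞ φ a := hφ.contDiffAt (hV.mem_nhds ha)
  have hn : (∞ : WithTop ℕ∞) ≠ 0 := by simp
  let Φ₀ := hca.toOpenPartialHomeomorph φ hf' hn
  have hΦ₀ : (Φ₀ : E2 → E2) = φ := rfl
  -- The inverse has to be smooth on its whole domain, and not only at the image of a, so the source
  -- is cut down to the open set where the derivative is invertible.
  let V' : Set E2 := V ∩ fderiv ℝ φ ⁻¹' range ((↑) : (E2 ≃L[ℝ] E2) → E2 →L[ℝ] E2)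
  have hV' : IsOpen V' :=
    (hφ.fderiv_of_isOpen hV (m := ∞) (by simp)).continuousOn.isOpen_inter_preimage hV
      (ContinuousLinearEquiv.isOpen)
  have haV' : a ∈ V' := ⟨ha, f', hf'c⟩
  have hsrc : (Φ₀.restrOpen V' hV').source = Φ₀.source ∩ V' := rfl
  refine ⟨Φ₀.restrOpen V' hV', ?_, ?_, fun q _ => rfl, ?_, ?_⟩
  · rw [hsrc]
    exact ⟨hca.mem_toOpenPartialHomeomorph_source hf' hn, haV'⟩
  · rw [hsrc]
    exact fun q hq => hq.2.1
  · exact hφ.mono (by rw [hsrc]; exact fun q hq => hq.2.1)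
  · intro p hp
    have hq := (Φ₀.restrOpen V' hV').map_target hp
    rw [hsrc] at hq
    obtain ⟨g, hg⟩ := hq.2.2
    refine ContDiffAt.contDiffWithinAt ?_
    refine OpenPartialHomeomorph.contDiffAt_symm _ (f₀' := g) hp ?_ ?_
    · rw [hg]; exact (diffAt hφ hV hq.2.1).hasFDerivAt
    · exact hφ.contDiffAt (hV.mem_nhds hq.2.1)

variable {M : Type*} [TopologicalSpace M] [ChartedSpace E2 M]

theorem contDiffOn_param {x : M → E3} (hx : IsSmoothImmersion x) {e : OpenPartialHomeomorph M E2}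
    (he : e ∈ IsManifold.maximalAtlas (𝓡 2) ∞ M) : ContDiffOn ℝ ∞ (x ∘ e.symm) e.target :=
  (hx.1.comp_contMDiffOn (contMDiffOn_symm_of_mem_maximalAtlas he)).contDiffOn

theorem injective_fderiv_param {x : M → E3} (hx : IsSmoothImmersion x)
    {e : OpenPartialHomeomorph M E2} (he : e ∈ IsManifold.maximalAtlas (𝓡 2) ∞ M) {q : E2}
    (hq : q ∈ e.target) : Function.Injective (fderiv ℝ (x ∘ e.symm) q) := by
  have hs : MDifferentiableAt (𝓡 2) (𝓡 2) e.symm q :=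
    (contMDiffAt_symm_of_mem_maximalAtlas he hq).mdifferentiableAt (by simp)
  have he1 : MDifferentiableAt (𝓡 2) (𝓡 2) e (e.symm q) :=
    (contMDiffAt_of_mem_maximalAtlas he (e.map_target hq)).mdifferentiableAt (by simp)
  have hx1 : MDifferentiableAt (𝓡 2) (𝓡 3) x (e.symm q) :=
    hx.1.mdifferentiableAt (by simp)
  rw [← mfderiv_eq_fderiv, mfderiv_comp q hx1 hs]
  change Function.Injective ((mfderiv (𝓡 2) (𝓡 3) x (e.symm q)) ∘ (mfderiv (𝓡 2) (𝓡 2) e.symm q))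
  refine (hx.2 _).comp ?_
  have h1 : mfderiv (𝓡 2) (𝓡 2) (e ∘ e.symm) q = ContinuousLinearMap.id ℝ _ := by
    have h2 : e ∘ e.symm =ᶠ[𝓝 q] id :=
      (e.open_target.mem_nhds hq) |> fun h => Filter.mem_of_superset h fun p hp => e.right_inv hp
    rw [h2.mfderiv_eq, mfderiv_id]
  rw [mfderiv_comp q he1 hs] at h1
  intro v w hvw
  have h3 : ∀ v, mfderiv (𝓡 2) (𝓡 2) e (e.symm q) (mfderiv (𝓡 2) (𝓡 2) e.symm q v) = v :=
    fun v => congrArg (fun A => A v) h1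
  rw [← h3 v, ← h3 w, hvw]

variable [IsManifold (𝓡 2) ∞ M]

/-- The new chart is Φ ∘ e, restricted so that its target is a ball inside W. Balls are convex,
which the Poincaré lemma and the arguments along coordinate lines require. -/
theorem exists_chart_of_diffeo {e : OpenPartialHomeomorph M E2}
    (he : e ∈ IsManifold.maximalAtlas (𝓡 2) ∞ M) {m : M} (hm : m ∈ e.source)
    {Φ : OpenPartialHomeomorph E2 E2} (ha : e m ∈ Φ.source) (hΦ : ContDiffOn ℝ ∞ Φ Φ.source)
    (hΦ' : ContDiffOn ℝ ∞ Φ.symm Φ.target) {W : Set E2} (hW : W ∈ 𝓝 (Φ (e m))) :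
    ∃ e' ∈ IsManifold.maximalAtlas (𝓡 2) ∞ M, m ∈ e'.source ∧
      (∀ u ∈ e'.source, u ∈ e.source ∧ e u ∈ Φ.source ∧ e' u = Φ (e u)) ∧
      (∀ q ∈ e'.target, q ∈ Φ.target ∧ Φ.symm q ∈ e.target ∧ e'.symm q = e.symm (Φ.symm q)) ∧
      e'.target ⊆ W ∧ ∃ r > 0, e'.target = Metric.ball (e' m) r := by
  have hmt : Φ (e m) ∈ (e.trans Φ).target :=
    (e.trans Φ).map_source (by rw [OpenPartialHomeomorph.trans_source]; exact ⟨hm, ha⟩)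
  obtain ⟨r, hr, hrb⟩ := Metric.mem_nhds_iff.1
    (inter_mem hW ((e.trans Φ).open_target.mem_nhds hmt))
  let O := OpenPartialHomeomorph.ofSet (Metric.ball (Φ (e m)) r) Metric.isOpen_ball
  let e' := (e.trans Φ).trans O
  have hs : e'.source = (e.source ∩ e ⁻¹' Φ.source) ∩ {u | Φ (e u) ∈ Metric.ball (Φ (e m)) r} := by
    simp only [e', O, OpenPartialHomeomorph.trans_source, OpenPartialHomeomorph.ofSet_source]
    rfl
  have ht : e'.target = Metric.ball (Φ (e m)) r := by
    ext q
    simp only [e', O, OpenPartialHomeomorph.trans_target, OpenPartialHomeomorph.ofSet_target,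
      OpenPartialHomeomorph.ofSet_symm, OpenPartialHomeomorph.ofSet_apply, mem_inter_iff,
      mem_preimage, id]
    refine ⟨fun h => h.1, fun h => ⟨h, ?_⟩⟩
    have := (hrb h).2
    rwa [OpenPartialHomeomorph.trans_target] at this
  have ht' : ∀ q ∈ e'.target, q ∈ Φ.target ∧ Φ.symm q ∈ e.target := by
    intro q hq
    rw [ht] at hq
    have := (hrb hq).2
    rwa [OpenPartialHomeomorph.trans_target] at this
  refine ⟨e', ?_, ?_, ?_, ?_, ?_, r, hr, ht⟩
  · apply OpenPartialHomeomorph.mem_maximalAtlas_of_contMDiffOn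
    · have h1 : ContMDiffOn (𝓡 2) (𝓡 2) ∞ (Φ ∘ e) e'.source :=
        (hΦ.contMDiffOn).comp ((contMDiffOn_of_mem_maximalAtlas he).mono
          (by rw [hs]; exact fun u hu => hu.1.1)) (by rw [hs]; exact fun u hu => hu.1.2)
      exact h1
    · have h1 : ContMDiffOn (𝓡 2) (𝓡 2) ∞ (e.symm ∘ Φ.symm) e'.target :=
        (contMDiffOn_symm_of_mem_maximalAtlas he).comp ((hΦ'.contMDiffOn).mono
          (fun q hq => (ht' q hq).1)) (fun q hq => (ht' q hq).2)
      exact h1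
  · rw [hs]; exact ⟨⟨hm, ha⟩, Metric.mem_ball_self hr⟩
  · intro u hu
    rw [hs] at hu
    exact ⟨hu.1.1, hu.1.2, rfl⟩
  · exact fun q hq => ⟨(ht' q hq).1, (ht' q hq).2, rfl⟩
  · rw [ht]; exact fun q hq => (hrb hq).1

/-- New charts from a local diffeomorphism starting at the given chart. -/
theorem exists_chart_forward {e : OpenPartialHomeomorph M E2}
    (he : e ∈ IsManifold.maximalAtlas (𝓡 2) ∞ M) {m : M} (hm : m ∈ e.source) {V : Set E2}
    (hV : IsOpen V) {φ : E2 → E2} (hφ : ContDiffOn ℝ ∞ φ V) (ha : e m ∈ V)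
    (hinj : Function.Injective (fderiv ℝ φ (e m))) {W : Set E2} (hW : W ∈ 𝓝 (φ (e m))) :
    ∃ e' ∈ IsManifold.maximalAtlas (𝓡 2) ∞ M, m ∈ e'.source ∧
      (∀ u ∈ e'.source, u ∈ e.source ∧ e u ∈ V ∧ e' u = φ (e u)) ∧
      e'.target ⊆ W ∧ ∃ r > 0, e'.target = Metric.ball (e' m) r := by
  obtain ⟨Φ, h1, h2, h3, h4, h5⟩ := exists_local_diffeo hV hφ ha hinj
  obtain ⟨e', he', hm', h6, -, h7, h8⟩ :=
    exists_chart_of_diffeo he hm h1 h4 h5 (W := W) (by rwa [h3 _ h1])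
  exact ⟨e', he', hm', fun u hu => ⟨(h6 u hu).1, h2 (h6 u hu).2.1,
    by rw [(h6 u hu).2.2, h3 _ (h6 u hu).2.1]⟩, h7, h8⟩

/-- New charts from a local diffeomorphism into the target of the given chart. -/
theorem exists_chart_backward {e : OpenPartialHomeomorph M E2}
    (he : e ∈ IsManifold.maximalAtlas (𝓡 2) ∞ M) {m : M} (hm : m ∈ e.source) {V : Set E2}
    (hV : IsOpen V) {ψ : E2 → E2} (hψ : ContDiffOn ℝ ∞ ψ V) {q₀ : E2} (hq₀ : q₀ ∈ V)
    (hψ₀ : ψ q₀ = e m) (hinj : Function.Injective (fderiv ℝ ψ q₀)) :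
    ∃ e' ∈ IsManifold.maximalAtlas (𝓡 2) ∞ M, m ∈ e'.source ∧ e' m = q₀ ∧
      (∀ q ∈ e'.target, q ∈ V ∧ ψ q ∈ e.target ∧ e'.symm q = e.symm (ψ q)) ∧
      ∃ r > 0, e'.target = Metric.ball q₀ r := by
  obtain ⟨Φ, h1, h2, h3, h4, h5⟩ := exists_local_diffeo hV hψ hq₀ hinj
  have h9 : e m = Φ q₀ := by rw [h3 _ h1, hψ₀]
  have h10 : Φ.symm (e m) = q₀ := by rw [h9, Φ.left_inv h1]
  obtain ⟨e', he', hm', h6, h7, -, h8⟩ :=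
    exists_chart_of_diffeo he hm (Φ := Φ.symm) (by rw [h9]; exact Φ.map_source h1) h5
      (by simpa using h4) univ_mem
  have h11 : e' m = q₀ := by rw [(h6 m hm').2.2, h10]
  refine ⟨e', he', hm', h11, fun q hq => ?_, by rwa [h11] at h8⟩
  obtain ⟨ha, hb, hc⟩ := h7 q hq
  simp only [OpenPartialHomeomorph.symm_target, OpenPartialHomeomorph.symm_symm] at ha hb hc
  rw [h3 q ha] at hb hc
  exact ⟨h2 ha, hb, hc⟩

end Charts

/-! ### Regularity and smoothness of the unit normal. -/

section UnitNormal

variable {y : E2 → E3} {q : E2} {U : Set E2}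

theorem cross_partialD_ne_zero (h : Function.Injective (fderiv ℝ y q)) :
    cross (partialD 0 y q) (partialD 1 y q) ≠ 0 := by
  apply cross_ne_zero_of_independent
  intro c d hcd
  have h1 := fderiv_apply_eq y q (!₂[c, d])
  simp only [Matrix.cons_val_zero, Matrix.cons_val_one] at h1
  rw [hcd] at h1
  have h2 := h (h1.trans (map_zero _).symm)
  exact ⟨by simpa using congrArg (fun v : E2 => v 0) h2,
    by simpa using congrArg (fun v : E2 => v 1) h2⟩

theorem norm_unitNormal (h : cross (partialD 0 y q) (partialD 1 y q) ≠ 0) :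
    ‖unitNormal y q‖ = 1 := by
  rw [unitNormal, norm_smul, norm_inv, norm_norm]
  exact inv_mul_cancel₀ (norm_ne_zero_iff.2 h)

theorem inner_partialD_unitNormal (i : Fin 2) : inner ℝ (partialD i y q) (unitNormal y q) = 0 := by
  rw [unitNormal, inner_smul_right]
  fin_cases i
  · simp [inner_cross_left]
  · simp [inner_cross_right]

theorem contDiffOn_cross {f g : E2 → E3} (hf : ContDiffOn ℝ ∞ f U) (hg : ContDiffOn ℝ ∞ g U) :
    ContDiffOn ℝ ∞ (fun q => cross (f q) (g q)) U := by
  have hf' := contDiffOn_euclidean.1 hf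
  have hg' := contDiffOn_euclidean.1 hg
  rw [contDiffOn_euclidean]
  intro i
  fin_cases i
  · exact (((hf' 1).mul (hg' 2)).sub ((hf' 2).mul (hg' 1))).congr fun q _ => cross_zero _ _
  · exact (((hf' 2).mul (hg' 0)).sub ((hf' 0).mul (hg' 2))).congr fun q _ => cross_one _ _
  · exact (((hf' 0).mul (hg' 1)).sub ((hf' 1).mul (hg' 0))).congr fun q _ => cross_two _ _

theorem contDiffOn_normalize {f : E2 → E3} (hf : ContDiffOn ℝ ∞ f U) (h : ∀ q ∈ U, f q ≠ 0) :
    ContDiffOn ℝ ∞ (fun q => ‖f q‖⁻¹ • f q) U :=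
  ((hf.norm ℝ h).inv (fun q hq => norm_ne_zero_iff.2 (h q hq))).smul hf

theorem contDiffOn_unitNormal (hU : IsOpen U) (hy : ContDiffOn ℝ ∞ y U)
    (h : ∀ q ∈ U, cross (partialD 0 y q) (partialD 1 y q) ≠ 0) :
    ContDiffOn ℝ ∞ (unitNormal y) U :=
  contDiffOn_normalize (contDiffOn_cross (contDiffOn_partialD hU hy 0)
    (contDiffOn_partialD hU hy 1)) h

theorem det_firstForm : (firstForm y q).det = ‖cross (partialD 0 y q) (partialD 1 y q)‖ ^ 2 := by
  rw [Matrix.det_fin_two, norm_cross_sq]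
  simp only [firstForm, Matrix.of_apply, real_inner_self_eq_norm_sq]
  rw [real_inner_comm (partialD 0 y q) (partialD 1 y q)]
  ring

theorem det_secondForm_eq_zero (h : cross (partialD 0 y q) (partialD 1 y q) ≠ 0)
    (hK : gaussCurvature y q = 0) : (secondForm y q).det = 0 := by
  rw [gaussCurvature, div_eq_zero_iff, det_firstForm] at hK
  exact hK.resolve_right (pow_ne_zero 2 (norm_ne_zero_iff.2 h))

theorem partialD_inner_eq_zero {f g : E2 → E3} (hU : IsOpen U) (hf : ContDiffOn ℝ ∞ f U)
    (hg : ContDiffOn ℝ ∞ g U) {c : ℝ} (h : ∀ q ∈ U, inner ℝ (f q) (g q) = c) (hq : q ∈ U)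
    (i : Fin 2) : inner ℝ (partialD i f q) (g q) + inner ℝ (f q) (partialD i g q) = 0 := by
  rw [← partialD_inner (diffAt hf hU hq) (diffAt hg hU hq),
    partialD_congr_on hU (g := fun _ => c) h hq, partialD_const]

end UnitNormal

/-! ### The Poincaré lemma on convex plane domains. -/

section Primitive

variable {U : Set E2}

/-- The Poincaré lemma in two variables. -/
theorem exists_primitive (hU : IsOpen U) (hc : Convex ℝ U) {η : Fin 2 → E2 → ℝ}
    (hη : ∀ i, ContDiffOn ℝ ∞ (η i) U)
    (hcl : ∀ q ∈ U, partialD 0 (η 1) q = partialD 1 (η 0) q) :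
    ∃ f : E2 → ℝ, ContDiffOn ℝ ∞ f U ∧ ∀ q ∈ U, ∀ i, partialD i f q = η i q := by
  let p : Fin 2 → E2 →L[ℝ] ℝ := fun i => EuclideanSpace.proj i
  let Θ : E2 → E2 →L[ℝ] ℝ := fun q => η 0 q • p 0 + η 1 q • p 1
  have hΘ : ContDiffOn ℝ ∞ Θ U :=
    ((hη 0).smul contDiffOn_const).add ((hη 1).smul contDiffOn_const)
  have hd : ∀ q ∈ U, ∀ v w, fderiv ℝ Θ q v w
      = fderiv ℝ (η 0) q v * w 0 + fderiv ℝ (η 1) q v * w 1 := by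
    intro q hq v w
    have h0 := ((diffAt (hη 0) hU hq).hasFDerivAt.smul_const (p 0)).add
      ((diffAt (hη 1) hU hq).hasFDerivAt.smul_const (p 1))
    have h1 : fderiv ℝ Θ q = _ := h0.fderiv
    rw [h1]
    simp [p]
  obtain ⟨f, hf⟩ := hc.exists_forall_hasFDerivAt_of_fderiv_symmetric hU
    (hΘ.differentiableOn (by simp)) (fun q hq v w => by
      rw [hd q hq, hd q hq, fderiv_apply_eq, fderiv_apply_eq, fderiv_apply_eq, fderiv_apply_eq]
      have := hcl q hq
      simp only [smul_eq_mul]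
      linear_combination (v 0 * w 1 - v 1 * w 0) * this)
  refine ⟨f, ?_, fun q hq i => ?_⟩
  · rw [contDiffOn_infty_iff_fderiv_of_isOpen hU]
    exact ⟨fun q hq => (hf q hq).differentiableAt.differentiableWithinAt,
      hΘ.congr fun q hq => (hf q hq).fderiv⟩
  · rw [partialD, (hf q hq).fderiv]
    fin_cases i <;> simp [Θ, p]

end Primitive

/-! ### Vanishing Gaussian curvature gives Euclidean coordinates. -/

section FlatCoordinates

variable {y : E2 → E3} {U : Set E2}

/-- A smooth orthonormal frame of the tangent planes, completed by the unit normal. -/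
theorem exists_tangent_frame (hU : IsOpen U) (hy : ContDiffOn ℝ ∞ y U)
    (h : ∀ q ∈ U, cross (partialD 0 y q) (partialD 1 y q) ≠ 0) :
    ∃ e₁ e₂ : E2 → E3, ContDiffOn ℝ ∞ e₁ U ∧ ContDiffOn ℝ ∞ e₂ U ∧
      ∀ q ∈ U, IsFrame (e₁ q) (e₂ q) (unitNormal y q) := by
  have h0 : ∀ q ∈ U, partialD 0 y q ≠ 0 := by
    intro q hq h0
    apply h q hq
    rw [h0, ← zero_smul ℝ (0 : E3), cross_smul_left, zero_smul, zero_smul]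
  have hn := contDiffOn_unitNormal hU hy h
  have he₁ := contDiffOn_normalize (contDiffOn_partialD hU hy 0) h0
  refine ⟨_, fun q => cross (unitNormal y q) (‖partialD 0 y q‖⁻¹ • partialD 0 y q), he₁,
    contDiffOn_cross hn he₁, fun q hq => ?_⟩
  have h1 : ‖‖partialD 0 y q‖⁻¹ • partialD 0 y q‖ = 1 := by
    rw [norm_smul, norm_inv, norm_norm]
    exact inv_mul_cancel₀ (norm_ne_zero_iff.2 (h0 q hq))
  have h2 : inner ℝ (unitNormal y q) (‖partialD 0 y q‖⁻¹ • partialD 0 y q) = 0 := by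
    rw [inner_smul_right, real_inner_comm, inner_partialD_unitNormal, mul_zero]
  have h3 := IsFrame.of_cross (norm_unitNormal (h q hq)) h1 h2
  exact ⟨h3.vv, h3.ww, h3.uu, h3.vw, h3.vu, h3.wu⟩

/-- On a flat surface there is a frame of the tangent planes whose derivatives are normal. -/
theorem exists_parallel_frame (hU : IsOpen U) (hc : Convex ℝ U) (hy : ContDiffOn ℝ ∞ y U)
    (h : ∀ q ∈ U, cross (partialD 0 y q) (partialD 1 y q) ≠ 0)
    (hK : ∀ q ∈ U, gaussCurvature y q = 0) :
    ∃ e₁ e₂ : E2 → E3, ContDiffOn ℝ ∞ e₁ U ∧ ContDiffOn ℝ ∞ e₂ U ∧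
      (∀ q ∈ U, IsFrame (e₁ q) (e₂ q) (unitNormal y q)) ∧
      ∀ q ∈ U, ∀ i, inner ℝ (partialD i e₁ q) (e₂ q) = 0 := by
  obtain ⟨e₁, e₂, he₁, he₂, hfr⟩ := exists_tangent_frame hU hy h
  set ξ := unitNormal y with hξ
  have hsξ : ContDiffOn ℝ ∞ ξ U := contDiffOn_unitNormal hU hy h
  have d₁ : ∀ q ∈ U, DifferentiableAt ℝ e₁ q := fun q hq => diffAt he₁ hU hq
  have d₂ : ∀ q ∈ U, DifferentiableAt ℝ e₂ q := fun q hq => diffAt he₂ hU hq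
  have r11 : ∀ q ∈ U, ∀ i, inner ℝ (partialD i e₁ q) (e₁ q) = 0 := fun q hq i => by
    have := partialD_inner_eq_zero hU he₁ he₁ (fun q hq => (hfr q hq).uu') hq i
    rw [real_inner_comm (partialD i e₁ q) (e₁ q)] at this; linarith
  have r22 : ∀ q ∈ U, ∀ i, inner ℝ (partialD i e₂ q) (e₂ q) = 0 := fun q hq i => by
    have := partialD_inner_eq_zero hU he₂ he₂ (fun q hq => (hfr q hq).vv') hq i
    rw [real_inner_comm (partialD i e₂ q) (e₂ q)] at this; linarith
  have r12 : ∀ q ∈ U, ∀ i, inner ℝ (partialD i e₁ q) (e₂ q)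
      + inner ℝ (e₁ q) (partialD i e₂ q) = 0 :=
    fun q hq i => partialD_inner_eq_zero hU he₁ he₂ (fun q hq => (hfr q hq).uv) hq i
  have r1ξ : ∀ q ∈ U, ∀ i, inner ℝ (partialD i e₁ q) (ξ q) + inner ℝ (e₁ q) (partialD i ξ q) = 0 :=
    fun q hq i => partialD_inner_eq_zero hU he₁ hsξ (fun q hq => (hfr q hq).uw) hq i
  have r2ξ : ∀ q ∈ U, ∀ i, inner ℝ (partialD i e₂ q) (ξ q) + inner ℝ (e₂ q) (partialD i ξ q) = 0 :=
    fun q hq i => partialD_inner_eq_zero hU he₂ hsξ (fun q hq => (hfr q hq).vw) hq i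
  have rξξ : ∀ q ∈ U, ∀ i, inner ℝ (partialD i ξ q) (ξ q) = 0 := fun q hq i => by
    have := partialD_inner_eq_zero hU hsξ hsξ (fun q hq => (hfr q hq).ww') hq i
    rw [real_inner_comm (partialD i ξ q) (ξ q)] at this; linarith
  -- the shape operator has determinant zero
  have hdet : ∀ q ∈ U, inner ℝ (partialD 0 e₁ q) (ξ q) * inner ℝ (partialD 1 e₂ q) (ξ q)
      - inner ℝ (partialD 1 e₁ q) (ξ q) * inner ℝ (partialD 0 e₂ q) (ξ q) = 0 := by
    intro q hq
    have hd := det_secondForm_eq_zero (h q hq) (hK q hq)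
    have hh : ∀ i j, secondForm y q i j
        = inner ℝ (partialD j y q) (e₁ q) * inner ℝ (partialD i e₁ q) (ξ q)
          + inner ℝ (partialD j y q) (e₂ q) * inner ℝ (partialD i e₂ q) (ξ q) := by
      intro i j
      have h1 := partialD_inner_eq_zero hU (contDiffOn_partialD hU hy j) hsξ
        (fun q _ => inner_partialD_unitNormal (y := y) j) hq i
      have h2 : secondForm y q i j = inner ℝ (partialD i (partialD j y) q) (ξ q) := rfl
      have h3 := (hfr q hq).inner_expand (partialD j y q) (partialD i ξ q)
      rw [rξξ q hq i, mul_zero, add_zero] at h3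
      rw [h2]
      have h4 := r1ξ q hq i
      have h5 := r2ξ q hq i
      rw [real_inner_comm (partialD i ξ q)] at h4 h5
      linear_combination h1 - h3 - inner ℝ (partialD j y q) (e₁ q) * h4
        - inner ℝ (partialD j y q) (e₂ q) * h5
    -- By `hh` the matrix of the second form is a product of two matrices: the components of the ∂ⱼy
    -- in the frame, and the normal components of the derivatives of the frame. The squared
    -- determinant of the first is |∂₀y × ∂₁y|² ≠ 0, so the determinant of the second must vanish.
    have hg : inner ℝ (partialD 0 y q) (e₁ q) * inner ℝ (partialD 1 y q) (e₂ q)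
        - inner ℝ (partialD 1 y q) (e₁ q) * inner ℝ (partialD 0 y q) (e₂ q) ≠ 0 := by
      intro h0
      apply h q hq
      rw [← norm_eq_zero, ← sq_eq_zero_iff, norm_cross_sq, ← real_inner_self_eq_norm_sq,
        ← real_inner_self_eq_norm_sq]
      rw [(hfr q hq).inner_expand (partialD 0 y q) (partialD 0 y q),
        (hfr q hq).inner_expand (partialD 0 y q) (partialD 1 y q),
        (hfr q hq).inner_expand (partialD 1 y q) (partialD 1 y q)]
      rw [hξ, inner_partialD_unitNormal, inner_partialD_unitNormal]
      linear_combination (inner ℝ (partialD 0 y q) (e₁ q) * inner ℝ (partialD 1 y q) (e₂ q)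
        - inner ℝ (partialD 1 y q) (e₁ q) * inner ℝ (partialD 0 y q) (e₂ q)) * h0
    rw [Matrix.det_fin_two, hh, hh, hh, hh] at hd
    have := mul_eq_zero (a := inner ℝ (partialD 0 y q) (e₁ q) * inner ℝ (partialD 1 y q) (e₂ q)
        - inner ℝ (partialD 1 y q) (e₁ q) * inner ℝ (partialD 0 y q) (e₂ q))
        (b := inner ℝ (partialD 0 e₁ q) (ξ q) * inner ℝ (partialD 1 e₂ q) (ξ q)
      - inner ℝ (partialD 1 e₁ q) (ξ q) * inner ℝ (partialD 0 e₂ q) (ξ q))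
    exact (this.1 (by linear_combination hd)).resolve_left hg
  -- the connection form is closed
  have dd : ∀ q ∈ U, ∀ i, DifferentiableAt ℝ (partialD i e₁) q :=
    fun q hq i => diffAt (contDiffOn_partialD hU he₁ i) hU hq
  -- Let ωᵢ = ⟨∂ᵢe₁, e₂⟩. Since ∂ᵢe₁ ⟂ e₁ and ∂ᵢe₂ ⟂ e₂, only normal components contribute to dω,
  -- and they combine to the determinant in `hdet`. Turning the frame by an angle θ adds dθ to ω, so
  -- dθ = -ω makes the turned frame parallel.
  obtain ⟨θ, hθ, hdθ⟩ := exists_primitive hU hc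
    (η := fun i q => -inner ℝ (partialD i e₁ q) (e₂ q))
    (fun i => ((contDiffOn_partialD hU he₁ i).inner ℝ he₂).neg) (by
      intro q hq
      rw [partialD_neg, partialD_neg, partialD_inner (dd q hq 1) (d₂ q hq),
        partialD_inner (dd q hq 0) (d₂ q hq), partialD_comm hU he₁ hq 0 1,
        (hfr q hq).inner_expand (partialD 1 e₁ q), (hfr q hq).inner_expand (partialD 0 e₁ q),
        r11 q hq, r11 q hq, r22 q hq, r22 q hq]
      linear_combination hdet q hq)
  have dθ : ∀ q ∈ U, DifferentiableAt ℝ θ q := fun q hq => diffAt hθ hU hq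
  have hcos : ContDiffOn ℝ ∞ (fun q => Real.cos (θ q)) U := Real.contDiff_cos.comp_contDiffOn hθ
  have hsin : ContDiffOn ℝ ∞ (fun q => Real.sin (θ q)) U := Real.contDiff_sin.comp_contDiffOn hθ
  refine ⟨fun q => Real.cos (θ q) • e₁ q + Real.sin (θ q) • e₂ q,
    fun q => Real.cos (θ q) • e₂ q - Real.sin (θ q) • e₁ q,
    (hcos.smul he₁).add (hsin.smul he₂), (hcos.smul he₂).sub (hsin.smul he₁), ?_, ?_⟩
  · intro q hq
    have f := hfr q hq
    have key := Real.sin_sq_add_cos_sq (θ q)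
    refine ⟨?_, ?_, f.ww, ?_, ?_, ?_⟩
    · rw [← sq_eq_sq₀ (norm_nonneg _) zero_le_one, ← real_inner_self_eq_norm_sq]
      simp only [inner_add_left, inner_add_right, inner_smul_left, inner_smul_right, f.uu', f.vv',
        f.uv, f.vu, conj_trivial]
      linear_combination key
    · rw [← sq_eq_sq₀ (norm_nonneg _) zero_le_one, ← real_inner_self_eq_norm_sq]
      simp only [inner_sub_left, inner_sub_right, inner_smul_left, inner_smul_right, f.uu', f.vv',
        f.uv, f.vu, conj_trivial]
      linear_combination key
    · simp only [inner_add_left, inner_sub_right, inner_smul_left, inner_smul_right, f.uu', f.vv',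
        f.uv, f.vu, conj_trivial]
      ring
    · simp only [inner_add_left, inner_smul_left, f.uw, f.vw]
      ring
    · simp only [inner_sub_left, inner_smul_left, f.uw, f.vw]
      ring
  · intro q hq i
    have f := hfr q hq
    have dc : partialD i (fun q => Real.cos (θ q)) q = -Real.sin (θ q) * partialD i θ q := by
      rw [partialD_comp_real Real.differentiable_cos.differentiableAt (dθ q hq), Real.deriv_cos,
        smul_eq_mul]; ring
    have ds : partialD i (fun q => Real.sin (θ q)) q = Real.cos (θ q) * partialD i θ q := by
      rw [partialD_comp_real Real.differentiable_sin.differentiableAt (dθ q hq), Real.deriv_sin,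
        smul_eq_mul]; ring
    have dc' := diffAt hcos hU hq
    have ds' := diffAt hsin hU hq
    rw [partialD_add (dc'.fun_smul (d₁ q hq)) (ds'.fun_smul (d₂ q hq)),
      partialD_smul dc' (d₁ q hq), partialD_smul ds' (d₂ q hq), dc, ds, hdθ q hq i]
    simp only [inner_add_left, inner_sub_right, inner_smul_left, inner_smul_right, f.uu', f.vv',
        f.uv, f.vu, conj_trivial, r11 q hq, r22 q hq]
    have r := r12 q hq i
    rw [real_inner_comm (partialD i e₂ q) (e₁ q)] at r
    linear_combination (-Real.sin (θ q) ^ 2) * r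

variable {M : Type*} [TopologicalSpace M] [ChartedSpace E2 M] [IsManifold (𝓡 2) ∞ M]

/-- A flat surface has flat coordinates. -/
theorem exists_flat_chart {x : M → E3} (hx : IsSmoothImmersion x) (hflat : IsFlat x) (m : M) :
    ∃ e ∈ IsManifold.maximalAtlas (𝓡 2) ∞ M, m ∈ e.source ∧
      (∃ r > 0, e.target = Metric.ball (e m) r) ∧
      ∀ q ∈ e.target, firstForm (x ∘ e.symm) q = 1 := by
  set e₀ := chartAt E2 m
  have he₀ : e₀ ∈ IsManifold.maximalAtlas (𝓡 2) ∞ M := IsManifold.chart_mem_maximalAtlas m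
  have hm₀ : m ∈ e₀.source := mem_chart_source E2 m
  obtain ⟨r, hr, hrb⟩ := Metric.mem_nhds_iff.1 (e₀.open_target.mem_nhds (e₀.map_source hm₀))
  set U := Metric.ball (e₀ m) r
  have hU : IsOpen U := Metric.isOpen_ball
  set y := x ∘ e₀.symm
  have hy : ContDiffOn ℝ ∞ y U := (contDiffOn_param hx he₀).mono hrb
  have hinj : ∀ q ∈ U, Function.Injective (fderiv ℝ y q) :=
    fun q hq => injective_fderiv_param hx he₀ (hrb hq)
  have hcr : ∀ q ∈ U, cross (partialD 0 y q) (partialD 1 y q) ≠ 0 :=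
    fun q hq => cross_partialD_ne_zero (hinj q hq)
  obtain ⟨e₁, e₂, he₁, he₂, hfr, hpar⟩ := exists_parallel_frame hU (convex_ball _ _) hy hcr
    (fun q hq => hflat e₀ he₀ q (hrb hq))
  have hsξ : ContDiffOn ℝ ∞ (unitNormal y) U := contDiffOn_unitNormal hU hy hcr
  have hpar' : ∀ q ∈ U, ∀ i, inner ℝ (partialD i e₂ q) (e₁ q) = 0 := fun q hq i => by
    have := partialD_inner_eq_zero hU he₁ he₂ (fun q hq => (hfr q hq).uv) hq i
    rw [hpar q hq, zero_add, real_inner_comm] at this; exact this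
  -- If the derivatives of a field f are normal to the surface, the form ⟨dy, f⟩ is closed. Its
  -- primitives for f = e₁, e₂ are the flat coordinates: dy = du₁ e₁ + du₂ e₂.
  have prim : ∀ f : E2 → E3, ContDiffOn ℝ ∞ f U →
      (∀ q ∈ U, ∀ i j, inner ℝ (partialD j y q) (partialD i f q) = 0) →
      ∃ u : E2 → ℝ, ContDiffOn ℝ ∞ u U ∧ ∀ q ∈ U, ∀ i,
        partialD i u q = inner ℝ (partialD i y q) (f q) := by
    intro f hf h0
    refine exists_primitive hU (convex_ball _ _)
      (fun i => (contDiffOn_partialD hU hy i).inner ℝ hf) (fun q hq => ?_)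
    rw [partialD_inner (diffAt (contDiffOn_partialD hU hy 1) hU hq) (diffAt hf hU hq),
      partialD_inner (diffAt (contDiffOn_partialD hU hy 0) hU hq) (diffAt hf hU hq),
      partialD_comm hU hy hq 0 1, h0 q hq, h0 q hq]
  obtain ⟨u₁, hu₁, hdu₁⟩ := prim e₁ he₁ (fun q hq i j => by
    have h1 := partialD_inner_eq_zero hU he₁ he₁ (fun q hq => (hfr q hq).uu') hq i
    rw [real_inner_comm (partialD i e₁ q) (e₁ q)] at h1
    rw [(hfr q hq).inner_expand, inner_partialD_unitNormal, hpar q hq,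
      show inner ℝ (partialD i e₁ q) (e₁ q) = 0 by linarith]
    ring)
  obtain ⟨u₂, hu₂, hdu₂⟩ := prim e₂ he₂ (fun q hq i j => by
    have h1 := partialD_inner_eq_zero hU he₂ he₂ (fun q hq => (hfr q hq).vv') hq i
    rw [real_inner_comm (partialD i e₂ q) (e₂ q)] at h1
    rw [(hfr q hq).inner_expand, inner_partialD_unitNormal, hpar' q hq,
      show inner ℝ (partialD i e₂ q) (e₂ q) = 0 by linarith]
    ring)
  let φ : E2 → E2 := fun q => !₂[u₁ q, u₂ q]
  have hφ : ContDiffOn ℝ ∞ φ U := by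
    rw [contDiffOn_euclidean]
    intro i
    fin_cases i
    · exact hu₁
    · exact hu₂
  have hdφ : ∀ q ∈ U, ∀ v, fderiv ℝ y q v
      = fderiv ℝ φ q v 0 • e₁ q + fderiv ℝ φ q v 1 • e₂ q := by
    intro q hq v
    have hp : ∀ i, partialD i y q = partialD i φ q 0 • e₁ q + partialD i φ q 1 • e₂ q := by
      intro i
      rw [← partialD_apply (diffAt hφ hU hq), ← partialD_apply (diffAt hφ hU hq)]
      have h1 := hdu₁ q hq i
      have h2 := hdu₂ q hq i
      have h3 := (hfr q hq).expand (partialD i y q)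
      rw [inner_partialD_unitNormal, ← h1, ← h2, zero_smul, add_zero] at h3
      exact h3
    rw [fderiv_apply_eq, fderiv_apply_eq φ, hp 0, hp 1]
    simp only [PiLp.add_apply, PiLp.smul_apply, smul_eq_mul]
    module
  obtain ⟨e, he, hme, hsrc, -, hball⟩ := exists_chart_forward he₀ hm₀ hU hφ
    (Metric.mem_ball_self hr) (fun v w hvw => hinj _ (Metric.mem_ball_self hr) (by
      rw [hdφ _ (Metric.mem_ball_self hr), hvw, ← hdφ _ (Metric.mem_ball_self hr)])) univ_mem
  refine ⟨e, he, hme, hball, fun p hp => ?_⟩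
  obtain ⟨hs, hq, hep⟩ := hsrc _ (e.map_target hp)
  rw [e.right_inv hp] at hep
  set q := e₀ (e.symm p) with hqdef
  set z := x ∘ e.symm
  have hz : DifferentiableAt ℝ z p := diffAt (contDiffOn_param hx he) e.open_target hp
  have hev : y =ᶠ[𝓝 q] fun r => z (φ r) := by
    have h1 : ∀ᶠ r in 𝓝 q, r ∈ e₀.target ∧ e₀.symm r ∈ e.source :=
      (e₀.open_target.eventually_mem (hrb hq)).and
        ((e₀.continuousAt_symm (hrb hq)).eventually_mem (e.open_source.mem_nhds (by
          rw [hqdef, e₀.left_inv hs]; exact e.map_target hp)))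
    filter_upwards [h1] with r hr
    obtain ⟨-, -, h4⟩ := hsrc _ hr.2
    rw [e₀.right_inv hr.1] at h4
    change x (e₀.symm r) = x (e.symm (φ r))
    rw [← h4, e.left_inv hr.2]
  have hcomp : ∀ v, fderiv ℝ y q v = fderiv ℝ z p (fderiv ℝ φ q v) := by
    intro v
    have hz' : HasFDerivAt z (fderiv ℝ z p) (φ q) := by rw [← hep]; exact hz.hasFDerivAt
    have h1 : HasFDerivAt (fun r => z (φ r)) ((fderiv ℝ z p).comp (fderiv ℝ φ q)) q :=
      hz'.comp q (diffAt hφ hU hq).hasFDerivAt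
    rw [hev.fderiv_eq, h1.fderiv]
    rfl
  have hsurj : Function.Surjective (fderiv ℝ φ q) :=
    LinearMap.surjective_of_injective (f := (fderiv ℝ φ q : E2 →ₗ[ℝ] E2)) (fun v w hvw => by
      apply hinj q hq
      rw [hcomp, hcomp]
      exact congrArg _ hvw)
  -- In the coordinates (u₁, u₂) the coordinate fields are e₁ and e₂ themselves. The surjectivity of
  -- dφ is what determines Dz on every vector.
  have hD : ∀ w, fderiv ℝ z p w = w 0 • e₁ q + w 1 • e₂ q := by
    intro w
    obtain ⟨v, rfl⟩ := hsurj w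
    rw [← hcomp, hdφ q hq]
  have hz0 : partialD 0 z p = e₁ q := by rw [partialD, hD]; simp
  have hz1 : partialD 1 z p = e₂ q := by rw [partialD, hD]; simp
  have f := hfr q hq
  ext i j
  simp only [firstForm, Matrix.of_apply]
  fin_cases i <;> fin_cases j <;> simp [hz0, hz1, f.uu, f.vv, f.uv, f.vu]

end FlatCoordinates

/-! ### Wirtinger derivatives and the identity theorem. -/

section Wirtinger

open ComplexConjugate

/-- The Wirtinger derivative `∂f/∂z`. -/
noncomputable def dz (f : E2 → ℂ) (q : E2) : ℂ :=
  (partialD 0 f q - Complex.I * partialD 1 f q) / 2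

/-- The Wirtinger derivative `∂f/∂z̄`. -/
noncomputable def dzb (f : E2 → ℂ) (q : E2) : ℂ :=
  (partialD 0 f q + Complex.I * partialD 1 f q) / 2

/-- The complex coordinate of the plane. -/
noncomputable def toC (q : E2) : ℂ := ⟨q 0, q 1⟩

variable {f g : E2 → ℂ} {U : Set E2} {q : E2}

theorem contDiffOn_dz (hU : IsOpen U) (hf : ContDiffOn ℝ ∞ f U) : ContDiffOn ℝ ∞ (dz f) U :=
  ((contDiffOn_partialD hU hf 0).sub (contDiffOn_const.mul (contDiffOn_partialD hU hf 1))).div_const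
    2

theorem contDiffOn_conj (hf : ContDiffOn ℝ ∞ f U) : ContDiffOn ℝ ∞ (fun q => conj (f q)) U :=
  Complex.conjCLE.contDiff.comp_contDiffOn hf

theorem dz_congr (hU : IsOpen U) (h : EqOn f g U) (hq : q ∈ U) : dz f q = dz g q := by
  rw [dz, dz, partialD_congr_on hU h hq, partialD_congr_on hU h hq]

theorem dzb_congr (hU : IsOpen U) (h : EqOn f g U) (hq : q ∈ U) : dzb f q = dzb g q := by
  rw [dzb, dzb, partialD_congr_on hU h hq, partialD_congr_on hU h hq]

theorem dz_const (c : ℂ) (q : E2) : dz (fun _ => c) q = 0 := by simp [dz, partialD_const]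

theorem dzb_const (c : ℂ) (q : E2) : dzb (fun _ => c) q = 0 := by simp [dzb, partialD_const]

theorem dz_add (hf : DifferentiableAt ℝ f q) (hg : DifferentiableAt ℝ g q) :
    dz (fun r => f r + g r) q = dz f q + dz g q := by
  simp only [dz, partialD_add hf hg]; ring

theorem dzb_add (hf : DifferentiableAt ℝ f q) (hg : DifferentiableAt ℝ g q) :
    dzb (fun r => f r + g r) q = dzb f q + dzb g q := by
  simp only [dzb, partialD_add hf hg]; ring

theorem dz_sub (hf : DifferentiableAt ℝ f q) (hg : DifferentiableAt ℝ g q) :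
    dz (fun r => f r - g r) q = dz f q - dz g q := by
  simp only [dz, partialD_sub hf hg]; ring

theorem dzb_sub (hf : DifferentiableAt ℝ f q) (hg : DifferentiableAt ℝ g q) :
    dzb (fun r => f r - g r) q = dzb f q - dzb g q := by
  simp only [dzb, partialD_sub hf hg]; ring

theorem dz_neg (f : E2 → ℂ) (q : E2) : dz (fun r => -f r) q = -dz f q := by
  simp only [dz, partialD_neg]; ring

theorem dzb_neg (f : E2 → ℂ) (q : E2) : dzb (fun r => -f r) q = -dzb f q := by
  simp only [dzb, partialD_neg]; ring

theorem dz_mul (hf : DifferentiableAt ℝ f q) (hg : DifferentiableAt ℝ g q) :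
    dz (fun r => f r * g r) q = f q * dz g q + dz f q * g q := by
  simp only [dz, partialD_cmul hf hg]; ring

theorem dzb_mul (hf : DifferentiableAt ℝ f q) (hg : DifferentiableAt ℝ g q) :
    dzb (fun r => f r * g r) q = f q * dzb g q + dzb f q * g q := by
  simp only [dzb, partialD_cmul hf hg]; ring

theorem partialD_conj (hf : DifferentiableAt ℝ f q) (i : Fin 2) :
    partialD i (fun r => conj (f r)) q = conj (partialD i f q) :=
  partialD_clm (Complex.conjCLE : ℂ →L[ℝ] ℂ) hf i

theorem dz_conj (hf : DifferentiableAt ℝ f q) : dz (fun r => conj (f r)) q = conj (dzb f q) := by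
  simp only [dz, dzb, partialD_conj hf]
  simp [sub_eq_add_neg, Complex.conj_ofNat]

theorem dzb_conj (hf : DifferentiableAt ℝ f q) : dzb (fun r => conj (f r)) q = conj (dz f q) := by
  simp only [dz, dzb, partialD_conj hf]
  simp [sub_eq_add_neg, Complex.conj_ofNat]

theorem dzb_dz (hU : IsOpen U) (hf : ContDiffOn ℝ ∞ f U) (hq : q ∈ U) :
    dzb (dz f) q = (partialD 0 (partialD 0 f) q + partialD 1 (partialD 1 f) q) / 4 := by
  have d0 := diffAt (contDiffOn_partialD hU hf 0) hU hq
  have d1 := diffAt (contDiffOn_partialD hU hf 1) hU hq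
  have h : ∀ i, partialD i (dz f) q
      = (partialD i (partialD 0 f) q - Complex.I * partialD i (partialD 1 f) q) / 2 := by
    intro i
    have h1 : dz f = fun r => (partialD 0 f r - Complex.I * partialD 1 f r) * (2 : ℂ)⁻¹ := by
      ext r; rw [dz, div_eq_mul_inv]
    rw [h1, partialD_cmul (d0.fun_sub (d1.const_mul Complex.I)) (differentiableAt_const _),
      partialD_sub d0 (d1.const_mul Complex.I), partialD_cmul (differentiableAt_const _) d1,
      partialD_const, partialD_const]
    ring
  rw [dzb, h, h, partialD_comm hU hf hq 1 0]
  linear_combination (-partialD 1 (partialD 1 f) q / 4) * Complex.I_sq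

theorem dz_dzb (hU : IsOpen U) (hf : ContDiffOn ℝ ∞ f U) (hq : q ∈ U) :
    dz (dzb f) q = (partialD 0 (partialD 0 f) q + partialD 1 (partialD 1 f) q) / 4 := by
  have d0 := diffAt (contDiffOn_partialD hU hf 0) hU hq
  have d1 := diffAt (contDiffOn_partialD hU hf 1) hU hq
  have h : ∀ i, partialD i (dzb f) q
      = (partialD i (partialD 0 f) q + Complex.I * partialD i (partialD 1 f) q) / 2 := by
    intro i
    have h1 : dzb f = fun r => (partialD 0 f r + Complex.I * partialD 1 f r) * (2 : ℂ)⁻¹ := by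
      ext r; rw [dzb, div_eq_mul_inv]
    rw [h1, partialD_cmul (d0.fun_add (d1.const_mul Complex.I)) (differentiableAt_const _),
      partialD_add d0 (d1.const_mul Complex.I), partialD_cmul (differentiableAt_const _) d1,
      partialD_const, partialD_const]
    ring
  rw [dz, h, h, partialD_comm hU hf hq 1 0]
  linear_combination (-partialD 1 (partialD 1 f) q / 4) * Complex.I_sq

theorem dzb_dz_comm (hU : IsOpen U) (hf : ContDiffOn ℝ ∞ f U) (hq : q ∈ U) :
    dzb (dz f) q = dz (dzb f) q := by rw [dzb_dz hU hf hq, dz_dzb hU hf hq]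

theorem toC_eq (q : E2) : toC q = (q 0 : ℂ) + Complex.I * (q 1 : ℂ) := by
  apply Complex.ext <;> simp [toC]

theorem contDiff_toC : ContDiff ℝ ∞ toC := by
  have : toC = fun q : E2 => (q 0 : ℂ) + Complex.I * (q 1 : ℂ) := funext toC_eq
  rw [this]
  have h : ∀ i : Fin 2, ContDiff ℝ ∞ (fun q : E2 => ((q i : ℝ) : ℂ)) := fun i =>
    Complex.ofRealCLM.contDiff.comp (contDiff_euclidean.1 contDiff_id i)
  exact (h 0).add (contDiff_const.mul (h 1))

theorem partialD_ofReal {u : E2 → ℝ} (hu : DifferentiableAt ℝ u q) (i : Fin 2) :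
    partialD i (fun r => ((u r : ℝ) : ℂ)) q = ((partialD i u q : ℝ) : ℂ) :=
  partialD_clm Complex.ofRealCLM hu i

theorem partialD_toC (i : Fin 2) (q : E2) :
    partialD i toC q = if i = 0 then 1 else Complex.I := by
  have hc : ∀ k : Fin 2, DifferentiableAt ℝ (fun r : E2 => r k) q := fun k =>
    (contDiff_euclidean.1 (contDiff_id (n := ∞)) k).differentiable (by simp) q
  have hc' : ∀ k : Fin 2, DifferentiableAt ℝ (fun r : E2 => ((r k : ℝ) : ℂ)) q := fun k =>
    Complex.ofRealCLM.differentiableAt.comp q (hc k)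
  have : toC = fun q : E2 => (q 0 : ℂ) + Complex.I * (q 1 : ℂ) := funext toC_eq
  rw [this, partialD_add (hc' 0) ((hc' 1).const_mul Complex.I),
    partialD_cmul (differentiableAt_const _) (hc' 1), partialD_const, partialD_ofReal (hc 0),
    partialD_ofReal (hc 1), partialD_coord, partialD_coord]
  fin_cases i <;> simp

theorem dz_toC (q : E2) : dz toC q = 1 := by
  simp only [dz, partialD_toC]
  simp

theorem dzb_toC (q : E2) : dzb toC q = 0 := by
  simp only [dzb, partialD_toC]
  simp

theorem partialD_eq_zero_of_dz (h : dz f q = 0) (hb : dzb f q = 0) (i : Fin 2) :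
    partialD i f q = 0 := by
  simp only [dz, dzb, div_eq_zero_iff, two_ne_zero, or_false] at h hb
  fin_cases i
  · change partialD 0 f q = 0
    linear_combination (h + hb) / 2
  · change partialD 1 f q = 0
    linear_combination (Complex.I / 2) * (h - hb) + partialD 1 f q * Complex.I_sq

theorem eq_of_dz_eq_zero (hU : IsOpen U) (hc : Convex ℝ U) (hf : ContDiffOn ℝ ∞ f U)
    (h : ∀ q ∈ U, dz f q = 0) (hb : ∀ q ∈ U, dzb f q = 0) {p q : E2} (hp : p ∈ U) (hq : q ∈ U) :
    f p = f q :=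
  eq_of_partialD_eq_zero hU hc (hf.differentiableOn (by simp))
    (fun r hr => partialD_eq_zero_of_dz (h r hr) (hb r hr)) hp hq

/-- The inverse of `toC`, as a linear map. -/
noncomputable def fromC : ℂ →L[ℝ] E2 :=
  LinearMap.toContinuousLinearMap
    { toFun := fun z => !₂[z.re, z.im]
      map_add' := fun z w => by apply ext_E2 <;> simp
      map_smul' := fun c z => by apply ext_E2 <;> simp }

theorem fromC_apply (z : ℂ) : fromC z = !₂[z.re, z.im] := rfl

theorem fromC_toC (q : E2) : fromC (toC q) = q := by
  rw [fromC_apply]; apply ext_E2 <;> simp [toC]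

theorem toC_fromC (z : ℂ) : toC (fromC z) = z := by
  rw [fromC_apply]; apply Complex.ext <;> simp [toC]

/-- The identity theorem for holomorphic functions. -/
theorem eq_zero_of_dzb_eq_zero (hU : IsOpen U) (hc : Convex ℝ U) (hf : ContDiffOn ℝ ∞ f U)
    (hb : ∀ q ∈ U, dzb f q = 0) {p : E2} (hp : p ∈ U) (h0 : ∀ᶠ r in 𝓝 p, f r = 0) (hq : q ∈ U) :
    f q = 0 := by
  set V : Set ℂ := fromC ⁻¹' U
  have hV : IsOpen V := hU.preimage fromC.continuous
  have hVc : Convex ℝ V := hc.linear_preimage fromC.toLinearMap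
  have hd : DifferentiableOn ℂ (fun z => f (fromC z)) V := by
    intro z hz
    have h1 : HasFDerivAt (fun z => f (fromC z)) ((fderiv ℝ f (fromC z)).comp fromC) z :=
      (diffAt hf hU hz).hasFDerivAt.comp z fromC.hasFDerivAt
    -- The Cauchy–Riemann equation ∂f/∂z̄ = 0 makes the real derivative multiplication by the
    -- complex number ∂₀f.
    have h2 : HasFDerivAt (𝕜 := ℂ) (fun z => f (fromC z))
        (ContinuousLinearMap.toSpanSingleton ℂ (partialD 0 f (fromC z))) z := by
      refine hasFDerivAt_of_restrictScalars ℝ h1 ?_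
      ext w
      have h3 := hb _ hz
      simp only [dzb, div_eq_zero_iff, two_ne_zero, or_false] at h3
      have h4 : w = (w.re : ℂ) + w.im * Complex.I := (Complex.re_add_im w).symm
      simp only [ContinuousLinearMap.comp_apply, fderiv_apply_eq, fromC_apply,
        ContinuousLinearMap.coe_restrictScalars', ContinuousLinearMap.toSpanSingleton_apply,
        Complex.real_smul, smul_eq_mul] at h3 ⊢
      conv_lhs => rw [h4]
      simp only [Matrix.cons_val_zero, Matrix.cons_val_one]
      linear_combination (w.im * Complex.I) * h3 
        - w.im * partialD 1 f !₂[z.re, z.im] * Complex.I_sq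
    exact h2.differentiableAt.differentiableWithinAt
  have ha : AnalyticOnNhd ℂ (fun z => f (fromC z)) V := hd.analyticOnNhd hV
  have hp' : toC p ∈ V := by change fromC (toC p) ∈ U; rwa [fromC_toC]
  have h5 := ha.eqOn_zero_of_preconnected_of_eventuallyEq_zero hVc.isPreconnected hp' (by
    have h6 : Tendsto fromC (𝓝 (toC p)) (𝓝 p) := by
      have := fromC.continuous.tendsto (toC p)
      rwa [fromC_toC] at this
    exact h6.eventually h0)
  have h7 := h5 (x := toC q) (by change fromC (toC q) ∈ U; rwa [fromC_toC])
  simpa [fromC_toC] using h7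

end Wirtinger

/-! ### Differential consequences for the squared ruling direction P. -/

section HarmonicCodazzi

open ComplexConjugate

variable {a H P : E2 → ℂ} {U V : Set E2} {q : E2}

/-- The equations satisfied by the direction `P` of the rulings of a flat surface with harmonic
mean curvature `a`, where the latter does not vanish. -/
theorem ruling_equations (hV : IsOpen V) (ha : ContDiffOn ℝ ∞ a V) (hH : ContDiffOn ℝ ∞ H V)
    (hP : ContDiffOn ℝ ∞ P V)
    (har : ∀ q ∈ V, conj (a q) = a q) (hcod : ∀ q ∈ V, dzb H q = dz a q)
    (hharm : ∀ q ∈ V, dzb (dz a) q = 0) (hdet : ∀ q ∈ V, a q * a q = H q * conj (H q))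
    (ha0 : ∀ q ∈ V, a q ≠ 0) (hPH : ∀ q ∈ V, a q * P q = -conj (H q)) :
    ∀ q ∈ V, P q * conj (P q) = 1 ∧ dzb P q = P q * -dz P q ∧
      a q * -dz P q = conj (dz a q) + dz a q * P q ∧ P q * conj (dz P q) = dz P q ∧
      dz (dz P) q = 0 ∧ dzb (dz P) q = -(dz P q) ^ 2 ∧
      dz (dz a) q = 2 * dz a q * -conj (dz P q) := by
  have hf := contDiffOn_dz hV ha
  have hf' := contDiffOn_dz hV hf
  have hf'' := contDiffOn_dz hV hf'
  have hW := contDiffOn_dz hV hP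
  have hPc := contDiffOn_conj hP
  have hWc := contDiffOn_conj hW
  have hfc := contDiffOn_conj hf
  have hfc' := contDiffOn_conj hf'
  have dab : ∀ q ∈ V, dzb a q = conj (dz a q) := fun q hq => by
    rw [← dzb_conj (diffAt ha hV hq)]
    exact dzb_congr hV (fun r hr => (har r hr).symm) hq
  have h1 : ∀ q ∈ V, P q * conj (P q) = 1 := by
    intro q hq
    have e1 := hPH q hq
    have e2 := congrArg conj e1
    simp only [map_mul, map_neg, Complex.conj_conj, har q hq] at e2
    apply mul_left_cancel₀ (mul_ne_zero (ha0 q hq) (ha0 q hq))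
    linear_combination conj (P q) * a q * e1 - conj (H q) * e2 - hdet q hq
  -- This is ∂/∂z of aP = -H̄; the Codazzi equation enters conjugated, as (H̄)_z = conj(H_z̄) =
  -- conj(a_z).
  have h2 : ∀ q ∈ V, a q * -dz P q = conj (dz a q) + dz a q * P q := by
    intro q hq
    have e := dz_congr hV (f := fun r => a r * P r) (g := fun r => -conj (H r)) hPH hq
    rw [dz_mul (diffAt ha hV hq) (diffAt hP hV hq), dz_neg, dz_conj (diffAt hH hV hq),
      hcod q hq] at e
    linear_combination -e
  -- Because a is real and |P| = 1, P times the conjugate of `h2` has the same right-hand side as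
  -- `h2`.
  have h3 : ∀ q ∈ V, P q * conj (dz P q) = dz P q := by
    intro q hq
    have e := congrArg conj (h2 q hq)
    simp only [map_mul, map_neg, map_add, Complex.conj_conj, har q hq] at e
    apply mul_left_cancel₀ (ha0 q hq)
    linear_combination h2 q hq - P q * e - conj (dz a q) * h1 q hq
  have h4 : ∀ q ∈ V, dzb P q = P q * -dz P q := by
    intro q hq
    have e := dz_congr hV (f := fun r => P r * conj (P r)) (g := fun _ => 1) h1 hq
    rw [dz_mul (diffAt hP hV hq) (diffAt hPc hV hq), dz_const, dz_conj (diffAt hP hV hq)] at e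
    have e2 := congrArg conj e
    simp only [map_mul, map_add, Complex.conj_conj, map_zero] at e2
    linear_combination P q * e2 - dzb P q * h1 q hq - P q * h3 q hq
  have h5 : ∀ q ∈ V, a q * dz (dz P) q = -(dz (dz a) q * P q) - 2 * dz a q * dz P q := by
    intro q hq
    have e := dz_congr hV (f := fun r => a r * -dz P r)
      (g := fun r => conj (dz a r) + dz a r * P r) h2 hq
    rw [dz_mul (diffAt ha hV hq) (diffAt hW.neg hV hq), dz_neg,
      dz_add (diffAt hfc hV hq) ((diffAt hf hV hq).fun_mul (diffAt hP hV hq)),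
      dz_mul (diffAt hf hV hq) (diffAt hP hV hq), dz_conj (diffAt hf hV hq), hharm q hq,
      map_zero] at e
    linear_combination -e
  have h6 : ∀ q ∈ V, a q * dzb (dz P) q
      = -conj (dz (dz a) q) + dz a q * P q * dz P q - conj (dz a q) * dz P q := by
    intro q hq
    have e := dzb_congr hV (f := fun r => a r * -dz P r)
      (g := fun r => conj (dz a r) + dz a r * P r) h2 hq
    rw [dzb_mul (diffAt ha hV hq) (diffAt hW.neg hV hq), dzb_neg,
      dzb_add (diffAt hfc hV hq) ((diffAt hf hV hq).fun_mul (diffAt hP hV hq)),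
      dzb_mul (diffAt hf hV hq) (diffAt hP hV hq), dzb_conj (diffAt hf hV hq), hharm q hq,
      dab q hq, h4 q hq] at e
    linear_combination -e
  have h7 : ∀ q ∈ V, dzb (dz P) q = -(dz P q) ^ 2 - P q * dz (dz P) q := by
    intro q hq
    have e := dz_congr hV (f := dzb P) (g := fun r => P r * -dz P r) h4 hq
    rw [← dzb_dz_comm hV hP hq, dz_mul (diffAt hP hV hq) (diffAt hW.neg hV hq), dz_neg] at e
    linear_combination e
  -- The mixed derivative P_zz̄ is known twice, from `h6` and from the symmetry of mixed derivatives
  -- in `h7`; eliminating it and P_zz leaves a relation in the second derivatives of a and the first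
  -- of P.
  have h8 : ∀ q ∈ V, conj (dz (dz a) q) + (P q * P q) * dz (dz a) q
      = 2 * (a q * (dz P q * dz P q)) := by
    intro q hq
    linear_combination h6 q hq - a q * h7 q hq + P q * h5 q hq + dz P q * h2 q hq
  have h9 : ∀ q ∈ V, P q * P q * dz (dz (dz a)) q + 6 * P q * dz P q * dz (dz a) q
      + 6 * dz a q * dz P q ^ 2 = 0 := by
    intro q hq
    have dP := diffAt hP hV hq
    have dW := diffAt hW hV hq
    have e := dz_congr hV (f := fun r => conj (dz (dz a) r) + (P r * P r) * dz (dz a) r)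
      (g := fun r => 2 * (a r * (dz P r * dz P r))) h8 hq
    have e0 : dzb (dz (dz a)) q = 0 := by
      rw [dzb_dz_comm hV hf hq, dz_congr hV (g := fun _ => 0) hharm hq, dz_const]
    rw [dz_add (diffAt hfc' hV hq) ((dP.fun_mul dP).fun_mul (diffAt hf' hV hq)),
      dz_conj (diffAt hf' hV hq), e0, map_zero, dz_mul (dP.fun_mul dP) (diffAt hf' hV hq),
      dz_mul dP dP, dz_mul (differentiableAt_const _) ((diffAt ha hV hq).fun_mul (dW.fun_mul dW)),
      dz_const, dz_mul (diffAt ha hV hq) (dW.fun_mul dW), dz_mul dW dW] at e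
    linear_combination e + 4 * dz P q * h5 q hq
  -- Division by P² and P_z = P conj(P_z) rewrite `h9` so that a_z, a_zz, a_zzz are holomorphic and
  -- conj(P_z) is the only other function present.
  have h10 : ∀ q ∈ V, dz (dz (dz a)) q + 6 * (conj (dz P q) * dz (dz a) q)
      + 6 * (dz a q * (conj (dz P q) * conj (dz P q))) = 0 := by
    intro q hq
    have hP0 : P q ≠ 0 := left_ne_zero_of_mul_eq_one (h1 q hq)
    apply mul_left_cancel₀ (mul_ne_zero hP0 hP0)
    have e := h3 q hq
    linear_combination h9 q hq + (6 * P q * dz (dz a) q + 6 * dz a q *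
      (P q * conj (dz P q) + dz P q)) * e
  -- Applying ∂/∂z̄ to `h10` differentiates conj(P_z) alone and gives conj(P_zz)(a_zz + 2a_z
  -- conj(P_z)) = 0. By `h5` the second factor is -aP_zz/P, so a|P_zz|² = 0.
  have h11 : ∀ q ∈ V, dz (dz P) q = 0 := by
    intro q hq
    have dWc := diffAt hWc hV hq
    have df := diffAt hf hV hq
    have df' := diffAt hf' hV hq
    have e := dzb_congr hV (f := fun q => dz (dz (dz a)) q + 6 * (conj (dz P q) * dz (dz a) q)
      + 6 * (dz a q * (conj (dz P q) * conj (dz P q)))) (g := fun _ => 0) h10 hq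
    have e0 : ∀ q ∈ V, dzb (dz (dz a)) q = 0 := fun q hq => by
      rw [dzb_dz_comm hV hf hq, dz_congr hV (g := fun _ => 0) hharm hq, dz_const]
    have e1 : dzb (dz (dz (dz a))) q = 0 := by
      rw [dzb_dz_comm hV hf' hq, dz_congr hV (g := fun _ => 0) e0 hq, dz_const]
    have c6 : DifferentiableAt ℝ (fun _ : E2 => (6 : ℂ)) q := differentiableAt_const _
    rw [dzb_add ((diffAt hf'' hV hq).fun_add (c6.fun_mul (dWc.fun_mul df')))
      (c6.fun_mul (df.fun_mul (dWc.fun_mul dWc))),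
      dzb_add (diffAt hf'' hV hq) (c6.fun_mul (dWc.fun_mul df')), dzb_mul c6 (dWc.fun_mul df'),
      dzb_mul dWc df', dzb_mul c6 (df.fun_mul (dWc.fun_mul dWc)), dzb_mul df (dWc.fun_mul dWc),
      dzb_mul dWc dWc, dzb_const, dzb_const, dzb_conj (diffAt hW hV hq), e0 q hq, e1,
      hharm q hq] at e
    have hP0 : P q ≠ 0 := left_ne_zero_of_mul_eq_one (h1 q hq)
    have e2 : a q * dz (dz P) q * conj (dz (dz P) q) = 0 := by
      rw [h5 q hq]
      linear_combination (-P q / 6) * e + 2 * dz a q * conj (dz (dz P) q) * h3 q hq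
    rcases mul_eq_zero.1 e2 with e3 | e3
    · exact (mul_eq_zero.1 e3).resolve_left (ha0 q hq)
    · simpa using e3
  intro q hq
  refine ⟨h1 q hq, h4 q hq, h2 q hq, h3 q hq, h11 q hq, ?_, ?_⟩
  · rw [h7 q hq, h11 q hq]; ring
  · have e := h5 q hq
    rw [h11 q hq] at e
    have hP0 : P q ≠ 0 := left_ne_zero_of_mul_eq_one (h1 q hq)
    apply mul_left_cancel₀ hP0
    linear_combination e + 2 * dz a q * h3 q hq

end HarmonicCodazzi

/-! ### The rulings are parallel or pass through a fixed point. -/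

section HarmonicCodazzi

open ComplexConjugate

variable {a H : E2 → ℂ} {U : Set E2}

/-- With P = -H̄/a the kernel equation aτ + H̄τ̄ = 0 reads τ = Pτ̄, which for unit τ means τ² = P.
-/
theorem exists_sqrt_unimodular {P : ℂ} (hP : P * conj P = 1) :
    ∃ τ : ℂ, ‖τ‖ = 1 ∧ τ = P * conj τ := by
  obtain ⟨τ, hτ⟩ := IsSquare.exists_mul_self P (IsAlgClosed.exists_eq_mul_self P)
  have hn : ‖P‖ = 1 := by
    rw [Complex.mul_conj, ← Complex.ofReal_one, Complex.ofReal_inj, Complex.normSq_eq_norm_sq] at hP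
    nlinarith [norm_nonneg P]
  have hτn : ‖τ‖ = 1 := by
    rw [hτ, norm_mul] at hn
    nlinarith [norm_nonneg τ]
  refine ⟨τ, hτn, ?_⟩
  have h1 : τ * conj τ = 1 := by
    rw [Complex.mul_conj, Complex.normSq_eq_norm_sq, hτn]; simp
  rw [hτ, mul_assoc, h1, mul_one]

/-- A Codazzi tensor of rank at most one in the plane, with trace `2 a` harmonic and trace-free
part `H`, has either a constant direction in its kernel or the direction of a fixed point. -/
theorem kernel_alternative (hU : IsOpen U) (hc : Convex ℝ U) (ha : ContDiffOn ℝ ∞ a U)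
    (hH : ContDiffOn ℝ ∞ H U) (har : ∀ q ∈ U, conj (a q) = a q)
    (hcod : ∀ q ∈ U, dzb H q = dz a q) (hharm : ∀ q ∈ U, dzb (dz a) q = 0)
    (hdet : ∀ q ∈ U, a q * a q = H q * conj (H q)) :
    (∃ τ : ℂ, ‖τ‖ = 1 ∧ ∀ q ∈ U, a q * τ + conj (H q) * conj τ = 0) ∨
      ∃ z₀ : ℂ, ∀ q ∈ U, toC q ≠ z₀ ∧
        a q * (toC q - z₀) + conj (H q) * conj (toC q - z₀) = 0 := by
  have hH0 : ∀ q ∈ U, a q = 0 → conj (H q) = 0 := fun q hq h0 => by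
    have := hdet q hq
    rw [h0, zero_mul, eq_comm, mul_eq_zero] at this
    rcases this with h | h
    · rw [h, map_zero]
    · exact h
  set V : Set E2 := U ∩ a ⁻¹' {0}ᶜ with hVdef
  have hV : IsOpen V := ha.continuousOn.isOpen_inter_preimage hU isOpen_compl_singleton
  have hVU : V ⊆ U := inter_subset_left
  have hnV : ∀ q ∈ U, q ∉ V → a q = 0 := fun q hq hqV => by
    by_contra h; exact hqV ⟨hq, h⟩
  have haV := ha.mono hVU
  have hHV := hH.mono hVU
  have ha0 : ∀ q ∈ V, a q ≠ 0 := fun q hq => hq.2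
  let P : E2 → ℂ := fun q => -conj (H q) * (a q)⁻¹
  have hP : ContDiffOn ℝ ∞ P V := (contDiffOn_conj hHV).neg.mul (haV.inv ha0)
  have hPH : ∀ q ∈ V, a q * P q = -conj (H q) := fun q hq => by
    simp only [P]
    field_simp [ha0 q hq]
  have key := ruling_equations hV haV hHV hP (fun q hq => har q hq.1) (fun q hq => hcod q hq.1)
    (fun q hq => hharm q hq.1) (fun q hq => hdet q hq.1) ha0 hPH
  -- At the zeros of a the determinant condition forces H = 0, and the kernel equation is empty
  -- there. A direction therefore only has to be checked on V.
  have ker : ∀ v : E2 → ℂ, (∀ q ∈ V, v q = P q * conj (v q)) →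
      ∀ q ∈ U, a q * v q + conj (H q) * conj (v q) = 0 := by
    intro v hv q hq
    by_cases hqV : q ∈ V
    · linear_combination a q * hv q hqV + conj (v q) * hPH q hqV
    · have h0 := hnV q hq hqV
      rw [hH0 q hq h0, h0]; ring
  have hf := contDiffOn_dz hU ha
  have hf' := contDiffOn_dz hU hf
  by_cases hα : ∀ q ∈ U, a q = 0
  · left
    refine ⟨1, by simp, fun q hq => ?_⟩
    rw [hH0 q hq (hα q hq), hα q hq]; ring
  push Not at hα
  obtain ⟨p, hpU, hp⟩ := hα
  have hpV : p ∈ V := ⟨hpU, hp⟩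
  by_cases hf0 : ∀ q ∈ U, dz a q = 0
  · left
    have hab : ∀ q ∈ U, dzb a q = 0 := fun q hq => by
      rw [← dzb_congr hU har hq, dzb_conj (diffAt ha hU hq), hf0 q hq, map_zero]
    have hconst : ∀ q ∈ U, a q = a p := fun q hq => eq_of_dz_eq_zero hU hc ha hf0 hab hq hpU
    have hVeq : ∀ q ∈ U, q ∈ V := fun q hq => ⟨hq, by rw [mem_preimage, hconst q hq]; exact hp⟩
    have hPU : ContDiffOn ℝ ∞ P U := hP.mono hVeq
    have hPz : ∀ q ∈ U, dz P q = 0 := fun q hq => by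
      obtain ⟨-, -, h3, -⟩ := key q (hVeq q hq)
      rw [hf0 q hq, map_zero, zero_mul, add_zero] at h3
      simpa using (mul_eq_zero.1 h3).resolve_left (ha0 q (hVeq q hq))
    have hPzb : ∀ q ∈ U, dzb P q = 0 := fun q hq => by
      rw [(key q (hVeq q hq)).2.1, hPz q hq]; ring
    obtain ⟨τ, hτ, hτP⟩ := exists_sqrt_unimodular (key p hpV).1
    refine ⟨τ, hτ, ker (fun _ => τ) (fun q hq => ?_)⟩
    rw [eq_of_dz_eq_zero hU hc hPU hPz hPzb (hVU hq) hpU]; exact hτP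
  push Not at hf0
  obtain ⟨p₁, hp₁U, hp₁⟩ := hf0
  -- If a vanished on a nonempty open set, the holomorphic function a_z would vanish there and hence
  -- on all of U, contrary to `hp₁`.
  have dense : ∀ q ∈ U, ∀ W ∈ 𝓝 q, ∃ r ∈ W, r ∈ V := by
    intro q hq W hW
    by_contra! hcon
    apply hp₁
    obtain ⟨O, hOW, hO, hqO⟩ := mem_nhds_iff.1 (inter_mem hW (hU.mem_nhds hq))
    refine eq_zero_of_dzb_eq_zero hU hc hf hharm hq ?_ hp₁U
    filter_upwards [hO.mem_nhds hqO] with r hr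
    rw [dz_congr hO (g := fun _ => 0) (fun s hs => hnV s (hOW hs).2 (hcon s (hOW hs).1)) hr,
      dz_const]
  by_cases hf1 : ∀ q ∈ U, dz (dz a) q = 0
  · left
    have hconst : ∀ q ∈ U, dz a q = dz a p₁ :=
      fun q hq => eq_of_dz_eq_zero hU hc hf hf1 hharm hq hp₁U
    have hPz : ∀ q ∈ V, dz P q = 0 := fun q hq => by
      have h := (key q hq).2.2.2.2.2.2
      rw [hf1 q hq.1, hconst q hq.1] at h
      simpa [hp₁] using h
    -- V may be disconnected, so P_z = 0 alone would not make P constant. The relation P a_z =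
    -- -conj(a_z), with a_z a nonzero constant, fixes the same value of P on all components.
    have hPc : ∀ q ∈ V, P q * dz a p₁ = -conj (dz a p₁) := fun q hq => by
      have h := (key q hq).2.2.1
      rw [hPz q hq, hconst q hq.1] at h
      linear_combination -h
    obtain ⟨τ, hτ, hτP⟩ := exists_sqrt_unimodular (key p hpV).1
    refine ⟨τ, hτ, ker (fun _ => τ) (fun q hq => ?_)⟩
    have : P q = P p := mul_right_cancel₀ hp₁ ((hPc q hq).trans (hPc p hpV).symm)
    rw [this]; exact hτP
  right
  push Not at hf1
  obtain ⟨p₂, hp₂U, hp₂⟩ := hf1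
  have hO : IsOpen (U ∩ dz (dz a) ⁻¹' {0}ᶜ) :=
    hf'.continuousOn.isOpen_inter_preimage hU isOpen_compl_singleton
  obtain ⟨p₃, ⟨-, hp₃⟩, hp₃V⟩ := dense p₂ hp₂U _ (hO.mem_nhds ⟨hp₂U, hp₂⟩)
  obtain ⟨r, hr, hrb⟩ := Metric.mem_nhds_iff.1
    (inter_mem (hO.mem_nhds ⟨hVU hp₃V, hp₃⟩) (hV.mem_nhds hp₃V))
  set B := Metric.ball p₃ r
  have hB : IsOpen B := Metric.isOpen_ball
  have hp₃B : p₃ ∈ B := Metric.mem_ball_self hr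
  have hBV : B ⊆ V := fun q hq => (hrb hq).2
  -- This m is holomorphic and solves m_z = m², so near p₃, where m ≠ 0, the function z + 1/m is a
  -- constant z₀ and m = -1/(z - z₀).
  let m : E2 → ℂ := fun q => -conj (dz P q)
  have hm : ContDiffOn ℝ ∞ m V := (contDiffOn_conj (contDiffOn_dz hV hP)).neg
  have hmz : ∀ q ∈ V, dz m q = m q ^ 2 := fun q hq => by
    have h1 : dz m q = -conj (dzb (dz P) q) := by
      rw [dz_neg, dz_conj (diffAt (contDiffOn_dz hV hP) hV hq)]
    rw [h1, (key q hq).2.2.2.2.2.1]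
    simp [m]
  have hmzb : ∀ q ∈ V, dzb m q = 0 := fun q hq => by
    have h1 : dzb m q = -conj (dz (dz P) q) := by
      rw [dzb_neg, dzb_conj (diffAt (contDiffOn_dz hV hP) hV hq)]
    rw [h1, (key q hq).2.2.2.2.1]
    simp
  have hfm : ∀ q ∈ V, dz (dz a) q = 2 * dz a q * m q := fun q hq => (key q hq).2.2.2.2.2.2
  have hm0 : ∀ q ∈ B, m q ≠ 0 := fun q hq h0 => (hrb hq).1.2 (by
    rw [hfm q (hBV hq), h0, mul_zero]; rfl)
  have hmB := hm.mono hBV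
  let n : E2 → ℂ := fun q => (m q)⁻¹
  have hn : ContDiffOn ℝ ∞ n B := hmB.inv hm0
  have hmn : ∀ q ∈ B, m q * n q = 1 := fun q hq => mul_inv_cancel₀ (hm0 q hq)
  have hnz : ∀ q ∈ B, dz n q = -1 := fun q hq => by
    have e := dz_congr hB (f := fun r => m r * n r) (g := fun _ => 1) hmn hq
    rw [dz_mul (diffAt hmB hB hq) (diffAt hn hB hq), dz_const, hmz q (hBV hq)] at e
    apply mul_left_cancel₀ (hm0 q hq)
    linear_combination e - m q * hmn q hq
  have hnzb : ∀ q ∈ B, dzb n q = 0 := fun q hq => by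
    have e := dzb_congr hB (f := fun r => m r * n r) (g := fun _ => 1) hmn hq
    rw [dzb_mul (diffAt hmB hB hq) (diffAt hn hB hq), dzb_const, hmzb q (hBV hq), zero_mul,
      add_zero] at e
    exact (mul_eq_zero.1 e).resolve_left (hm0 q hq)
  set z₀ : ℂ := toC p₃ + n p₃
  have dC : ∀ q, DifferentiableAt ℝ toC q := fun q => contDiff_toC.differentiable (by simp) q
  have hz₀ : ∀ q ∈ B, toC q + n q = z₀ := fun q hq => by
    refine eq_of_dz_eq_zero (f := fun q => toC q + n q) hB (convex_ball _ _)
      (contDiff_toC.contDiffOn.add hn) (fun r hr => ?_) (fun r hr => ?_) hq hp₃B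
    · rw [dz_add (dC r) (diffAt hn hB hr), dz_toC, hnz r hr]; ring
    · rw [dzb_add (dC r) (diffAt hn hB hr), dzb_toC, hnzb r hr]; ring
  let ζ : E2 → ℂ := fun q => toC q - z₀
  have hζ : ContDiff ℝ ∞ ζ := contDiff_toC.sub contDiff_const
  have dζ : ∀ q, DifferentiableAt ℝ ζ q := fun q => hζ.differentiable (by simp) q
  have hζz : ∀ q, dz ζ q = 1 := fun q => by
    rw [dz_sub (dC q) (differentiableAt_const _), dz_toC, dz_const, sub_zero]
  have hζzb : ∀ q, dzb ζ q = 0 := fun q => by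
    rw [dzb_sub (dC q) (differentiableAt_const _), dzb_toC, dzb_const, sub_zero]
  have hζn : ∀ q ∈ B, m q * ζ q = -1 := fun q hq => by
    simp only [ζ]
    rw [← hz₀ q hq]
    linear_combination -hmn q hq
  -- From a_zz = 2a_z m and m = -1/(z - z₀) the function a_z(z - z₀)² is constant on B. Being
  -- holomorphic on U, it is constant on U as well, and its value is nonzero; this excludes z₀ from
  -- U and zeros of a_z.
  let g : E2 → ℂ := fun q => dz a q * (ζ q * ζ q)
  have hg : ContDiffOn ℝ ∞ g U := hf.mul (hζ.contDiffOn.mul hζ.contDiffOn)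
  have hgz : ∀ q ∈ U, dz g q = ζ q * (dz (dz a) q * ζ q + 2 * dz a q) := fun q hq => by
    rw [dz_mul (diffAt hf hU hq) ((dζ q).fun_mul (dζ q)), dz_mul (dζ q) (dζ q), hζz]; ring
  have hgzb : ∀ q ∈ U, dzb g q = 0 := fun q hq => by
    rw [dzb_mul (diffAt hf hU hq) ((dζ q).fun_mul (dζ q)), dzb_mul (dζ q) (dζ q), hζzb,
      hharm q hq]; ring
  have hgB : ∀ q ∈ B, g q = g p₃ := fun q hq =>
    eq_of_dz_eq_zero hB (convex_ball _ _) (hg.mono (hBV.trans hVU)) (fun r hr => by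
      rw [hgz r (hVU (hBV hr)), hfm r (hBV hr)]
      linear_combination 2 * ζ r * dz a r * hζn r hr) (fun r hr => hgzb r (hVU (hBV hr))) hq hp₃B
  have hgU : ∀ q ∈ U, g q - g p₃ = 0 := fun q hq => by
    refine eq_zero_of_dzb_eq_zero (f := fun q => g q - g p₃) hU hc (hg.sub contDiffOn_const)
      (fun r hr => ?_) (hVU hp₃V) ?_ hq
    · rw [dzb_sub (diffAt hg hU hr) (differentiableAt_const _), hgzb r hr, dzb_const, sub_zero]
    · filter_upwards [hB.mem_nhds hp₃B] with r hr
      rw [hgB r hr, sub_self]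
  have hg0 : g p₃ ≠ 0 := by
    have h1 : dz a p₃ ≠ 0 := fun h => hp₃ (by
      rw [hfm p₃ hp₃V, h]; simp)
    have h2 : ζ p₃ ≠ 0 := right_ne_zero_of_mul (a := m p₃) (by
      rw [hζn p₃ hp₃B]; exact neg_ne_zero.2 one_ne_zero)
    exact mul_ne_zero h1 (mul_ne_zero h2 h2)
  have hgne : ∀ q ∈ U, g q ≠ 0 := fun q hq => by
    rw [sub_eq_zero.1 (hgU q hq)]; exact hg0
  have hζ0 : ∀ q ∈ U, ζ q ≠ 0 := fun q hq => right_ne_zero_of_mul (right_ne_zero_of_mul (hgne q hq))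
  have hf0 : ∀ q ∈ U, dz a q ≠ 0 := fun q hq => left_ne_zero_of_mul (hgne q hq)
  -- The constancy of g on U carries m = -1/(z - z₀) from the ball B to every component of V.
  have hζV : ∀ q ∈ V, m q * ζ q = -1 := fun q hq => by
    have h1 : dz g q = 0 := by
      rw [dz_congr hU (g := fun _ => g p₃) (fun r hr => sub_eq_zero.1 (hgU r hr)) hq.1, dz_const]
    rw [hgz q hq.1, hfm q hq] at h1
    have h2 := (mul_eq_zero.1 h1).resolve_left (hζ0 q hq.1)
    apply mul_left_cancel₀ (mul_ne_zero two_ne_zero (hf0 q hq.1))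
    linear_combination h2
  refine ⟨z₀, fun q hq => ⟨fun h => hζ0 q hq (sub_eq_zero.2 h), ker ζ (fun r hr => ?_) q hq⟩⟩
  have e1 := hζV r hr
  have e2 := congrArg conj e1
  have e3 := (key r hr).2.2.2.1
  simp only [m, map_mul, map_neg, Complex.conj_conj, map_one] at e1 e2
  -- With ζ = z - z₀, the equations conj(P_z)ζ = 1, P_z ζ̄ = 1 and P conj(P_z) = P_z give ζ = Pζ̄,
  -- so the ruling points along z - z₀.
  linear_combination ζ r * e2 - P r * conj (ζ r) * e1 - ζ r * conj (ζ r) * e3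

end HarmonicCodazzi

/-! ### Gauss, Weingarten and Codazzi equations in flat coordinates. -/

section FlatStructure

variable {y : E2 → E3} {U : Set E2} {q : E2}

theorem isFrame_of_firstForm_eq_one (h : firstForm y q = 1) :
    IsFrame (partialD 0 y q) (partialD 1 y q) (unitNormal y q) := by
  have h00 : inner ℝ (partialD 0 y q) (partialD 0 y q) = 1 := by
    simpa [firstForm] using congrFun (congrFun h 0) 0
  have h11 : inner ℝ (partialD 1 y q) (partialD 1 y q) = 1 := by
    simpa [firstForm] using congrFun (congrFun h 1) 1
  have h01 : inner ℝ (partialD 0 y q) (partialD 1 y q) = 0 := by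
    simpa [firstForm] using congrFun (congrFun h 0) 1
  rw [real_inner_self_eq_norm_sq, pow_eq_one_iff_of_nonneg (norm_nonneg _) two_ne_zero] at h00
  rw [real_inner_self_eq_norm_sq, pow_eq_one_iff_of_nonneg (norm_nonneg _) two_ne_zero] at h11
  have := IsFrame.of_cross h00 h11 h01
  rw [unitNormal, this.ww, inv_one, one_smul]
  exact this

theorem cross_ne_zero_of_firstForm_eq_one (h : firstForm y q = 1) :
    cross (partialD 0 y q) (partialD 1 y q) ≠ 0 := by
  intro h0
  have h1 := det_firstForm (y := y) (q := q)
  rw [h, h0] at h1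
  simp at h1

theorem contDiffOn_secondForm (hU : IsOpen U) (hy : ContDiffOn ℝ ∞ y U)
    (hg : ∀ q ∈ U, firstForm y q = 1) (i j : Fin 2) :
    ContDiffOn ℝ ∞ (fun q => secondForm y q i j) U :=
  (contDiffOn_partialD hU (contDiffOn_partialD hU hy j) i).inner ℝ
    (contDiffOn_unitNormal hU hy fun q hq => cross_ne_zero_of_firstForm_eq_one (hg q hq))

theorem secondForm_comm (hU : IsOpen U) (hy : ContDiffOn ℝ ∞ y U) (hq : q ∈ U) (i j : Fin 2) :
    secondForm y q i j = secondForm y q j i := by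
  simp only [secondForm, Matrix.of_apply]
  rw [partialD_comm hU hy hq]

/-- The formula of Gauss in flat coordinates. -/
theorem gauss_formula (hU : IsOpen U) (hy : ContDiffOn ℝ ∞ y U)
    (hg : ∀ q ∈ U, firstForm y q = 1) (hq : q ∈ U) (i j : Fin 2) :
    partialD i (partialD j y) q = secondForm y q i j • unitNormal y q := by
  have hd := contDiffOn_partialD hU hy
  have h1 : ∀ i j k, inner ℝ (partialD i (partialD j y) q) (partialD k y q)
      + inner ℝ (partialD j y q) (partialD i (partialD k y) q) = 0 := fun i j k =>
    partialD_inner_eq_zero hU (hd j) (hd k) (c := (1 : Matrix (Fin 2) (Fin 2) ℝ) j k)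
      (fun r hr => by rw [← hg r hr]; rfl) hq i
  -- Koszul's argument: the metric coefficients are constant, so the three cyclic permutations of
  -- `h1` make all Christoffel symbols vanish.
  have h2 : ∀ i j k, inner ℝ (partialD i (partialD j y) q) (partialD k y q) = 0 := by
    intro i j k
    have a1 := h1 i j k
    have a2 := h1 j k i
    have a3 := h1 k i j
    rw [real_inner_comm] at a1 a2 a3
    rw [partialD_comm hU hy hq i k] at a1
    rw [partialD_comm hU hy hq j i] at a2
    rw [partialD_comm hU hy hq k j] at a3
    rw [real_inner_comm (partialD i (partialD j y) q)] at a1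
    linarith [real_inner_comm (partialD i (partialD j y) q) (partialD k y q),
      real_inner_comm (partialD k (partialD i y) q) (partialD j y q),
      real_inner_comm (partialD j (partialD k y) q) (partialD i y q)]
  have h3 := (isFrame_of_firstForm_eq_one (hg q hq)).expand (partialD i (partialD j y) q)
  rw [h2, h2] at h3
  rw [h3]
  simp [secondForm]

/-- The formula of Weingarten in flat coordinates. -/
theorem weingarten_formula (hU : IsOpen U) (hy : ContDiffOn ℝ ∞ y U)
    (hg : ∀ q ∈ U, firstForm y q = 1) (hq : q ∈ U) (i : Fin 2) :
    partialD i (unitNormal y) q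
      = -(secondForm y q i 0 • partialD 0 y q + secondForm y q i 1 • partialD 1 y q) := by
  have hd := contDiffOn_partialD hU hy
  have hξ := contDiffOn_unitNormal hU hy fun q hq => cross_ne_zero_of_firstForm_eq_one (hg q hq)
  have f := isFrame_of_firstForm_eq_one (hg q hq)
  have h1 : ∀ j, inner ℝ (partialD i (unitNormal y) q) (partialD j y q)
      = -secondForm y q i j := fun j => by
    have := partialD_inner_eq_zero hU (hd j) hξ
      (fun q _ => inner_partialD_unitNormal (y := y) j) hq i
    rw [real_inner_comm (partialD i (unitNormal y) q)] at this
    simp only [secondForm, Matrix.of_apply]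
    linarith
  have h2 : inner ℝ (partialD i (unitNormal y) q) (unitNormal y q) = 0 := by
    have := partialD_inner_eq_zero hU hξ hξ
      (fun q hq => (isFrame_of_firstForm_eq_one (hg q hq)).ww') hq i
    rw [real_inner_comm (partialD i (unitNormal y) q)] at this
    linarith
  have h3 := f.expand (partialD i (unitNormal y) q)
  rw [h1, h1, h2] at h3
  rw [h3]
  module

/-- The equation of Codazzi in flat coordinates. -/
theorem codazzi (hU : IsOpen U) (hy : ContDiffOn ℝ ∞ y U)
    (hg : ∀ q ∈ U, firstForm y q = 1) (hq : q ∈ U) (j : Fin 2) :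
    partialD 0 (fun r => secondForm y r 1 j) q = partialD 1 (fun r => secondForm y r 0 j) q := by
  have hd := contDiffOn_partialD hU hy
  have hξ := contDiffOn_unitNormal hU hy fun q hq => cross_ne_zero_of_firstForm_eq_one (hg q hq)
  have f := isFrame_of_firstForm_eq_one (hg q hq)
  have hh := contDiffOn_secondForm hU hy hg
  -- Derivatives of the normal are tangent, so the normal part of ∂ₖ∂ᵢ∂ⱼy is ∂ₖhᵢⱼ, and Codazzi
  -- becomes the symmetry of third derivatives.
  have h1 : ∀ i k, inner ℝ (partialD k (partialD i (partialD j y)) q) (unitNormal y q)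
      = partialD k (fun r => secondForm y r i j) q := by
    intro i k
    rw [partialD_congr_on hU (fun r hr => gauss_formula hU hy hg hr i j) hq,
      partialD_smul (diffAt (hh i j) hU hq) (diffAt hξ hU hq), weingarten_formula hU hy hg hq]
    simp [inner_add_left, inner_smul_left, f.uw, f.vw, inner_neg_left,
      norm_unitNormal (cross_ne_zero_of_firstForm_eq_one (hg q hq))]
  rw [← h1, ← h1, partialD_comm hU (hd j) hq]

theorem meanCurvature_of_flat (hg : firstForm y q = 1) :
    meanCurvature y q = (secondForm y q 0 0 + secondForm y q 1 1) / 2 := by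
  rw [meanCurvature, hg, inv_one, one_mul, Matrix.trace_fin_two]
  ring

theorem laplace_of_flat (hU : IsOpen U) (hg : ∀ q ∈ U, firstForm y q = 1) (f : E2 → ℝ)
    (hq : q ∈ U) :
    laplace y f q = -(partialD 0 (partialD 0 f) q + partialD 1 (partialD 1 f) q) := by
  have h : ∀ i, partialD i
      (fun r => √(firstForm y r).det * ∑ j, (firstForm y r)⁻¹ i j * partialD j f r) q
      = partialD i (partialD i f) q := by
    intro i
    refine partialD_congr_on hU (fun r hr => ?_) hq i
    simp only [hg r hr, Matrix.det_one, Real.sqrt_one, inv_one, one_mul, Matrix.one_apply,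
      ite_mul, zero_mul, Finset.sum_ite_eq, Finset.mem_univ, if_true]
  rw [laplace, hg q hq, Fin.sum_univ_two, h, h]
  simp

/-- The second fundamental form of a flat surface with harmonic mean curvature, in flat
coordinates, has a constant direction or the direction of a fixed point in its kernel. -/
theorem secondForm_kernel (hU : IsOpen U) (hc : Convex ℝ U) (hy : ContDiffOn ℝ ∞ y U)
    (hg : ∀ q ∈ U, firstForm y q = 1) (hK : ∀ q ∈ U, gaussCurvature y q = 0)
    (hα : ∀ q ∈ U, laplace y (meanCurvature y) q = 0) :
    (∃ τ : E2, ‖τ‖ = 1 ∧ ∀ q ∈ U, ∀ i, secondForm y q i 0 * τ 0 + secondForm y q i 1 * τ 1 = 0) ∨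
      ∃ z : E2, ∀ q ∈ U, q ≠ z ∧ ∀ i,
        secondForm y q i 0 * (q 0 - z 0) + secondForm y q i 1 * (q 1 - z 1) = 0 := by
  have hh := contDiffOn_secondForm hU hy hg
  have dh : ∀ i j, ∀ q ∈ U, DifferentiableAt ℝ (fun r => secondForm y r i j) q :=
    fun i j q hq => diffAt (hh i j) hU hq
  have hc1 : ∀ {u : E2 → ℝ}, ContDiffOn ℝ ∞ u U → ContDiffOn ℝ ∞ (fun q => ((u q : ℝ) : ℂ)) U :=
    fun hu => Complex.ofRealCLM.contDiff.comp_contDiffOn hu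
  let α : E2 → ℝ := fun q => (secondForm y q 0 0 + secondForm y q 1 1) / 2
  have hαs : ContDiffOn ℝ ∞ α U := ((hh 0 0).add (hh 1 1)).div_const 2
  let a : E2 → ℂ := fun q => ((α q : ℝ) : ℂ)
  let δ : E2 → ℝ := fun q => (secondForm y q 0 0 - secondForm y q 1 1) / 2
  have hδs : ContDiffOn ℝ ∞ δ U := ((hh 0 0).sub (hh 1 1)).div_const 2
  -- H is the Hopf coefficient of the second form. Codazzi reads H_z̄ = a_z, det h = 0 reads a² =
  -- |H|², and h v = 0 for v = v₀ + iv₁ reads av + H̄v̄ = 0.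
  let H : E2 → ℂ := fun q => (δ q : ℂ) - Complex.I * (secondForm y q 0 1 : ℝ)
  have ha : ContDiffOn ℝ ∞ a U := hc1 hαs
  have hH : ContDiffOn ℝ ∞ H U := (hc1 hδs).sub (contDiffOn_const.mul (hc1 (hh 0 1)))
  have pα : ∀ q ∈ U, ∀ i, partialD i α q = (partialD i (fun r => secondForm y r 0 0) q
      + partialD i (fun r => secondForm y r 1 1) q) / 2 := fun q hq i => by
    have : α = fun r => (secondForm y r 0 0 + secondForm y r 1 1) * 2⁻¹ := by
      ext r; simp only [α]; ring
    rw [this, partialD_mul ((dh 0 0 q hq).fun_add (dh 1 1 q hq)) (differentiableAt_const _),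
      partialD_add (dh 0 0 q hq) (dh 1 1 q hq), partialD_const]
    ring
  have pδ : ∀ q ∈ U, ∀ i, partialD i δ q = (partialD i (fun r => secondForm y r 0 0) q
      - partialD i (fun r => secondForm y r 1 1) q) / 2 := fun q hq i => by
    have : δ = fun r => (secondForm y r 0 0 - secondForm y r 1 1) * 2⁻¹ := by
      ext r; simp only [δ]; ring
    rw [this, partialD_mul ((dh 0 0 q hq).fun_sub (dh 1 1 q hq)) (differentiableAt_const _),
      partialD_sub (dh 0 0 q hq) (dh 1 1 q hq), partialD_const]
    ring
  have pa : ∀ q ∈ U, ∀ i, partialD i a q = ((partialD i α q : ℝ) : ℂ) := fun q hq i =>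
    partialD_ofReal (diffAt hαs hU hq) i
  have pH : ∀ q ∈ U, ∀ i, partialD i H q = ((partialD i δ q : ℝ) : ℂ)
      - Complex.I * ((partialD i (fun r => secondForm y r 0 1) q : ℝ) : ℂ) := fun q hq i => by
    have d1 := diffAt (hc1 (hh 0 1)) hU hq
    rw [partialD_sub (diffAt (hc1 hδs) hU hq) (d1.const_mul Complex.I),
      partialD_cmul (differentiableAt_const _) d1, partialD_const,
      partialD_ofReal (diffAt hδs hU hq), partialD_ofReal (dh 0 1 q hq)]
    ring
  have cod0 : ∀ q ∈ U, partialD 0 (fun r => secondForm y r 0 1) q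
      = partialD 1 (fun r => secondForm y r 0 0) q := fun q hq => by
    rw [← codazzi hU hy hg hq 0]
    exact partialD_congr_on hU (fun r hr => secondForm_comm hU hy hr 0 1) hq 0
  have cod1 := fun q (hq : q ∈ U) => codazzi hU hy hg hq 1
  have hsym := fun q (hq : q ∈ U) => secondForm_comm hU hy hq 0 1
  rcases kernel_alternative hU hc ha hH (fun q _ => Complex.conj_ofReal _) (fun q hq => by
      rw [dzb, dz, pH q hq, pH q hq, pa q hq, pa q hq, pα q hq, pα q hq, pδ q hq, pδ q hq,
        cod0 q hq, cod1 q hq]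
      push_cast
      linear_combination (-((partialD 1 (fun r => secondForm y r 0 1) q : ℝ) : ℂ) / 2)
        * Complex.I_sq) (fun q hq => by
      have h1 : laplace y α q = 0 := by
        rw [← hα q hq, laplace, laplace]
        congr 2
        refine Finset.sum_congr rfl fun i _ => partialD_congr_on hU (fun r hr => ?_) hq i
        congr 1
        refine Finset.sum_congr rfl fun j _ => ?_
        rw [partialD_congr_on hU (fun s hs => (meanCurvature_of_flat (hg s hs)).symm) hr j]
      rw [laplace_of_flat hU hg α hq] at h1
      have h2 : ∀ i, partialD i (partialD i a) q = ((partialD i (partialD i α) q : ℝ) : ℂ) :=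
        fun i => by
          rw [partialD_congr_on hU (fun r hr => pa r hr i) hq,
            partialD_ofReal (diffAt (contDiffOn_partialD hU hαs i) hU hq)]
      rw [dzb_dz hU ha hq, h2, h2, ← Complex.ofReal_add,
        show partialD 0 (partialD 0 α) q + partialD 1 (partialD 1 α) q = 0 by linarith]
      simp) (fun q hq => by
      have hd := det_secondForm_eq_zero (cross_ne_zero_of_firstForm_eq_one (hg q hq)) (hK q hq)
      rw [Matrix.det_fin_two, ← hsym q hq] at hd
      have hd' : α q * α q = δ q * δ q + secondForm y q 0 1 * secondForm y q 0 1 := by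
        simp only [α, δ]
        linear_combination hd
      simp only [a, H]
      apply Complex.ext
      · simp
        linear_combination hd'
      · simp; ring) with ⟨τ, hτ, hk⟩ | ⟨z, hk⟩
  · left
    refine ⟨fromC τ, ?_, fun q hq i => ?_⟩
    · rw [EuclideanSpace.norm_eq, ← hτ, Complex.norm_eq_sqrt_sq_add_sq]
      simp [fromC_apply, Fin.sum_univ_two]
    · have h1 := hk q hq
      have hre := congrArg Complex.re h1
      have him := congrArg Complex.im h1
      simp [a, H] at hre him
      simp only [α, δ] at hre him
      have hs := hsym q hq
      fin_cases i
      · simp [fromC_apply]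
        linear_combination hre
      · simp [fromC_apply]
        linear_combination him - τ.re * hs
  · right
    refine ⟨fromC z, fun q hq => ⟨fun h => (hk q hq).1 (by rw [h, toC_fromC]), fun i => ?_⟩⟩
    have h1 := (hk q hq).2
    have hre := congrArg Complex.re h1
    have him := congrArg Complex.im h1
    simp [a, H, toC] at hre him
    simp only [α, δ] at hre him
    have hs := hsym q hq
    fin_cases i
    · simp [fromC_apply]
      linear_combination hre
    · simp [fromC_apply]
      linear_combination him - (q 0 - z.re) * hs

end FlatStructure

/-! ### Ruled frames and the Laplacian of the mean curvature of a ruled surface. -/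

section RuledSurfaces

/-- The curves `a`, `b`, with `(b, T, ν)` a positively oriented orthonormal frame satisfying the
equations of Frenet with curvature `κ`, which define a cylinder (`μ = 0`) or a cone (`μ = 1`). -/
structure IsRuledFrame (μ : ℝ) (I : Set ℝ) (κ : ℝ → ℝ) (a b T ν : ℝ → E3) : Prop where
  bb : ∀ s ∈ I, ‖b s‖ = 1
  TT : ∀ s ∈ I, ‖T s‖ = 1
  bT : ∀ s ∈ I, inner ℝ (b s) (T s) = 0
  cross_eq : ∀ s ∈ I, cross (b s) (T s) = ν s
  da : ∀ s ∈ I, HasDerivAt a ((1 - μ) • T s) s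
  db : ∀ s ∈ I, HasDerivAt b (μ • T s) s
  dT : ∀ s ∈ I, HasDerivAt T (κ s • ν s - μ • b s) s
  dν : ∀ s ∈ I, HasDerivAt ν (-(κ s • T s)) s

/-- The ruled surface with directrix `a` and rulings `b`. -/
def ruled (a b : ℝ → E3) (q : E2) : E3 := a (q 0) + q 1 • b (q 0)

variable {μ : ℝ} {I : Set ℝ} {κ : ℝ → ℝ} {a b T ν : ℝ → E3}

theorem IsRuledFrame.frame (h : IsRuledFrame μ I κ a b T ν) {s : ℝ} (hs : s ∈ I) :
    IsFrame (b s) (T s) (ν s) := by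
  rw [← h.cross_eq s hs]
  exact IsFrame.of_cross (h.bb s hs) (h.TT s hs) (h.bT s hs)

theorem IsRuledFrame.mono {J : Set ℝ} (h : IsRuledFrame μ I κ a b T ν) (hJ : J ⊆ I) :
    IsRuledFrame μ J κ a b T ν :=
  ⟨fun s hs => h.bb s (hJ hs), fun s hs => h.TT s (hJ hs), fun s hs => h.bT s (hJ hs),
    fun s hs => h.cross_eq s (hJ hs), fun s hs => h.da s (hJ hs), fun s hs => h.db s (hJ hs),
    fun s hs => h.dT s (hJ hs), fun s hs => h.dν s (hJ hs)⟩

theorem contDiffOn_of_hasDerivAt {F : Type*} [NormedAddCommGroup F] [NormedSpace ℝ F]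
    {f f' : ℝ → F} (hI : IsOpen I) (hf : ∀ s ∈ I, HasDerivAt f (f' s) s) {n : ℕ}
    (hf' : ContDiffOn ℝ n f' I) : ContDiffOn ℝ (n + 1) f I := by
  rw [contDiffOn_succ_iff_deriv_of_isOpen hI]
  refine ⟨fun s hs => (hf s hs).differentiableAt.differentiableWithinAt, by simp, ?_⟩
  exact hf'.congr fun s hs => (hf s hs).deriv

/-- The curves of a ruled frame are smooth. -/
theorem IsRuledFrame.contDiffOn (h : IsRuledFrame μ I κ a b T ν) (hI : IsOpen I)
    (hκ : ContDiffOn ℝ ∞ κ I) : ContDiffOn ℝ ∞ a I ∧ ContDiffOn ℝ ∞ b I ∧ ContDiffOn ℝ ∞ T I ∧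
      ContDiffOn ℝ ∞ ν I := by
  -- Bootstrapping: the derivatives of b, T, ν are combinations of the same curves with smooth
  -- coefficients, so each round gains one order of smoothness.
  have key : ∀ n : ℕ, ContDiffOn ℝ n b I ∧ ContDiffOn ℝ n T I ∧ ContDiffOn ℝ n ν I := by
    intro n
    induction n with
    | zero =>
      simp only [Nat.cast_zero, contDiffOn_zero]
      exact ⟨fun s hs => (h.db s hs).continuousAt.continuousWithinAt,
        fun s hs => (h.dT s hs).continuousAt.continuousWithinAt,
        fun s hs => (h.dν s hs).continuousAt.continuousWithinAt⟩
    | succ n ih =>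
      obtain ⟨hb, hT, hν⟩ := ih
      have hκn : ContDiffOn ℝ n κ I := hκ.of_le (by exact_mod_cast le_top)
      push_cast
      exact ⟨contDiffOn_of_hasDerivAt hI h.db (hT.const_smul μ),
        contDiffOn_of_hasDerivAt hI h.dT ((hκn.smul hν).sub (hb.const_smul μ)),
        contDiffOn_of_hasDerivAt hI h.dν (hκn.smul hT).neg⟩
  have hb := contDiffOn_infty.2 fun n => (key n).1
  have hT := contDiffOn_infty.2 fun n => (key n).2.1
  have hν := contDiffOn_infty.2 fun n => (key n).2.2
  refine ⟨contDiffOn_infty.2 fun n => ?_, hb, hT, hν⟩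
  exact (contDiffOn_of_hasDerivAt hI h.da (((key n).2.1).const_smul (1 - μ))).of_le
    (by exact_mod_cast Nat.le_succ n)

theorem differentiable_coord (i : Fin 2) : Differentiable ℝ (fun r : E2 => r i) :=
  (contDiff_euclidean.1 (contDiff_id (n := ∞)) i).differentiable (by simp)

theorem contDiff_coord (i : Fin 2) : ContDiff ℝ ∞ (fun r : E2 => r i) :=
  contDiff_euclidean.1 (contDiff_id (n := ∞)) i

theorem partialD_comp_coord {F : Type*} [NormedAddCommGroup F] [NormedSpace ℝ F] {f : ℝ → F}
    {f' : F} {q : E2} {k : Fin 2} (hf : HasDerivAt f f' (q k)) (i : Fin 2) :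
    partialD i (fun r : E2 => f (r k)) q = (if k = i then (1 : ℝ) else 0) • f' := by
  rw [partialD_comp_real (φ := fun r : E2 => r k) hf.differentiableAt (differentiable_coord k q),
    partialD_coord, hf.deriv]

theorem partialD_comp_coord_self {F : Type*} [NormedAddCommGroup F] [NormedSpace ℝ F] {f : ℝ → F}
    {f' : F} {q : E2} {k : Fin 2} (hf : HasDerivAt f f' (q k)) :
    partialD k (fun r : E2 => f (r k)) q = f' := by
  rw [partialD_comp_coord hf, if_pos rfl, one_smul]

theorem partialD_comp_coord_ne {F : Type*} [NormedAddCommGroup F] [NormedSpace ℝ F] {f : ℝ → F}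
    {f' : F} {q : E2} {k i : Fin 2} (hf : HasDerivAt f f' (q k)) (h : k ≠ i) :
    partialD i (fun r : E2 => f (r k)) q = 0 := by
  rw [partialD_comp_coord hf, if_neg h, zero_smul]

theorem diffAt_comp_coord {F : Type*} [NormedAddCommGroup F] [NormedSpace ℝ F] {f : ℝ → F}
    {f' : F} {q : E2} {k : Fin 2} (hf : HasDerivAt f f' (q k)) :
    DifferentiableAt ℝ (fun r : E2 => f (r k)) q :=
  hf.differentiableAt.comp q (differentiable_coord k q)

/-- The speed of the coordinate lines orthogonal to the rulings. -/
def rulingSpeed (μ : ℝ) (t : ℝ) : ℝ := 1 - μ + μ * t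

theorem hasDerivAt_rulingSpeed (μ t : ℝ) : HasDerivAt (rulingSpeed μ) μ t := by
  have h : HasDerivAt (rulingSpeed μ) (μ * 1) t :=
    ((hasDerivAt_id t).const_mul μ).const_add (1 - μ)
  rwa [mul_one] at h

variable {Y : E2 → E3} {U : Set E2} {q : E2}

theorem IsRuledFrame.partialD_zero (h : IsRuledFrame μ I κ a b T ν) (hq : q 0 ∈ I) :
    partialD 0 (ruled a b) q = rulingSpeed μ (q 1) • T (q 0) := by
  have d1 := diffAt_comp_coord (h.da _ hq)
  have d2 := diffAt_comp_coord (h.db _ hq)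
  have d3 := differentiable_coord 1 q
  unfold ruled
  rw [partialD_add d1 (d3.fun_smul d2), partialD_smul d3 d2, partialD_comp_coord_self (h.da _ hq),
    partialD_comp_coord_self (h.db _ hq), partialD_coord, rulingSpeed]
  simp only [one_ne_zero, if_false]
  module

theorem IsRuledFrame.partialD_one (h : IsRuledFrame μ I κ a b T ν) (hq : q 0 ∈ I) :
    partialD 1 (ruled a b) q = b (q 0) := by
  have d1 := diffAt_comp_coord (h.da _ hq)
  have d2 := diffAt_comp_coord (h.db _ hq)
  have d3 := differentiable_coord 1 q
  unfold ruled
  rw [partialD_add d1 (d3.fun_smul d2), partialD_smul d3 d2,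
    partialD_comp_coord_ne (h.da _ hq) zero_ne_one,
    partialD_comp_coord_ne (h.db _ hq) zero_ne_one, partialD_coord]
  simp

/-- Write w for the ruling speed. The metric is w²ds² + dt², the normal is -ν because (∂₀, ∂₁) has
the directions (T, b), and the mean curvature is -κ/(2w). The variables therefore separate, and
harmonicity is an ordinary differential equation for κ. -/
theorem IsRuledFrame.laplace_eq (h : IsRuledFrame μ I κ a b T ν) (hI : IsOpen I)
    (hκ : ContDiffOn ℝ ∞ κ I) (hU : IsOpen U) (hUI : ∀ q ∈ U, q 0 ∈ I ∧ 0 < rulingSpeed μ (q 1))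
    (hY : EqOn Y (ruled a b) U) (hq : q ∈ U) :
    laplace Y (meanCurvature Y) q
      = (deriv (deriv κ) (q 0) + μ ^ 2 * κ (q 0)) / (2 * rulingSpeed μ (q 1) ^ 3) := by
  have p0 : ∀ r ∈ U, partialD 0 Y r = rulingSpeed μ (r 1) • T (r 0) := fun r hr => by
    rw [partialD_congr_on hU hY hr, h.partialD_zero (hUI r hr).1]
  have p1 : ∀ r ∈ U, partialD 1 Y r = b (r 0) := fun r hr => by
    rw [partialD_congr_on hU hY hr, h.partialD_one (hUI r hr).1]
  have w0 : ∀ r ∈ U, rulingSpeed μ (r 1) ≠ 0 := fun r hr => (hUI r hr).2.ne'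
  have dw : ∀ r : E2, DifferentiableAt ℝ (fun r : E2 => rulingSpeed μ (r 1)) r :=
    fun r => diffAt_comp_coord (hasDerivAt_rulingSpeed μ (r 1))
  have pw0 : ∀ r : E2, partialD 0 (fun r : E2 => rulingSpeed μ (r 1)) r = 0 := fun r =>
    partialD_comp_coord_ne (hasDerivAt_rulingSpeed μ (r 1)) one_ne_zero
  have pw1 : ∀ r : E2, partialD 1 (fun r : E2 => rulingSpeed μ (r 1)) r = μ := fun r =>
    partialD_comp_coord_self (hasDerivAt_rulingSpeed μ (r 1))
  have hnormal : ∀ r ∈ U, unitNormal Y r = -ν (r 0) := fun r hr => by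
    have f := h.frame (hUI r hr).1
    have hc : cross (partialD 0 Y r) (partialD 1 Y r) = -(rulingSpeed μ (r 1) • ν (r 0)) := by
      rw [p0 r hr, p1 r hr, cross_smul_left, cross_anticomm, h.cross_eq _ (hUI r hr).1, smul_neg]
    rw [unitNormal, hc, norm_neg, norm_smul, f.ww, mul_one, Real.norm_of_nonneg (hUI r hr).2.le,
      smul_neg, inv_smul_smul₀ (w0 r hr)]
  have hfirst : ∀ r ∈ U, firstForm Y r = !![rulingSpeed μ (r 1) ^ 2, 0; 0, 1] := fun r hr => by
    have f := h.frame (hUI r hr).1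
    ext i j
    simp only [firstForm, Matrix.of_apply]
    fin_cases i <;> fin_cases j <;>
      simp [p0 r hr, p1 r hr, inner_smul_left, inner_smul_right, f.uv, f.vu, f.uu, f.vv,
        norm_smul, sq]
  have hinv : ∀ r ∈ U, (firstForm Y r)⁻¹ = !![(rulingSpeed μ (r 1) ^ 2)⁻¹, 0; 0, 1] :=
    fun r hr => by
      rw [hfirst r hr]
      apply Matrix.inv_eq_right_inv
      rw [Matrix.mul_fin_two, Matrix.one_fin_two, mul_inv_cancel₀ (pow_ne_zero 2 (w0 r hr))]
      simp
  have hdet : ∀ r ∈ U, √(firstForm Y r).det = rulingSpeed μ (r 1) := fun r hr => by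
    rw [hfirst r hr, Matrix.det_fin_two_of]
    simp [Real.sqrt_sq (hUI r hr).2.le]
  have hsec : ∀ r ∈ U, secondForm Y r 0 0 = -(rulingSpeed μ (r 1) * κ (r 0)) ∧
      secondForm Y r 1 1 = 0 := fun r hr => by
    have f := h.frame (hUI r hr).1
    have e0 : partialD 0 (partialD 0 Y) r
        = rulingSpeed μ (r 1) • (κ (r 0) • ν (r 0) - μ • b (r 0)) := by
      rw [partialD_congr_on hU p0 hr,
        partialD_smul (dw r) (diffAt_comp_coord (h.dT _ (hUI r hr).1)), pw0,
        partialD_comp_coord_self (h.dT _ (hUI r hr).1)]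
      simp
    have e1 : partialD 1 (partialD 1 Y) r = 0 := by
      rw [partialD_congr_on hU p1 hr, partialD_comp_coord_ne (h.db _ (hUI r hr).1) zero_ne_one]
    simp only [secondForm, Matrix.of_apply, hnormal r hr, e0, e1]
    simp [inner_smul_left, inner_sub_left, f.ww, f.uw]
  have hmean : ∀ r ∈ U, meanCurvature Y r = κ (r 0) * (-(2 * rulingSpeed μ (r 1))⁻¹) :=
    fun r hr => by
      rw [meanCurvature, hinv r hr, Matrix.trace_fin_two, Matrix.mul_apply, Matrix.mul_apply,
        Fin.sum_univ_two, Fin.sum_univ_two, (hsec r hr).1, (hsec r hr).2]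
      have := w0 r hr
      simp
      field_simp
  have hκ' : ∀ s ∈ I, HasDerivAt κ (deriv κ s) s := fun s hs =>
    ((hκ.contDiffAt (hI.mem_nhds hs)).differentiableAt (by simp)).hasDerivAt
  have hκ'' : ∀ s ∈ I, HasDerivAt (deriv κ) (deriv (deriv κ) s) s := fun s hs =>
    (((hκ.deriv_of_isOpen (m := ∞) hI (by simp)).contDiffAt
      (hI.mem_nhds hs)).differentiableAt (by simp)).hasDerivAt
  have hv : ∀ t, rulingSpeed μ t ≠ 0 → HasDerivAt (fun t => -(2 * rulingSpeed μ t)⁻¹)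
      (μ / (2 * rulingSpeed μ t ^ 2)) t := fun t ht => by
    have := (((hasDerivAt_rulingSpeed μ t).const_mul 2).inv (mul_ne_zero two_ne_zero ht)).neg
    refine this.congr_deriv ?_
    field_simp
  have m0 : ∀ r ∈ U, partialD 0 (meanCurvature Y) r
      = deriv κ (r 0) * (-(2 * rulingSpeed μ (r 1))⁻¹) := fun r hr => by
    have e1 := hκ' _ (hUI r hr).1
    have e2 := hv _ (w0 r hr)
    rw [partialD_congr_on hU hmean hr, partialD_mul (diffAt_comp_coord e1) (diffAt_comp_coord e2),
      partialD_comp_coord_self e1, partialD_comp_coord_ne e2 one_ne_zero]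
    ring
  have m1 : ∀ r ∈ U, partialD 1 (meanCurvature Y) r
      = κ (r 0) * (μ / (2 * rulingSpeed μ (r 1) ^ 2)) := fun r hr => by
    have e1 := hκ' _ (hUI r hr).1
    have e2 := hv _ (w0 r hr)
    rw [partialD_congr_on hU hmean hr, partialD_mul (diffAt_comp_coord e1) (diffAt_comp_coord e2),
      partialD_comp_coord_self e2, partialD_comp_coord_ne e1 zero_ne_one]
    ring
  have t0 : partialD 0 (fun r => √(firstForm Y r).det
      * ∑ j, (firstForm Y r)⁻¹ 0 j * partialD j (meanCurvature Y) r) q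
      = deriv (deriv κ) (q 0) * (-(2 * rulingSpeed μ (q 1) ^ 2)⁻¹) := by
    have e1 := hκ'' _ (hUI q hq).1
    have e2 : HasDerivAt (fun t => -(2 * rulingSpeed μ t ^ 2)⁻¹) _ (q 1) :=
      ((((hasDerivAt_rulingSpeed μ (q 1)).pow 2).const_mul 2).inv
        (mul_ne_zero two_ne_zero (pow_ne_zero 2 (w0 q hq)))).neg
    rw [partialD_congr_on (g := fun r => deriv κ (r 0) * (-(2 * rulingSpeed μ (r 1) ^ 2)⁻¹)) hU
      (fun r hr => ?_) hq, partialD_mul (diffAt_comp_coord e1) (diffAt_comp_coord e2),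
      partialD_comp_coord_self e1, partialD_comp_coord_ne e2 one_ne_zero]
    · ring
    · simp only [hdet r hr, hinv r hr, Fin.sum_univ_two, m0 r hr, m1 r hr]
      have := w0 r hr
      simp
      field_simp
  have t1 : partialD 1 (fun r => √(firstForm Y r).det
      * ∑ j, (firstForm Y r)⁻¹ 1 j * partialD j (meanCurvature Y) r) q
      = - κ (q 0) * (μ ^ 2 / (2 * rulingSpeed μ (q 1) ^ 2)) := by
    have e1 := hκ' _ (hUI q hq).1
    have e2 := hv _ (w0 q hq)
    rw [partialD_congr_on (g := fun r => (-μ) * (κ (r 0) * -(2 * rulingSpeed μ (r 1))⁻¹)) hU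
      (fun r hr => ?_) hq, partialD_mul (differentiableAt_const _)
        ((diffAt_comp_coord e1).fun_mul (diffAt_comp_coord e2)), partialD_const,
      partialD_mul (diffAt_comp_coord e1) (diffAt_comp_coord e2), partialD_comp_coord_self e2,
      partialD_comp_coord_ne e1 zero_ne_one]
    · ring
    · simp only [hdet r hr, hinv r hr, Fin.sum_univ_two, m0 r hr, m1 r hr]
      have := w0 r hr
      simp
      field_simp
  rw [laplace, Fin.sum_univ_two, t0, t1, hdet q hq]
  have := w0 q hq
  field_simp
  ring

end RuledSurfaces

/-! ### From a kernel direction in the plane to a ruled frame in space. -/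

section LocalRuling

variable {F : Type*} [NormedAddCommGroup F] [NormedSpace ℝ F]

theorem hasDerivAt_horizontal (s t : ℝ) :
    HasDerivAt (fun s : ℝ => (!₂[s, t] : E2)) (EuclideanSpace.single 0 1) s := by
  have h1 : (fun s : ℝ => (!₂[s, t] : E2))
      = fun s => s • EuclideanSpace.single 0 1 + t • EuclideanSpace.single 1 1 := by
    ext s i; fin_cases i <;> simp
  rw [h1]
  simpa using ((hasDerivAt_id s).smul_const (EuclideanSpace.single (0 : Fin 2) (1 : ℝ))).add_const
    (t • EuclideanSpace.single (1 : Fin 2) (1 : ℝ))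

theorem hasDerivAt_comp_horizontal {f : E2 → F} {s t : ℝ}
    (hf : DifferentiableAt ℝ f !₂[s, t]) :
    HasDerivAt (fun s : ℝ => f !₂[s, t]) (partialD 0 f !₂[s, t]) s :=
  hf.hasFDerivAt.comp_hasDerivAt s (hasDerivAt_horizontal s t)

theorem contDiff_horizontal (t : ℝ) : ContDiff ℝ ∞ (fun s : ℝ => (!₂[s, t] : E2)) := by
  rw [contDiff_euclidean]
  intro i
  fin_cases i
  · exact contDiff_id
  · exact contDiff_const

/-- The slice through the centre contains every abscissa of the disc (`coord_mem_of_mem_ball`).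
Functions of the first coordinate alone are therefore read off on this slice. -/
theorem horizontal_mem_ball {q₀ : E2} {r s : ℝ} :
    (!₂[s, q₀ 1] : E2) ∈ Metric.ball q₀ r ↔ s ∈ Ioo (q₀ 0 - r) (q₀ 0 + r) := by
  rw [Metric.mem_ball, EuclideanSpace.dist_eq, Fin.sum_univ_two]
  simp only [Matrix.cons_val_zero, Matrix.cons_val_one, dist_self]
  rw [zero_pow two_ne_zero, add_zero, Real.sqrt_sq dist_nonneg, Real.dist_eq, abs_lt, mem_Ioo]
  constructor <;> rintro ⟨h1, h2⟩ <;> constructor <;> linarith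

theorem coord_mem_of_mem_ball {q₀ q : E2} {r : ℝ} (hq : q ∈ Metric.ball q₀ r) :
    q 0 ∈ Ioo (q₀ 0 - r) (q₀ 0 + r) := by
  rw [Metric.mem_ball, EuclideanSpace.dist_eq, Fin.sum_univ_two] at hq
  have h1 : |q 0 - q₀ 0| < r := by
    refine lt_of_le_of_lt ?_ hq
    rw [← Real.dist_eq]
    exact Real.le_sqrt_of_sq_le (by linarith [sq_nonneg (dist (q 1) (q₀ 1))])
  rw [abs_lt] at h1
  exact ⟨by linarith, by linarith⟩

/-- A function on a disc with `∂₁ f = 0` depends on the first coordinate only. -/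
theorem eq_of_partialD_one_eq_zero {f : E2 → F} {q₀ q : E2} {r : ℝ}
    (hf : DifferentiableOn ℝ f (Metric.ball q₀ r))
    (h : ∀ q ∈ Metric.ball q₀ r, partialD 1 f q = 0) (hq : q ∈ Metric.ball q₀ r) :
    f q = f !₂[q 0, q₀ 1] := by
  set p : E2 := !₂[q 0, q₀ 1] with hp
  have hpB : p ∈ Metric.ball q₀ r := horizontal_mem_ball.2 (coord_mem_of_mem_ball hq)
  have hseg : ∀ t ∈ Icc (0 : ℝ) 1, p + t • (q - p) ∈ Metric.ball q₀ r := fun t ht =>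
    (convex_ball q₀ r).add_smul_sub_mem hpB hq ht
  have hd : ∀ t ∈ Icc (0 : ℝ) 1, HasDerivAt (fun t : ℝ => f (p + t • (q - p))) 0 t := by
    intro t ht
    have h1 : HasDerivAt (fun t : ℝ => p + t • (q - p)) (q - p) t := by
      simpa using ((hasDerivAt_id t).smul_const (q - p)).const_add p
    have h2 := ((hf.differentiableAt
      (Metric.isOpen_ball.mem_nhds (hseg t ht))).hasFDerivAt).comp_hasDerivAt t h1
    refine h2.congr_deriv ?_
    rw [fderiv_apply_eq, h _ (hseg t ht)]
    simp [hp]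
  have := constant_of_has_deriv_right_zero (fun t ht => (hd t ht).continuousAt.continuousWithinAt)
    (fun t ht => (hd t (Ico_subset_Icc_self ht)).hasDerivWithinAt) 1 (right_mem_Icc.2 zero_le_one)
  simpa using this

variable {y : E2 → E3} {U : Set E2} {μ : ℝ}

/-- The parametrization of the plane by the lines through a point or by parallel lines. -/
def planarRuling (μ : ℝ) (c : E2) (τ n : ℝ → E2) (q : E2) : E2 :=
  c + (((1 - μ) * q 0) • n (q 0) + q 1 • τ (q 0))

/-- The moving frame of a planar ruling. -/
structure IsPlanarFrame (μ : ℝ) (τ n : ℝ → E2) : Prop where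
  mu : μ * (1 - μ) = 0
  unit : ∀ s, τ s 0 ^ 2 + τ s 1 ^ 2 = 1
  n0 : ∀ s, n s 0 = -τ s 1
  n1 : ∀ s, n s 1 = τ s 0
  dτ : ∀ s, HasDerivAt τ (μ • n s) s
  dn : ∀ s, HasDerivAt n (-(μ • τ s)) s
  sτ : ContDiff ℝ ∞ τ
  sn : ContDiff ℝ ∞ n

namespace IsPlanarFrame

variable {c : E2} {τ n : ℝ → E2}

theorem contDiff_planarRuling (h : IsPlanarFrame μ τ n) : ContDiff ℝ ∞ (planarRuling μ c τ n) :=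
  contDiff_const.add (((contDiff_const.mul (contDiff_coord 0)).smul
    (h.sn.comp (contDiff_coord 0))).add ((contDiff_coord 1).smul (h.sτ.comp (contDiff_coord 0))))

theorem partialD_planarRuling (h : IsPlanarFrame μ τ n) (q : E2) :
    partialD 0 (planarRuling μ c τ n) q = rulingSpeed μ (q 1) • n (q 0) ∧
      partialD 1 (planarRuling μ c τ n) q = τ (q 0) := by
  have d0 := differentiable_coord 0 q
  have d1 := differentiable_coord 1 q
  have dn := diffAt_comp_coord (k := 0) (q := q) (h.dn _)
  have dt := diffAt_comp_coord (k := 0) (q := q) (h.dτ _)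
  have dc : DifferentiableAt ℝ (fun r : E2 => (1 - μ) * r 0) q := d0.const_mul _
  have e : ∀ i, partialD i (planarRuling μ c τ n) q
      = ((1 - μ) * q 0) • partialD i (fun r : E2 => n (r 0)) q
        + ((1 - μ) * (if (0 : Fin 2) = i then 1 else 0)) • n (q 0)
        + (q 1 • partialD i (fun r : E2 => τ (r 0)) q
        + (if (1 : Fin 2) = i then (1 : ℝ) else 0) • τ (q 0)) := by
    intro i
    unfold planarRuling
    rw [partialD_add (differentiableAt_const _) ((dc.fun_smul dn).fun_add (d1.fun_smul dt)),
      partialD_add (dc.fun_smul dn) (d1.fun_smul dt), partialD_smul dc dn, partialD_smul d1 dt,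
      partialD_mul (differentiableAt_const _) d0, partialD_const, partialD_const, partialD_coord,
      partialD_coord]
    simp
  constructor
  · rw [e, partialD_comp_coord_self (h.dn _), partialD_comp_coord_self (h.dτ _), rulingSpeed]
    have h1 := h.mu
    -- The directrix moves along the normal only for cylinders and the frame turns only for cones;
    -- μ(1 - μ) = 0 kills the mixed term.
    have h2 : ((1 - μ) * q 0) • -(μ • τ (q 0)) = 0 := by
      rw [smul_neg, smul_smul, show (1 - μ) * q 0 * μ = 0 by linear_combination q 0 * h1, zero_smul,
        neg_zero]
    rw [h2]
    simp only [if_true, one_ne_zero, if_false]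
    module
  · rw [e, partialD_comp_coord_ne (h.dn _) zero_ne_one, partialD_comp_coord_ne (h.dτ _) zero_ne_one]
    simp

theorem injective_fderiv (h : IsPlanarFrame μ τ n) {q : E2} (hq : rulingSpeed μ (q 1) ≠ 0) :
    Function.Injective (fderiv ℝ (planarRuling μ c τ n) q) := by
  rw [injective_iff_map_eq_zero]
  intro v hv
  rw [fderiv_apply_eq, (h.partialD_planarRuling q).1, (h.partialD_planarRuling q).2] at hv
  have e0 := congrArg (fun u : E2 => u 0) hv
  have e1 := congrArg (fun u : E2 => u 1) hv
  simp only [PiLp.add_apply, PiLp.smul_apply, smul_eq_mul, h.n0, h.n1, PiLp.zero_apply] at e0 e1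
  have hu := h.unit (q 0)
  have h1 : v 1 = 0 := by
    linear_combination τ (q 0) 0 * e0 + τ (q 0) 1 * e1 - v 1 * hu
  have h0 : rulingSpeed μ (q 1) * v 0 = 0 := by
    linear_combination τ (q 0) 0 * e1 - τ (q 0) 1 * e0 - rulingSpeed μ (q 1) * v 0 * hu
  exact ext_E2 ((mul_eq_zero.1 h0).resolve_left hq) h1

/-- A flat surface whose second fundamental form has the direction of a planar ruling in its
kernel is ruled by the images of the lines. -/
theorem exists_ruledFrame (hf : IsPlanarFrame μ τ n) (hU : IsOpen U) (hy : ContDiffOn ℝ ∞ y U)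
    (hg : ∀ q ∈ U, firstForm y q = 1) {q₀ : E2} {r : ℝ}
    (hmem : ∀ q ∈ Metric.ball q₀ r, planarRuling μ c τ n q ∈ U)
    (hk : ∀ q ∈ Metric.ball q₀ r, ∀ i,
      secondForm y (planarRuling μ c τ n q) i 0 * τ (q 0) 0
        + secondForm y (planarRuling μ c τ n q) i 1 * τ (q 0) 1 = 0) :
    ∃ (κ : ℝ → ℝ) (a b T ν : ℝ → E3), ContDiffOn ℝ ∞ κ (Ioo (q₀ 0 - r) (q₀ 0 + r)) ∧
      IsRuledFrame μ (Ioo (q₀ 0 - r) (q₀ 0 + r)) κ a b T ν ∧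
      ∀ q ∈ Metric.ball q₀ r, y (planarRuling μ c τ n q) = ruled a b q := by
  set Φ := planarRuling μ c τ n with hΦdef
  set B := Metric.ball q₀ r
  have hB : IsOpen B := Metric.isOpen_ball
  have hΦ : ContDiff ℝ ∞ Φ := hf.contDiff_planarRuling
  have dΦ : ∀ q, DifferentiableAt ℝ Φ q := fun q => hΦ.differentiable (by simp) q
  have hmaps : MapsTo Φ B U := hmem
  have hd := contDiffOn_partialD hU hy
  have hξ := contDiffOn_unitNormal hU hy fun q hq => cross_ne_zero_of_firstForm_eq_one (hg q hq)
  have hh := contDiffOn_secondForm hU hy hg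
  have comp : ∀ {f : E2 → E3}, ContDiffOn ℝ ∞ f U → ContDiffOn ℝ ∞ (fun q => f (Φ q)) B :=
    fun hf => hf.comp hΦ.contDiffOn hmaps
  have compR : ∀ {f : E2 → ℝ}, ContDiffOn ℝ ∞ f U → ContDiffOn ℝ ∞ (fun q => f (Φ q)) B :=
    fun hf => hf.comp hΦ.contDiffOn hmaps
  have sτ : ∀ k, ContDiff ℝ ∞ (fun q : E2 => τ (q 0) k) := fun k =>
    (contDiff_euclidean.1 hf.sτ k).comp (contDiff_coord 0)
  have sn : ∀ k, ContDiff ℝ ∞ (fun q : E2 => n (q 0) k) := fun k =>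
    (contDiff_euclidean.1 hf.sn k).comp (contDiff_coord 0)
  have pd0 : ∀ {f : E2 → E3}, ContDiffOn ℝ ∞ f U → ∀ q ∈ B, partialD 0 (fun q => f (Φ q)) q
      = (rulingSpeed μ (q 1) * n (q 0) 0) • partialD 0 f (Φ q)
        + (rulingSpeed μ (q 1) * n (q 0) 1) • partialD 1 f (Φ q) := fun hf' q hq => by
    rw [partialD_comp (diffAt hf' hU (hmaps hq)) (dΦ q), (hf.partialD_planarRuling q).1]
    simp
  have pd1 : ∀ {f : E2 → E3}, ContDiffOn ℝ ∞ f U → ∀ q ∈ B, partialD 1 (fun q => f (Φ q)) q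
      = τ (q 0) 0 • partialD 0 f (Φ q) + τ (q 0) 1 • partialD 1 f (Φ q) := fun hf' q hq => by
    rw [partialD_comp (diffAt hf' hU (hmaps hq)) (dΦ q), (hf.partialD_planarRuling q).2]
  have hτ' : ∀ k s, HasDerivAt (fun s => τ s k) (μ * n s k) s := fun k s =>
    ((EuclideanSpace.proj k : E2 →L[ℝ] ℝ).hasFDerivAt.comp_hasDerivAt s (hf.dτ s))
  have hn' : ∀ k s, HasDerivAt (fun s => n s k) (-(μ * τ s k)) s := fun k s =>
    ((EuclideanSpace.proj k : E2 →L[ℝ] ℝ).hasFDerivAt.comp_hasDerivAt s (hf.dn s))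
  -- G and N are the images under dy of the planar frame (τ, n), and K below is w·h(n, n). Since
  -- h(τ, ·) = 0, the field G is constant along the rulings and (G, N, Ξ) satisfies the Frenet
  -- equations in s with curvature K.
  let G : E2 → E3 := fun q =>
    τ (q 0) 0 • partialD 0 y (Φ q) + τ (q 0) 1 • partialD 1 y (Φ q)
  let N : E2 → E3 := fun q =>
    n (q 0) 0 • partialD 0 y (Φ q) + n (q 0) 1 • partialD 1 y (Φ q)
  let Ξ : E2 → E3 := fun q => unitNormal y (Φ q)
  let K : E2 → ℝ := fun q => rulingSpeed μ (q 1) * (secondForm y (Φ q) 0 0 * n (q 0) 0 ^ 2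
    + 2 * secondForm y (Φ q) 0 1 * n (q 0) 0 * n (q 0) 1 + secondForm y (Φ q) 1 1 * n (q 0) 1 ^ 2)
  have hG : ContDiffOn ℝ ∞ G B :=
    ((sτ 0).contDiffOn.smul (comp (hd 0))).add ((sτ 1).contDiffOn.smul (comp (hd 1)))
  have hN : ContDiffOn ℝ ∞ N B :=
    ((sn 0).contDiffOn.smul (comp (hd 0))).add ((sn 1).contDiffOn.smul (comp (hd 1)))
  have hΞ : ContDiffOn ℝ ∞ Ξ B := comp hξ
  have hw : ContDiff ℝ ∞ (fun q : E2 => rulingSpeed μ (q 1)) :=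
    contDiff_const.add (contDiff_const.mul (contDiff_coord 1))
  have hK : ContDiffOn ℝ ∞ K B :=
    hw.contDiffOn.mul ((((compR (hh 0 0)).mul ((sn 0).contDiffOn.pow 2)).add
      (((contDiffOn_const.mul (compR (hh 0 1))).mul (sn 0).contDiffOn).mul (sn 1).contDiffOn)).add
      ((compR (hh 1 1)).mul ((sn 1).contDiffOn.pow 2)))
  have hyΦ := comp hy
  have y0 : ∀ q ∈ B, partialD 0 (fun q => y (Φ q)) q = rulingSpeed μ (q 1) • N q := fun q hq => by
    rw [pd0 hy q hq]; simp only [N]; module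
  have y1 : ∀ q ∈ B, partialD 1 (fun q => y (Φ q)) q = G q := fun q hq => pd1 hy q hq
  have gen : ∀ (v w : ℝ → E2) (i : Fin 2) (q : E2), q ∈ B →
      (∀ k, HasDerivAt (fun s => v s k) (w (q 0) k) (q 0)) →
      partialD i (fun q => v (q 0) 0 • partialD 0 y (Φ q) + v (q 0) 1 • partialD 1 y (Φ q)) q
      = (v (q 0) 0 • partialD i (fun q => partialD 0 y (Φ q)) q
          + (if (0 : Fin 2) = i then w (q 0) 0 else 0) • partialD 0 y (Φ q))
        + (v (q 0) 1 • partialD i (fun q => partialD 1 y (Φ q)) q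
          + (if (0 : Fin 2) = i then w (q 0) 1 else 0) • partialD 1 y (Φ q)) := by
    intro v w i q hq hv
    have dv : ∀ k, DifferentiableAt ℝ (fun q : E2 => v (q 0) k) q := fun k =>
      diffAt_comp_coord (f := fun s => v s k) (hv k)
    have dy := fun k => diffAt (comp (hd k)) hB hq
    have pv : ∀ k, partialD i (fun q : E2 => v (q 0) k) q
        = if (0 : Fin 2) = i then w (q 0) k else 0 := fun k => by
      rw [partialD_comp_coord (f := fun s => v s k) (hv k)]
      split_ifs <;> simp
    rw [partialD_add ((dv 0).fun_smul (dy 0)) ((dv 1).fun_smul (dy 1)),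
      partialD_smul (dv 0) (dy 0), partialD_smul (dv 1) (dy 1), pv, pv]
  have hsym := fun q (hq : q ∈ B) => secondForm_comm hU hy (hmaps hq) 1 0
  have G1 : ∀ q ∈ B, partialD 1 G q = 0 := fun q hq => by
    have e := gen τ (fun s => μ • n s) 1 q hq (fun k => hτ' k _)
    change partialD 1 G q = _ at e
    rw [e, pd1 (hd 0) q hq, pd1 (hd 1) q hq]
    simp only [gauss_formula hU hy hg (hmaps hq), zero_ne_one, if_false]
    rw [hsym q hq]
    have k0 := hk q hq 0
    have k1 := hk q hq 1
    rw [hsym q hq] at k1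
    have : (τ (q 0) 0 * (secondForm y (Φ q) 0 0 * τ (q 0) 0 + secondForm y (Φ q) 0 1 * τ (q 0) 1)
      + τ (q 0) 1 * (secondForm y (Φ q) 0 1 * τ (q 0) 0 + secondForm y (Φ q) 1 1 * τ (q 0) 1))
      • unitNormal y (Φ q) = 0 := by rw [k0, k1]; simp
    rw [← this]
    module
  have G0 : ∀ q ∈ B, partialD 0 G q = μ • N q := fun q hq => by
    have e := gen τ (fun s => μ • n s) 0 q hq (fun k => hτ' k _)
    change partialD 0 G q = _ at e
    rw [e, pd0 (hd 0) q hq, pd0 (hd 1) q hq]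
    simp only [gauss_formula hU hy hg (hmaps hq), if_true, PiLp.smul_apply, smul_eq_mul]
    rw [hsym q hq]
    have k0 := hk q hq 0
    have k1 := hk q hq 1
    rw [hsym q hq] at k1
    have : (rulingSpeed μ (q 1) * (n (q 0) 0 * (secondForm y (Φ q) 0 0 * τ (q 0) 0
      + secondForm y (Φ q) 0 1 * τ (q 0) 1)
      + n (q 0) 1 * (secondForm y (Φ q) 0 1 * τ (q 0) 0 + secondForm y (Φ q) 1 1 * τ (q 0) 1)))
      • unitNormal y (Φ q) = 0 := by rw [k0, k1]; simp
    rw [← sub_eq_zero, ← this]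
    simp only [N]
    module
  have N0 : ∀ q ∈ B, partialD 0 N q = K q • Ξ q - μ • G q := fun q hq => by
    have e := gen n (fun s => -(μ • τ s)) 0 q hq (fun k => hn' k _)
    change partialD 0 N q = _ at e
    rw [e, pd0 (hd 0) q hq, pd0 (hd 1) q hq]
    simp only [gauss_formula hU hy hg (hmaps hq), if_true, PiLp.smul_apply, PiLp.neg_apply,
      smul_eq_mul]
    rw [hsym q hq]
    simp only [K, Ξ, G]
    module
  have Ξ0 : ∀ q ∈ B, partialD 0 Ξ q = -(K q • N q) := fun q hq => by
    have e : partialD 0 Ξ q = _ := pd0 hξ q hq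
    rw [e, weingarten_formula hU hy hg (hmaps hq), weingarten_formula hU hy hg (hmaps hq),
      hsym q hq]
    have k0 := hk q hq 0
    have k1 := hk q hq 1
    rw [hsym q hq] at k1
    have hu := hf.unit (q 0)
    -- Together with `c1` this says h n = h(n, n) n: h is symmetric with τ in its kernel, and n
    -- completes τ to an orthonormal basis.
    have c0 : secondForm y (Φ q) 0 0 * n (q 0) 0 + secondForm y (Φ q) 0 1 * n (q 0) 1
        = (secondForm y (Φ q) 0 0 * n (q 0) 0 ^ 2
          + 2 * secondForm y (Φ q) 0 1 * n (q 0) 0 * n (q 0) 1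
          + secondForm y (Φ q) 1 1 * n (q 0) 1 ^ 2) * n (q 0) 0 := by
      rw [hf.n0, hf.n1]
      linear_combination (τ (q 0) 1 * secondForm y (Φ q) 0 0
        - τ (q 0) 0 * secondForm y (Φ q) 0 1) * hu - τ (q 0) 0 * τ (q 0) 1 * k0
        + τ (q 0) 0 ^ 2 * k1
    have c1 : secondForm y (Φ q) 0 1 * n (q 0) 0 + secondForm y (Φ q) 1 1 * n (q 0) 1
        = (secondForm y (Φ q) 0 0 * n (q 0) 0 ^ 2
          + 2 * secondForm y (Φ q) 0 1 * n (q 0) 0 * n (q 0) 1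
          + secondForm y (Φ q) 1 1 * n (q 0) 1 ^ 2) * n (q 0) 1 := by
      rw [hf.n0, hf.n1]
      linear_combination (τ (q 0) 1 * secondForm y (Φ q) 0 1
        - τ (q 0) 0 * secondForm y (Φ q) 1 1) * hu - τ (q 0) 1 ^ 2 * k0
        + τ (q 0) 0 * τ (q 0) 1 * k1
    have key : (rulingSpeed μ (q 1) * n (q 0) 0) • -(secondForm y (Φ q) 0 0 • partialD 0 y (Φ q)
        + secondForm y (Φ q) 0 1 • partialD 1 y (Φ q))
        + (rulingSpeed μ (q 1) * n (q 0) 1) • -(secondForm y (Φ q) 0 1 • partialD 0 y (Φ q)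
        + secondForm y (Φ q) 1 1 • partialD 1 y (Φ q))
        = -(rulingSpeed μ (q 1) • ((secondForm y (Φ q) 0 0 * n (q 0) 0
          + secondForm y (Φ q) 0 1 * n (q 0) 1) • partialD 0 y (Φ q)
          + (secondForm y (Φ q) 0 1 * n (q 0) 0 + secondForm y (Φ q) 1 1 * n (q 0) 1)
          • partialD 1 y (Φ q))) := by module
    rw [key, c0, c1]
    simp only [K, N]
    module
  set I := Ioo (q₀ 0 - r) (q₀ 0 + r)
  have hI : ∀ s ∈ I, (!₂[s, q₀ 1] : E2) ∈ B := fun s hs => horizontal_mem_ball.2 hs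
  have hder : ∀ {f : E2 → E3}, ContDiffOn ℝ ∞ f B → ∀ s ∈ I,
      HasDerivAt (fun s => f !₂[s, q₀ 1]) (partialD 0 f !₂[s, q₀ 1]) s := fun hf s hs =>
    hasDerivAt_comp_horizontal (diffAt hf hB (hI s hs))
  have hfr : ∀ q ∈ B, IsFrame (partialD 0 y (Φ q)) (partialD 1 y (Φ q)) (unitNormal y (Φ q)) :=
    fun q hq => isFrame_of_firstForm_eq_one (hg _ (hmaps hq))
  -- Both G and y ∘ Φ - tG have zero derivative along the rulings. Their values on the slice t = `q₀
  -- 1` give the ruling field and the directrix.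
  refine ⟨fun s => K !₂[s, q₀ 1], fun s => y (Φ !₂[s, q₀ 1]) - q₀ 1 • G !₂[s, q₀ 1],
    fun s => G !₂[s, q₀ 1], fun s => N !₂[s, q₀ 1], fun s => Ξ !₂[s, q₀ 1], ?_, ?_, ?_⟩
  · exact hK.comp (contDiff_horizontal _).contDiffOn hI
  · refine ⟨fun s hs => ?_, fun s hs => ?_, fun s hs => ?_, fun s hs => ?_, fun s hs => ?_,
      fun s hs => ?_, fun s hs => ?_, fun s hs => ?_⟩
    · have f := hfr _ (hI s hs)
      have hu := hf.unit s
      rw [← pow_eq_one_iff_of_nonneg (norm_nonneg _) two_ne_zero, ← real_inner_self_eq_norm_sq]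
      simp only [G, inner_add_left, inner_add_right, inner_smul_left, inner_smul_right, f.uu',
        f.vv', f.uv, f.vu, conj_trivial]
      simp
      linear_combination hu
    · have f := hfr _ (hI s hs)
      have hu := hf.unit s
      rw [← pow_eq_one_iff_of_nonneg (norm_nonneg _) two_ne_zero, ← real_inner_self_eq_norm_sq]
      simp only [N, inner_add_left, inner_add_right, inner_smul_left, inner_smul_right, f.uu',
        f.vv', f.uv, f.vu, conj_trivial]
      simp [hf.n0, hf.n1]
      linear_combination hu
    · have f := hfr _ (hI s hs)
      simp only [G, N, inner_add_left, inner_add_right, inner_smul_left, inner_smul_right, f.uu',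
        f.vv', f.uv, f.vu, conj_trivial]
      simp [hf.n0, hf.n1]
      ring
    · have f := hfr _ (hI s hs)
      have hu := hf.unit s
      have hx : cross (partialD 0 y (Φ !₂[s, q₀ 1])) (partialD 1 y (Φ !₂[s, q₀ 1]))
          = unitNormal y (Φ !₂[s, q₀ 1]) := by
        rw [unitNormal, (IsFrame.of_cross f.uu f.vv f.uv).ww, inv_one, one_smul]
      simp only [G, N, Ξ]
      simp only [cross_add_left, cross_add_right, cross_smul_left, cross_smul_right, cross_self]
      rw [cross_anticomm (partialD 0 y (Φ !₂[s, q₀ 1])) (partialD 1 y (Φ !₂[s, q₀ 1])), hx]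
      simp only [Matrix.cons_val_zero, hf.n0, hf.n1]
      have : (τ s 0 ^ 2 + τ s 1 ^ 2) • unitNormal y (Φ !₂[s, q₀ 1])
          = unitNormal y (Φ !₂[s, q₀ 1]) := by rw [hu, one_smul]
      conv_rhs => rw [← this]
      module
    · refine ((hder hyΦ s hs).sub ((hder hG s hs).const_smul (q₀ 1))).congr_deriv ?_
      rw [y0 _ (hI s hs), G0 _ (hI s hs)]
      simp only [Matrix.cons_val_one, Matrix.cons_val_fin_one, rulingSpeed]
      module
    · exact (hder hG s hs).congr_deriv (G0 _ (hI s hs))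
    · exact (hder hN s hs).congr_deriv (N0 _ (hI s hs))
    · exact (hder hΞ s hs).congr_deriv (Ξ0 _ (hI s hs))
  · intro q hq
    have e1 := eq_of_partialD_one_eq_zero (hG.differentiableOn (by simp)) G1 hq
    have e2 := eq_of_partialD_one_eq_zero (f := fun q => y (Φ q) - q 1 • G q)
      ((hyΦ.sub ((contDiff_coord 1).contDiffOn.smul hG)).differentiableOn (by simp))
      (fun p hp => by
        have dG := diffAt hG hB hp
        have d1 := differentiable_coord 1 p
        rw [partialD_sub (diffAt hyΦ hB hp) (d1.fun_smul dG), partialD_smul d1 dG, G1 p hp,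
          y1 p hp, partialD_coord]
        simp) hq
    simp only [Matrix.cons_val_one, Matrix.cons_val_fin_one] at e2
    simp only [ruled]
    rw [← e1, ← sub_eq_iff_eq_add, e2, ← e1]

end IsPlanarFrame

end LocalRuling

/-! ### Every point has a chart by a cylinder or a cone with κ'' = -μκ. -/

section RuledCharts

theorem isPlanarFrame_const {τ : E2} (hτ : ‖τ‖ = 1) :
    IsPlanarFrame 0 (fun _ => τ) (fun _ => !₂[-τ 1, τ 0]) where
  mu := by norm_num
  unit := fun _ => by
    rw [EuclideanSpace.norm_eq, Real.sqrt_eq_one, Fin.sum_univ_two] at hτ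
    simpa using hτ
  n0 := fun _ => by simp
  n1 := fun _ => by simp
  dτ := fun s => by simpa using hasDerivAt_const s τ
  dn := fun s => by simpa using hasDerivAt_const s (!₂[-τ 1, τ 0] : E2)
  sτ := contDiff_const
  sn := contDiff_const

theorem hasDerivAt_E2 {f g f' g' : ℝ → ℝ} {s : ℝ} (hf : HasDerivAt f (f' s) s)
    (hg : HasDerivAt g (g' s) s) :
    HasDerivAt (fun s => (!₂[f s, g s] : E2)) (!₂[f' s, g' s]) s := by
  have h : ∀ u v : ℝ → ℝ, (fun s => (!₂[u s, v s] : E2))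
      = fun s => u s • EuclideanSpace.single 0 1 + v s • EuclideanSpace.single 1 1 := by
    intro u v; ext s i; fin_cases i <;> simp
  rw [h, congrFun (h f' g') s]
  exact (hf.smul_const _).add (hg.smul_const _)

theorem isPlanarFrame_polar :
    IsPlanarFrame 1 (fun s => !₂[Real.cos s, Real.sin s]) (fun s => !₂[-Real.sin s, Real.cos s])
    where
  mu := by norm_num
  unit := fun s => by simp
  n0 := fun _ => by simp
  n1 := fun _ => by simp
  dτ := fun s => by
    refine (hasDerivAt_E2 (f' := fun s => -Real.sin s) (g' := Real.cos) (Real.hasDerivAt_cos s)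
      (Real.hasDerivAt_sin s)).congr_deriv ?_
    simp
  dn := fun s => by
    refine (hasDerivAt_E2 (f' := fun s => -Real.cos s) (g' := fun s => -Real.sin s)
      (Real.hasDerivAt_sin s).neg (Real.hasDerivAt_cos s)).congr_deriv ?_
    apply ext_E2 <;> simp
  sτ := by
    rw [contDiff_euclidean]; intro i; fin_cases i
    · exact Real.contDiff_cos
    · exact Real.contDiff_sin
  sn := by
    rw [contDiff_euclidean]; intro i; fin_cases i
    · exact Real.contDiff_sin.neg
    · exact Real.contDiff_cos

variable {M : Type*} [TopologicalSpace M] [ChartedSpace E2 M] [IsManifold (𝓡 2) ∞ M]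

/-- Around every point, a flat surface with harmonic mean curvature is a piece of a cylinder or of
a cone over a curve whose curvature `κ` satisfies `κ'' = -μ κ`. -/
theorem exists_ruled_chart {x : M → E3} (hx : IsSmoothImmersion x) (hflat : IsFlat x)
    (hharm : HasHarmonicMeanCurvature x) (m : M) :
    ∃ μ : ℝ, (μ = 0 ∨ μ = 1) ∧ ∃ e ∈ IsManifold.maximalAtlas (𝓡 2) ∞ M, m ∈ e.source ∧
      ∃ (q₀ : E2) (r : ℝ), 0 < r ∧ e.target = Metric.ball q₀ r ∧
      (∀ q ∈ e.target, 0 < rulingSpeed μ (q 1)) ∧ ∃ (κ : ℝ → ℝ) (a b T ν : ℝ → E3),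
        ContDiffOn ℝ ∞ κ (Ioo (q₀ 0 - r) (q₀ 0 + r)) ∧
        IsRuledFrame μ (Ioo (q₀ 0 - r) (q₀ 0 + r)) κ a b T ν ∧
        (∀ s ∈ Ioo (q₀ 0 - r) (q₀ 0 + r), deriv (deriv κ) s = -(μ * κ s)) ∧
        ∀ q ∈ e.target, x (e.symm q) = ruled a b q := by
  obtain ⟨e, he, hm, ⟨R, -, heR⟩, hg⟩ := exists_flat_chart hx hflat m
  have hy := contDiffOn_param hx he
  set y := x ∘ e.symm
  have hconv : Convex ℝ e.target := by rw [heR]; exact convex_ball _ _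
  have hp : ∃ μ : ℝ, (μ = 0 ∨ μ = 1) ∧ ∃ (τ n : ℝ → E2) (c q₀ : E2), IsPlanarFrame μ τ n ∧
      planarRuling μ c τ n q₀ = e m ∧ 0 < rulingSpeed μ (q₀ 1) ∧
      ∀ q, 0 < rulingSpeed μ (q 1) → planarRuling μ c τ n q ∈ e.target → ∀ i,
      secondForm y (planarRuling μ c τ n q) i 0 * τ (q 0) 0
        + secondForm y (planarRuling μ c τ n q) i 1 * τ (q 0) 1 = 0 := by
    -- A constant kernel direction gives Cartesian coordinates along it (μ = 0) centred at `e m`. A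
    -- fixed point z gives polar coordinates around z (μ = 1), where the witness for `q₀` is the
    -- argument and modulus of `e m - z`.
    rcases secondForm_kernel e.open_target hconv hy hg (hflat e he) (hharm e he) with
      ⟨τ, hτ, hk⟩ | ⟨z, hk⟩
    · exact ⟨0, Or.inl rfl, _, _, e m, 0, isPlanarFrame_const hτ, by simp [planarRuling],
        by simp [rulingSpeed], fun q _ hq i => hk _ hq i⟩
    · refine ⟨1, Or.inr rfl, _, _, z, !₂[Complex.arg (toC (e m - z)), ‖toC (e m - z)‖],
        isPlanarFrame_polar, ?_, ?_, ?_⟩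
      · apply ext_E2
        · simp [planarRuling, Complex.norm_mul_cos_arg, toC]
        · simp [planarRuling, Complex.norm_mul_sin_arg, toC]
      · have h1 : toC (e m - z) ≠ 0 := fun h => (hk _ (e.map_source hm)).1 (by
          have := congrArg fromC h
          rwa [fromC_toC, map_zero, sub_eq_zero] at this)
        simpa [rulingSpeed] using h1
      · intro q hq0 hq i
        have h1 := (hk _ hq).2 i
        have hq0' : q 1 ≠ 0 := by
          simp only [rulingSpeed, sub_self, one_mul, zero_add] at hq0
          exact hq0.ne'
        have e0 : ∀ k, planarRuling 1 z (fun s => !₂[Real.cos s, Real.sin s])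
            (fun s => !₂[-Real.sin s, Real.cos s]) q k - z k
            = q 1 * (!₂[Real.cos (q 0), Real.sin (q 0)] : E2) k := fun k => by
          simp [planarRuling]
        rw [e0, e0] at h1
        apply mul_left_cancel₀ hq0'
        linear_combination h1
  obtain ⟨μ, hμ, τ, n, c, q₀, hf, hq₀, hw₀, hk⟩ := hp
  have hV : IsOpen {q : E2 | 0 < rulingSpeed μ (q 1)} := by
    have : Continuous fun q : E2 => rulingSpeed μ (q 1) :=
      continuous_const.add (continuous_const.mul (contDiff_coord 1).continuous)
    exact isOpen_lt continuous_const this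
  obtain ⟨e', he', hm', -, hsub, r, hr, hball⟩ := exists_chart_backward he hm hV
    hf.contDiff_planarRuling.contDiffOn hw₀ hq₀ (hf.injective_fderiv hw₀.ne')
  have hsub' : ∀ q ∈ Metric.ball q₀ r, 0 < rulingSpeed μ (q 1) ∧
      planarRuling μ c τ n q ∈ e.target ∧ e'.symm q = e.symm (planarRuling μ c τ n q) := by
    rw [← hball]; exact hsub
  obtain ⟨κ, a, b, T, ν, hκ, hfr, hY⟩ := hf.exists_ruledFrame e.open_target hy hg
    (fun q hq => (hsub' q hq).2.1) (fun q hq => hk q (hsub' q hq).1 (hsub' q hq).2.1)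
  have hY' : ∀ q ∈ e'.target, x (e'.symm q) = ruled a b q := fun q hq => by
    rw [(hsub q hq).2.2]
    rw [hball] at hq
    exact hY q hq
  refine ⟨μ, hμ, e', he', hm', q₀, r, hr, hball, fun q hq => (hsub q hq).1, κ, a, b, T, ν, hκ, hfr,
    fun s hs => ?_, hY'⟩
  have hq : (!₂[s, q₀ 1] : E2) ∈ e'.target := by rw [hball]; exact horizontal_mem_ball.2 hs
  have h1 := hfr.laplace_eq isOpen_Ioo hκ e'.open_target (Y := x ∘ e'.symm)
    (fun q hq => ⟨coord_mem_of_mem_ball (by rwa [← hball]), (hsub q hq).1⟩) hY' hq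
  rw [hharm e' he' _ hq, eq_comm, div_eq_zero_iff] at h1
  have h2 := h1.resolve_right (mul_ne_zero two_ne_zero (pow_ne_zero 3 (hsub _ hq).1.ne'))
  simp only [Matrix.cons_val_zero] at h2
  have h3 : μ ^ 2 = μ := by rcases hμ with rfl | rfl <;> norm_num
  rw [h3] at h2
  linarith

end RuledCharts

/-! ### Global solutions of linear differential equations. -/

section LinearODE

variable {E : Type*} [NormedAddCommGroup E] [NormedSpace ℝ E] [CompleteSpace E]

/-- Global existence for linear differential equations with bounded coefficients. -/
theorem exists_hasDerivAt_linear {A : ℝ → E →L[ℝ] E} (hA : ContDiff ℝ 1 A) {C : ℝ}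
    (hC : ∀ s, ‖A s‖ ≤ C) (s₀ : ℝ) (x₀ : E) :
    ∃ f : ℝ → E, f s₀ = x₀ ∧ ∀ s, HasDerivAt f (A s (f s)) s := by
  have hC0 : 0 ≤ C := (norm_nonneg _).trans (hC 0)
  -- Time becomes an extra coordinate, so that solutions are integral curves of an autonomous vector
  -- field.
  set v : (p : E × ℝ) → TangentSpace 𝓘(ℝ, E × ℝ) p := fun p => ((A p.2 p.1, 1) : E × ℝ) with hv
  have hv1 : ContMDiff 𝓘(ℝ, E × ℝ) 𝓘(ℝ, E × ℝ).tangent 1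
      (fun p => (⟨p, v p⟩ : TangentBundle 𝓘(ℝ, E × ℝ) (E × ℝ))) := by
    rw [contMDiff_vectorSpace_iff_contDiff]
    exact ((hA.comp contDiff_snd).clm_apply contDiff_fst).prodMk contDiff_const
  -- A time of existence independent of the starting point: on the ball of radius ‖x₁‖ + 1 around x₁
  -- the field is at most C(2‖x₁‖ + 1), and this bound times ε stays below the radius. Local
  -- solutions of uniform length extend to a global one.
  set ε : ℝ := 1 / (2 * C + 2) with hε
  have hε0 : 0 < ε := by positivity
  have hloc : ∀ p : E × ℝ, ∃ γ : ℝ → E × ℝ, γ 0 = p ∧ IsMIntegralCurveOn γ v (Ioo (-ε) ε) := by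
    rintro ⟨x₁, s₁⟩
    have hPL : IsPicardLindelof (fun t x => A (s₁ + t) x) (tmin := -ε) (tmax := ε)
        ⟨0, by constructor <;> linarith⟩ x₁ ⟨‖x₁‖ + 1, by positivity⟩ 0
        ⟨C * (2 * ‖x₁‖ + 1), by positivity⟩ ⟨C, hC0⟩ := by
      refine ⟨fun t _ => ?_, fun x _ => ?_, fun t _ x hx => ?_, ?_⟩
      · exact ((A (s₁ + t)).lipschitz.weaken (by exact_mod_cast hC (s₁ + t))).lipschitzOnWith
      · exact ((hA.continuous.comp (continuous_const.add continuous_id)).clm_apply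
          continuous_const).continuousOn
      · refine ((A (s₁ + t)).le_opNorm x).trans ?_
        rw [mem_closedBall_iff_norm] at hx
        have h1 : ‖x‖ ≤ 2 * ‖x₁‖ + 1 := by
          have h2 := norm_le_norm_add_norm_sub' x x₁
          have h3 : ‖x - x₁‖ ≤ ‖x₁‖ + 1 := hx
          linarith
        exact mul_le_mul (hC _) h1 (norm_nonneg _) hC0
      · have h1 : C * (2 * ‖x₁‖ + 1) * ε ≤ ‖x₁‖ + 1 := by
          rw [hε, mul_one_div, div_le_iff₀ (by positivity)]
          nlinarith [norm_nonneg x₁, mul_nonneg hC0 (norm_nonneg x₁)]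
        refine (le_of_eq ?_).trans (h1.trans (le_of_eq ?_))
        · simp only [sub_neg_eq_add, zero_add, sub_zero, max_self]; rfl
        · simp only [NNReal.coe_zero, sub_zero]; rfl
    obtain ⟨f, hf0, hf⟩ := hPL.exists_eq_forall_mem_Icc_hasDerivWithinAt₀
    refine ⟨fun t => (f t, s₁ + t), by simp [hf0], fun t ht => ?_⟩
    have h1 : HasDerivAt f (A (s₁ + t) (f t)) t :=
      (hf t (Ioo_subset_Icc_self ht)).hasDerivAt (Icc_mem_nhds ht.1 ht.2)
    have h2 : HasDerivAt (fun t => s₁ + t) 1 t := (hasDerivAt_id t).const_add s₁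
    exact (h1.prodMk h2).hasFDerivAt.hasMFDerivAt.hasMFDerivWithinAt
  obtain ⟨γ, hγ0, hγ⟩ := exists_isMIntegralCurve_of_isMIntegralCurveOn hv1 hε0 hloc (x₀, s₀)
  have hγ' : ∀ t, HasDerivAt γ ((A (γ t).2 (γ t).1, 1) : E × ℝ) t := fun t => by
    have h1 : HasMFDerivAt 𝓘(ℝ, ℝ) 𝓘(ℝ, E × ℝ) γ t
        ((1 : ℝ →L[ℝ] ℝ).smulRight ((A (γ t).2 (γ t).1, 1) : E × ℝ)) := hγ t
    have h2 : HasFDerivAt γ ((1 : ℝ →L[ℝ] ℝ).smulRight ((A (γ t).2 (γ t).1, 1) : E × ℝ)) t :=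
      h1.hasFDerivAt
    refine h2.hasDerivAt.congr_deriv ?_
    rw [ContinuousLinearMap.smulRight_apply, one_apply_eq_self, one_smul]
  have hfst : ∀ t, HasDerivAt (fun t => (γ t).1) (A (γ t).2 (γ t).1) t := fun t =>
    (ContinuousLinearMap.fst ℝ E ℝ).hasFDerivAt.comp_hasDerivAt t (hγ' t)
  have hsnd : ∀ t, HasDerivAt (fun t => (γ t).2) 1 t := fun t =>
    (ContinuousLinearMap.snd ℝ E ℝ).hasFDerivAt.comp_hasDerivAt t (hγ' t)
  have h2 : ∀ t, (γ t).2 = s₀ + t := by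
    have hd : ∀ t, HasDerivAt (fun t => (γ t).2 - t) 0 t := fun t =>
      ((hsnd t).sub (hasDerivAt_id t)).congr_deriv (sub_self 1)
    intro t
    have := is_const_of_deriv_eq_zero (fun t => (hd t).differentiableAt) (fun t => (hd t).deriv) t 0
    simp only [hγ0] at this
    linarith
  refine ⟨fun s => (γ (s - s₀)).1, by simp [hγ0], fun s => ?_⟩
  have h3 := HasDerivAt.comp_sub_const s s₀ (hfst (s - s₀))
  rwa [h2, add_sub_cancel] at h3

end LinearODE

/-! ### Derivatives of components and of vector products along curves. -/

section Coordinates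

theorem hasDerivAt_ofLp {n : ℕ} {f : ℝ → EuclideanSpace ℝ (Fin n)} {f' : EuclideanSpace ℝ (Fin n)}
    {s : ℝ} (hf : HasDerivAt f f' s) (i : Fin n) : HasDerivAt (fun s => f s i) (f' i) s :=
  (EuclideanSpace.proj (𝕜 := ℝ) i).hasFDerivAt.comp_hasDerivAt s hf

theorem hasDerivAt_cross {u v : ℝ → E3} {u' v' : E3} {s : ℝ} (hu : HasDerivAt u u' s)
    (hv : HasDerivAt v v' s) :
    HasDerivAt (fun s => cross (u s) (v s)) (cross u' (v s) + cross (u s) v') s := by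
  have hu' := hasDerivAt_ofLp hu
  have hv' := hasDerivAt_ofLp hv
  rw [← hasDerivWithinAt_univ, hasDerivWithinAt_iff_hasFDerivWithinAt, hasFDerivWithinAt_euclidean]
  intro i
  rw [hasFDerivWithinAt_univ, hasFDerivAt_iff_hasDerivAt]
  fin_cases i
  · simp only [Fin.zero_eta, cross_zero]
    refine (((hu' 1).mul (hv' 2)).sub ((hu' 2).mul (hv' 1))).congr_deriv ?_
    simp [cross_zero]; ring
  · simp only [Fin.mk_one, cross_one]
    refine (((hu' 2).mul (hv' 0)).sub ((hu' 0).mul (hv' 2))).congr_deriv ?_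
    simp [cross_one]; ring
  · simp only [Fin.reduceFinMk, cross_two]
    refine (((hu' 0).mul (hv' 1)).sub ((hu' 1).mul (hv' 0))).congr_deriv ?_
    simp [cross_two]; ring

end Coordinates

/-! ### The solutions of κ'' = -μκ. -/

section ModelCurvature

/-- The curvature functions of the cylinders (`μ = 0`) and cones (`μ = 1`) with harmonic mean
curvature: the solutions of `κ'' = -μ κ`. -/
def IsModelCurvature (μ : ℝ) (κ : ℝ → ℝ) : Prop :=
  (μ = 0 ∧ ∃ c₁ c₂ : ℝ, ∀ s, κ s = c₁ * s + c₂) ∨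
    (μ = 1 ∧ ∃ c₁ c₂ : ℝ, ∀ s, κ s = c₁ * Real.cos s + c₂ * Real.sin s)

theorem eq_of_hasDerivAt_zero {F : Type*} [NormedAddCommGroup F] [NormedSpace ℝ F] {f : ℝ → F}
    {I : Set ℝ} (hI : IsOpen I) (hI' : IsPreconnected I) (hf : ∀ s ∈ I, HasDerivAt f 0 s)
    {s t : ℝ} (hs : s ∈ I) (ht : t ∈ I) : f s = f t :=
  hI.is_const_of_deriv_eq_zero hI' (fun s hs => (hf s hs).differentiableAt.differentiableWithinAt)
    (fun s hs => (hf s hs).deriv) hs ht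

variable {μ : ℝ} {κ : ℝ → ℝ}

/-- Analyticity lets the curvature of a complete model be recovered from an arbitrarily small piece.
-/
theorem IsModelCurvature.analyticOnNhd (h : IsModelCurvature μ κ) : AnalyticOnNhd ℝ κ univ := by
  rcases h with ⟨-, c₁, c₂, h⟩ | ⟨-, c₁, c₂, h⟩
  · obtain rfl : κ = fun s => c₁ * s + c₂ := funext h
    exact (analyticOnNhd_const.mul analyticOnNhd_id).add analyticOnNhd_const
  · obtain rfl : κ = fun s => c₁ * Real.cos s + c₂ * Real.sin s := funext h
    exact (analyticOnNhd_const.mul fun s _ => Real.analyticAt_cos).add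
      (analyticOnNhd_const.mul fun s _ => Real.analyticAt_sin)

theorem IsModelCurvature.contDiff (h : IsModelCurvature μ κ) : ContDiff ℝ ∞ κ :=
  h.analyticOnNhd.contDiff

theorem IsModelCurvature.eq (h : IsModelCurvature μ κ) {κ' : ℝ → ℝ} (h' : IsModelCurvature μ κ')
    {s : ℝ} (hs : ∀ᶠ t in 𝓝 s, κ t = κ' t) : κ = κ' :=
  h.analyticOnNhd.eq_of_eventuallyEq h'.analyticOnNhd hs

theorem IsModelCurvature.const_mul (h : IsModelCurvature μ κ) (c : ℝ) :
    IsModelCurvature μ (fun s => c * κ s) := by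
  rcases h with ⟨hμ, c₁, c₂, h⟩ | ⟨hμ, c₁, c₂, h⟩
  · exact Or.inl ⟨hμ, c * c₁, c * c₂, fun s => by simp only [h]; ring⟩
  · exact Or.inr ⟨hμ, c * c₁, c * c₂, fun s => by simp only [h]; ring⟩

/-- Isometric coordinate changes act on the curve parameter by s ↦ ±s + c, and the class of models
must be stable under them. -/
theorem IsModelCurvature.comp_isometry (h : IsModelCurvature μ κ) {ε : ℝ} (hε : ε = 1 ∨ ε = -1)
    (c : ℝ) : IsModelCurvature μ (fun s => κ (ε * s + c)) := by
  rcases h with ⟨hμ, c₁, c₂, h⟩ | ⟨hμ, c₁, c₂, h⟩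
  · exact Or.inl ⟨hμ, c₁ * ε, c₁ * c + c₂, fun s => by simp only [h]; ring⟩
  · refine Or.inr ⟨hμ, c₁ * Real.cos c + c₂ * Real.sin c,
      ε * (c₂ * Real.cos c - c₁ * Real.sin c), fun s => ?_⟩
    simp only [h, Real.cos_add, Real.sin_add]
    rcases hε with rfl | rfl
    · simp only [one_mul]; ring
    · simp only [neg_mul, one_mul, Real.cos_neg, Real.sin_neg]; ring

/-- The solutions of `κ'' = -μ κ` on an interval. -/
theorem exists_isModelCurvature (hμ : μ = 0 ∨ μ = 1) {I : Set ℝ} (hI : IsOpen I)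
    (hI' : IsPreconnected I) (hκ : ContDiffOn ℝ ∞ κ I)
    (h : ∀ s ∈ I, deriv (deriv κ) s = -(μ * κ s)) :
    ∃ κ' : ℝ → ℝ, IsModelCurvature μ κ' ∧ EqOn κ κ' I := by
  rcases I.eq_empty_or_nonempty with rfl | ⟨s₀, hs₀⟩
  · rcases hμ with rfl | rfl
    · exact ⟨fun _ => 0, Or.inl ⟨rfl, 0, 0, by simp⟩, fun _ h => h.elim⟩
    · exact ⟨fun _ => 0, Or.inr ⟨rfl, 0, 0, by simp⟩, fun _ h => h.elim⟩
  have d1 : ∀ s ∈ I, HasDerivAt κ (deriv κ s) s := fun s hs =>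
    ((hκ.contDiffAt (hI.mem_nhds hs)).differentiableAt (by simp)).hasDerivAt
  have d2 : ∀ s ∈ I, HasDerivAt (deriv κ) (-(μ * κ s)) s := fun s hs => by
    rw [← h s hs]
    exact (((hκ.deriv_of_isOpen (m := ∞) hI (by simp)).contDiffAt
      (hI.mem_nhds hs)).differentiableAt (by simp)).hasDerivAt
  rcases hμ with rfl | rfl
  · have e1 : ∀ s ∈ I, deriv κ s = deriv κ s₀ := fun s hs =>
      eq_of_hasDerivAt_zero hI hI' (fun t ht => (d2 t ht).congr_deriv (by simp)) hs hs₀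
    have e2 : ∀ s ∈ I, κ s - deriv κ s₀ * s = κ s₀ - deriv κ s₀ * s₀ := fun s hs => by
      refine eq_of_hasDerivAt_zero (f := fun s => κ s - deriv κ s₀ * s) hI hI' (fun t ht => ?_)
        hs hs₀
      refine ((d1 t ht).sub ((hasDerivAt_id t).const_mul _)).congr_deriv ?_
      rw [e1 t ht]; ring
    exact ⟨fun s => deriv κ s₀ * s + (κ s₀ - deriv κ s₀ * s₀), Or.inl ⟨rfl, _, _, fun s => rfl⟩,
      fun s hs => by linear_combination e2 s hs⟩
  -- The first integrals κ cos - κ' sin and κ sin + κ' cos are the coefficients c₁ and c₂.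
  · have e1 : ∀ s ∈ I, κ s * Real.cos s - deriv κ s * Real.sin s
        = κ s₀ * Real.cos s₀ - deriv κ s₀ * Real.sin s₀ := fun s hs => by
      refine eq_of_hasDerivAt_zero (f := fun s => κ s * Real.cos s - deriv κ s * Real.sin s)
        hI hI' (fun t ht => ?_) hs hs₀
      refine (((d1 t ht).mul (Real.hasDerivAt_cos t)).sub
        ((d2 t ht).mul (Real.hasDerivAt_sin t))).congr_deriv ?_
      ring
    have e2 : ∀ s ∈ I, κ s * Real.sin s + deriv κ s * Real.cos s
        = κ s₀ * Real.sin s₀ + deriv κ s₀ * Real.cos s₀ := fun s hs => by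
      refine eq_of_hasDerivAt_zero (f := fun s => κ s * Real.sin s + deriv κ s * Real.cos s)
        hI hI' (fun t ht => ?_) hs hs₀
      refine (((d1 t ht).mul (Real.hasDerivAt_sin t)).add
        ((d2 t ht).mul (Real.hasDerivAt_cos t))).congr_deriv ?_
      ring
    refine ⟨fun s => (κ s₀ * Real.cos s₀ - deriv κ s₀ * Real.sin s₀) * Real.cos s
      + (κ s₀ * Real.sin s₀ + deriv κ s₀ * Real.cos s₀) * Real.sin s,
      Or.inr ⟨rfl, _, _, fun s => rfl⟩, fun s hs => ?_⟩
    simp only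
    rw [← e1 s hs, ← e2 s hs]
    linear_combination -(κ s) * Real.sin_sq_add_cos_sq s

end ModelCurvature

/-! ### Existence and uniqueness of ruled frames. -/

section Frames

variable {μ : ℝ} {κ : ℝ → ℝ} {a b T ν : ℝ → E3}

theorem hasDerivAt_inner {u v : ℝ → E3} {u' v' : E3} {s : ℝ} (hu : HasDerivAt u u' s)
    (hv : HasDerivAt v v' s) :
    HasDerivAt (fun s => (inner ℝ (u s) (v s) : ℝ)) (inner ℝ (u s) v' + inner ℝ u' (v s)) s :=
  hu.inner ℝ hv

/-- The equations of Frenet preserve the orthonormality of the frame. -/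
theorem isRuledFrame_of_hasDerivAt (da : ∀ s, HasDerivAt a ((1 - μ) • T s) s)
    (db : ∀ s, HasDerivAt b (μ • T s) s) (dT : ∀ s, HasDerivAt T (κ s • ν s - μ • b s) s)
    (dν : ∀ s, HasDerivAt ν (-(κ s • T s)) s) {s₀ : ℝ} (hf : IsFrame (b s₀) (T s₀) (ν s₀))
    (hc : cross (b s₀) (T s₀) = ν s₀) : IsRuledFrame μ univ κ a b T ν := by
  -- The quantity is the squared Hilbert–Schmidt distance of the Gram matrix from the identity; the
  -- factors 2 count off-diagonal entries twice. The Frenet matrix is skew, so the difference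
  -- evolves by a commutator and its norm is constant.
  have hE : ∀ s, ((inner ℝ (b s) (b s) : ℝ) - 1) ^ 2 + (inner ℝ (T s) (T s) - 1) ^ 2
      + (inner ℝ (ν s) (ν s) - 1) ^ 2 + 2 * inner ℝ (b s) (T s) ^ 2 + 2 * inner ℝ (b s) (ν s) ^ 2
      + 2 * inner ℝ (T s) (ν s) ^ 2 = 0 := by
    intro s
    rw [eq_of_hasDerivAt_zero (f := fun s => ((inner ℝ (b s) (b s) : ℝ) - 1) ^ 2
      + (inner ℝ (T s) (T s) - 1) ^ 2 + (inner ℝ (ν s) (ν s) - 1) ^ 2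
      + 2 * inner ℝ (b s) (T s) ^ 2 + 2 * inner ℝ (b s) (ν s) ^ 2
      + 2 * inner ℝ (T s) (ν s) ^ 2) isOpen_univ isPreconnected_univ (fun t _ => ?_)
      (mem_univ s) (mem_univ s₀)]
    · simp [hf.uv, hf.uw, hf.vw, hf.uu, hf.vv, hf.ww]
    · refine ((((((((hasDerivAt_inner (db t) (db t)).sub_const 1).pow 2).add
        (((hasDerivAt_inner (dT t) (dT t)).sub_const 1).pow 2)).add
        (((hasDerivAt_inner (dν t) (dν t)).sub_const 1).pow 2)).add
        (((hasDerivAt_inner (db t) (dT t)).pow 2).const_mul 2)).add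
        (((hasDerivAt_inner (db t) (dν t)).pow 2).const_mul 2)).add
        (((hasDerivAt_inner (dT t) (dν t)).pow 2).const_mul 2)).congr_deriv ?_
      simp only [inner_smul_left, inner_smul_right, inner_sub_left, inner_sub_right,
        inner_neg_left, inner_neg_right, real_inner_comm (b t) (T t),
        real_inner_comm (T t) (ν t), RCLike.conj_to_real]
      ring
  have hone : ∀ {u : E3}, (inner ℝ u u : ℝ) - 1 = 0 → ‖u‖ = 1 := fun {u} h => by
    rw [real_inner_self_eq_norm_sq, sub_eq_zero] at h
    nlinarith [norm_nonneg u]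
  have hfr : ∀ s, ‖b s‖ = 1 ∧ ‖T s‖ = 1 ∧ ‖ν s‖ = 1 ∧ (inner ℝ (b s) (T s) : ℝ) = 0 := by
    intro s
    have h := hE s
    have p1 := sq_nonneg ((inner ℝ (b s) (b s) : ℝ) - 1)
    have p2 := sq_nonneg ((inner ℝ (T s) (T s) : ℝ) - 1)
    have p3 := sq_nonneg ((inner ℝ (ν s) (ν s) : ℝ) - 1)
    have p4 := sq_nonneg (inner ℝ (b s) (T s) : ℝ)
    have p5 := sq_nonneg (inner ℝ (b s) (ν s) : ℝ)
    have p6 := sq_nonneg (inner ℝ (T s) (ν s) : ℝ)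
    refine ⟨hone ?_, hone ?_, hone ?_, ?_⟩ <;> apply pow_eq_zero_iff two_ne_zero |>.1 <;> linarith
  -- The orientation is preserved too: the triple product keeps its initial value 1, and two unit
  -- vectors with inner product 1 coincide.
  have hdet : ∀ s, (inner ℝ (cross (b s) (T s)) (ν s) : ℝ) = 1 := by
    intro s
    rw [eq_of_hasDerivAt_zero (f := fun s => (inner ℝ (cross (b s) (T s)) (ν s) : ℝ))
      isOpen_univ isPreconnected_univ (fun t _ => ?_) (mem_univ s) (mem_univ s₀), hc, hf.ww']
    refine (hasDerivAt_inner (hasDerivAt_cross (db t) (dT t)) (dν t)).congr_deriv ?_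
    have e1 : cross (b t) (κ t • ν t - μ • b t) = κ t • cross (b t) (ν t) := by
      rw [sub_eq_add_neg, ← neg_smul, cross_add_right, cross_smul_right, cross_smul_right,
        cross_self, smul_zero, add_zero]
    have e2 : (inner ℝ (cross (b t) (ν t)) (ν t) : ℝ) = 0 := by
      rw [real_inner_comm]; exact inner_cross_right _ _
    have e3 : (inner ℝ (cross (b t) (T t)) (T t) : ℝ) = 0 := by
      rw [real_inner_comm]; exact inner_cross_right _ _
    rw [e1, cross_smul_left, cross_self, smul_zero, zero_add, inner_smul_left, e2, inner_neg_right,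
      inner_smul_right, e3]
    simp
  refine ⟨fun s _ => (hfr s).1, fun s _ => (hfr s).2.1, fun s _ => (hfr s).2.2.2, fun s _ => ?_,
    fun s _ => da s, fun s _ => db s, fun s _ => dT s, fun s _ => dν s⟩
  have h1 := IsFrame.of_cross (hfr s).1 (hfr s).2.1 (hfr s).2.2.2
  exact (inner_eq_one_iff_of_norm_eq_one h1.ww (hfr s).2.2.1).1 (hdet s)

/-- Ruled frames exist for all model curvatures and all initial values. -/
theorem IsModelCurvature.exists_isRuledFrame (h : IsModelCurvature μ κ) (s₀ : ℝ) (a₀ : E3)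
    {b₀ T₀ ν₀ : E3} (hf : IsFrame b₀ T₀ ν₀) (hc : cross b₀ T₀ = ν₀) :
    ∃ a b T ν : ℝ → E3, IsRuledFrame μ univ κ a b T ν ∧ a s₀ = a₀ ∧ b s₀ = b₀ ∧ T s₀ = T₀ ∧
      ν s₀ = ν₀ := by
  rcases h with ⟨rfl, c₁, c₂, h⟩ | ⟨rfl, c₁, c₂, h⟩
  -- For a cylinder the frame turns in a fixed plane through the angle θ, the integral of κ from s₀,
  -- so the solution is explicit. A bound on κ, which fails for affine functions, is not needed.
  · set θ : ℝ → ℝ := fun s => c₁ * (s ^ 2 - s₀ ^ 2) / 2 + c₂ * (s - s₀) with hθ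
    have hθ0 : θ s₀ = 0 := by simp [hθ]
    have dθ : ∀ s, HasDerivAt θ (κ s) s := fun s => by
      refine (((((hasDerivAt_id s).pow 2).sub_const (s₀ ^ 2)).const_mul c₁).div_const 2
        |>.add (((hasDerivAt_id s).sub_const s₀).const_mul c₂)).congr_deriv ?_
      rw [h]; simp; ring
    set T : ℝ → E3 := fun s => Real.cos (θ s) • T₀ + Real.sin (θ s) • ν₀ with hT
    set ν : ℝ → E3 := fun s => Real.cos (θ s) • ν₀ - Real.sin (θ s) • T₀ with hν
    have dT : ∀ s, HasDerivAt T (κ s • ν s) s := fun s => by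
      refine (((dθ s).cos.smul_const T₀).add ((dθ s).sin.smul_const ν₀)).congr_deriv ?_
      simp only [hν]; module
    have dν : ∀ s, HasDerivAt ν (-(κ s • T s)) s := fun s => by
      refine (((dθ s).cos.smul_const ν₀).sub ((dθ s).sin.smul_const T₀)).congr_deriv ?_
      simp only [hT]; module
    have hTc : Continuous T := continuous_iff_continuousAt.2 fun s => (dT s).continuousAt
    have T0 : T s₀ = T₀ := by simp [hT, hθ0]
    have ν0 : ν s₀ = ν₀ := by simp [hν, hθ0]
    refine ⟨fun s => a₀ + ∫ t in s₀..s, T t, fun _ => b₀, T, ν,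
      isRuledFrame_of_hasDerivAt (s₀ := s₀) (fun s => ?_) (fun s => ?_) (fun s => ?_) dν
        (by rw [T0, ν0]; exact hf) (by rw [T0, ν0]; exact hc), by simp, rfl, T0, ν0⟩
    · simpa using (intervalIntegral.integral_hasDerivAt_right (hTc.intervalIntegrable _ _)
        hTc.stronglyMeasurable.stronglyMeasurableAtFilter hTc.continuousAt).const_add a₀
    · simpa using hasDerivAt_const s b₀
    · simpa using dT s
  -- For a cone the system for (b, T, ν) has coefficients A₁ + κ(s)A₂, bounded because |κ| ≤ |c₁| +
  -- |c₂|; global existence for linear equations applies.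
  · set A₁ : (E3 × E3 × E3) →L[ℝ] (E3 × E3 × E3) :=
      ((ContinuousLinearMap.fst ℝ E3 E3).comp (ContinuousLinearMap.snd ℝ E3 (E3 × E3))).prod
        ((-ContinuousLinearMap.fst ℝ E3 (E3 × E3)).prod 0) with hA₁
    set A₂ : (E3 × E3 × E3) →L[ℝ] (E3 × E3 × E3) :=
      (0 : (E3 × E3 × E3) →L[ℝ] E3).prod
        (((ContinuousLinearMap.snd ℝ E3 E3).comp (ContinuousLinearMap.snd ℝ E3 (E3 × E3))).prod
          (-((ContinuousLinearMap.fst ℝ E3 E3).comp (ContinuousLinearMap.snd ℝ E3 (E3 × E3)))))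
      with hA₂
    have hκ : ContDiff ℝ 1 κ :=
      (IsModelCurvature.contDiff (Or.inr ⟨rfl, c₁, c₂, h⟩)).of_le (by exact_mod_cast le_top)
    have hbound : ∀ s, ‖A₁ + κ s • A₂‖ ≤ ‖A₁‖ + (|c₁| + |c₂|) * ‖A₂‖ := fun s => by
      refine (norm_add_le _ _).trans ?_
      rw [norm_smul]
      gcongr
      rw [h, Real.norm_eq_abs]
      refine (abs_add_le _ _).trans ?_
      rw [abs_mul, abs_mul]
      exact add_le_add (mul_le_of_le_one_right (abs_nonneg _) (Real.abs_cos_le_one s))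
        (mul_le_of_le_one_right (abs_nonneg _) (Real.abs_sin_le_one s))
    obtain ⟨f, hf0, hfd⟩ := exists_hasDerivAt_linear (contDiff_const.add (hκ.smul contDiff_const))
      hbound s₀ (b₀, T₀, ν₀)
    have d1 : ∀ s, HasDerivAt (fun s => (f s).1) (f s).2.1 s := fun s => by
      refine ((ContinuousLinearMap.fst ℝ E3 (E3 × E3)).hasFDerivAt.comp_hasDerivAt s
        (hfd s)).congr_deriv ?_
      simp [hA₁]
    have d2 : ∀ s, HasDerivAt (fun s => (f s).2.1) (κ s • (f s).2.2 - (f s).1) s := fun s => by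
      refine (((ContinuousLinearMap.fst ℝ E3 E3).comp
        (ContinuousLinearMap.snd ℝ E3 (E3 × E3))).hasFDerivAt.comp_hasDerivAt s
        (hfd s)).congr_deriv ?_
      simp [hA₁]
      abel
    have d3 : ∀ s, HasDerivAt (fun s => (f s).2.2) (-(κ s • (f s).2.1)) s := fun s => by
      refine (((ContinuousLinearMap.snd ℝ E3 E3).comp
        (ContinuousLinearMap.snd ℝ E3 (E3 × E3))).hasFDerivAt.comp_hasDerivAt s
        (hfd s)).congr_deriv ?_
      simp [hA₁]
    refine ⟨fun _ => a₀, fun s => (f s).1, fun s => (f s).2.1, fun s => (f s).2.2,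
      isRuledFrame_of_hasDerivAt (s₀ := s₀) (fun s => ?_) (fun s => ?_) (fun s => ?_) d3
        (by rw [hf0]; exact hf) (by rw [hf0]; exact hc), rfl, by simp [hf0], by simp [hf0],
        by simp [hf0]⟩
    · simpa using hasDerivAt_const s a₀
    · simpa using d1 s
    · simpa using d2 s

/-- A ruled frame is determined by its curvature and its initial values. -/
theorem IsRuledFrame.eqOn {I : Set ℝ} (hI : IsOpen I) (hI' : IsPreconnected I)
    (h : IsRuledFrame μ I κ a b T ν) {a' b' T' ν' : ℝ → E3} (h' : IsRuledFrame μ I κ a' b' T' ν')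
    {s₀ : ℝ} (hs₀ : s₀ ∈ I) (ha : a s₀ = a' s₀) (hb : b s₀ = b' s₀) (hT : T s₀ = T' s₀) :
    EqOn a a' I ∧ EqOn b b' I := by
  have hν : ν s₀ = ν' s₀ := by rw [← h.cross_eq _ hs₀, ← h'.cross_eq _ hs₀, hb, hT]
  -- The difference of the two frames solves the same skew system, so its squared length is constant
  -- and stays zero.
  have hE : ∀ s ∈ I, (inner ℝ (b s - b' s) (b s - b' s) : ℝ)
      + inner ℝ (T s - T' s) (T s - T' s) + inner ℝ (ν s - ν' s) (ν s - ν' s) = 0 := by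
    intro s hs
    rw [eq_of_hasDerivAt_zero (f := fun s => (inner ℝ (b s - b' s) (b s - b' s) : ℝ)
      + inner ℝ (T s - T' s) (T s - T' s) + inner ℝ (ν s - ν' s) (ν s - ν' s)) hI hI'
      (fun t ht => ?_) hs hs₀]
    · simp [hb, hT, hν]
    · have d1 := (h.db t ht).sub (h'.db t ht)
      have d2 := (h.dT t ht).sub (h'.dT t ht)
      have d3 := (h.dν t ht).sub (h'.dν t ht)
      refine (((hasDerivAt_inner d1 d1).add (hasDerivAt_inner d2 d2)).add
        (hasDerivAt_inner d3 d3)).congr_deriv ?_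
      have e1 : μ • T t - μ • T' t = μ • (T t - T' t) := (smul_sub _ _ _).symm
      have e2 : κ t • ν t - μ • b t - (κ t • ν' t - μ • b' t)
          = κ t • (ν t - ν' t) - μ • (b t - b' t) := by module
      have e3 : -(κ t • T t) - -(κ t • T' t) = -(κ t • (T t - T' t)) := by module
      simp only [Pi.sub_apply, e1, e2, e3]
      generalize b t - b' t = B
      generalize T t - T' t = C
      generalize ν t - ν' t = N
      simp only [inner_smul_left, inner_smul_right, inner_sub_left, inner_sub_right,
        inner_neg_left, inner_neg_right, real_inner_comm B C, real_inner_comm C N,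
        RCLike.conj_to_real]
      ring
  have hz : ∀ s ∈ I, b s = b' s ∧ T s = T' s := by
    intro s hs
    have h1 := hE s hs
    simp only [real_inner_self_eq_norm_sq] at h1
    have p1 := sq_nonneg ‖b s - b' s‖
    have p2 := sq_nonneg ‖T s - T' s‖
    have p3 := sq_nonneg ‖ν s - ν' s‖
    constructor
    · rw [← sub_eq_zero, ← norm_eq_zero, ← pow_eq_zero_iff two_ne_zero]; linarith
    · rw [← sub_eq_zero, ← norm_eq_zero, ← pow_eq_zero_iff two_ne_zero]; linarith
  refine ⟨fun s hs => ?_, fun s hs => (hz s hs).1⟩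
  have h1 := eq_of_hasDerivAt_zero (f := fun s => a s - a' s) hI hI' (fun t ht => ?_) hs hs₀
  · simp only [ha, sub_self] at h1
    exact sub_eq_zero.1 h1
  · refine ((h.da t ht).sub (h'.da t ht)).congr_deriv ?_
    rw [(hz t ht).2, sub_self]

theorem IsRuledFrame.congr_curvature {I : Set ℝ} (h : IsRuledFrame μ I κ a b T ν) {κ' : ℝ → ℝ}
    (hκ : EqOn κ κ' I) : IsRuledFrame μ I κ' a b T ν :=
  ⟨h.bb, h.TT, h.bT, h.cross_eq, h.da, h.db, fun s hs => by rw [← hκ hs]; exact h.dT s hs,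
    fun s hs => by rw [← hκ hs]; exact h.dν s hs⟩

end Frames

/-! ### Local pieces extend to complete models. -/

section Charts

variable {M : Type*} [TopologicalSpace M] [ChartedSpace E2 M]

/-- A cylinder (`μ = 0`) or cone (`μ = 1`) over a complete curve, with harmonic mean curvature. -/
structure IsModel (μ : ℝ) (κ : ℝ → ℝ) (a b T ν : ℝ → E3) : Prop where
  curvature : IsModelCurvature μ κ
  frame : IsRuledFrame μ univ κ a b T ν

/-- The domain of the parametrization of a model. -/
def modelDomain (μ : ℝ) : Set E2 := {q | 0 < rulingSpeed μ (q 1)}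

theorem isOpen_modelDomain (μ : ℝ) : IsOpen (modelDomain μ) := by
  have : Continuous fun q : E2 => rulingSpeed μ (q 1) :=
    continuous_const.add (continuous_const.mul (contDiff_coord 1).continuous)
  exact isOpen_lt continuous_const this

/-- Around every point, a flat surface with harmonic mean curvature is a piece of a model. -/
theorem exists_model_chart [IsManifold (𝓡 2) ∞ M] {x : M → E3} (hx : IsSmoothImmersion x)
    (hflat : IsFlat x) (hharm : HasHarmonicMeanCurvature x) (m : M) :
    ∃ (μ : ℝ) (κ : ℝ → ℝ) (a b T ν : ℝ → E3), IsModel μ κ a b T ν ∧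
      ∃ e ∈ IsManifold.maximalAtlas (𝓡 2) ∞ M, m ∈ e.source ∧ e.target ⊆ modelDomain μ ∧
        ∀ u ∈ e.source, x u = ruled a b (e u) := by
  obtain ⟨μ, hμ, e, he, hm, q₀, r, hr, hball, hpos, κ, a, b, T, ν, hκ, hfr, hode, hY⟩ :=
    exists_ruled_chart hx hflat hharm m
  obtain ⟨κ', hκ', heq⟩ := exists_isModelCurvature hμ isOpen_Ioo isPreconnected_Ioo hκ hode
  have hs₀ : q₀ 0 ∈ Ioo (q₀ 0 - r) (q₀ 0 + r) := ⟨by linarith, by linarith⟩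
  -- The global frame has the extended curvature and takes the values of the local frame at the
  -- abscissa of the centre; uniqueness makes the two agree on the interval of the chart.
  obtain ⟨a', b', T', ν', hfr', ha, hb, hT, -⟩ := hκ'.exists_isRuledFrame (q₀ 0) (a (q₀ 0))
    (hfr.frame hs₀) (hfr.cross_eq _ hs₀)
  obtain ⟨e1, e2⟩ := (hfr.congr_curvature heq).eqOn isOpen_Ioo isPreconnected_Ioo
    (hfr'.mono (subset_univ _)) hs₀ ha.symm hb.symm hT.symm
  refine ⟨μ, κ', a', b', T', ν', ⟨hκ', hfr'⟩, e, he, hm, hpos, fun u hu => ?_⟩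
  have h1 := hY _ (e.map_source hu)
  rw [e.left_inv hu] at h1
  have h2 := coord_mem_of_mem_ball (hball ▸ e.map_source hu)
  rw [h1, ruled, ruled, e1 h2, e2 h2]

end Charts

/-! ### Coordinate changes between overlapping models. -/

section Transition

variable {μ μ' : ℝ} {κ κ' : ℝ → ℝ} {a b T ν a' b' T' ν' : ℝ → E3} {U : Set E2} {φ : E2 → E2}

theorem eq_of_sq_eq_one {f : E2 → ℝ} (hU : IsOpen U) (hc : Convex ℝ U) (hf : ContDiffOn ℝ ∞ f U)
    (h : ∀ r ∈ U, f r ^ 2 = 1) {p q : E2} (hp : p ∈ U) (hq : q ∈ U) : f p = f q := by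
  refine eq_of_partialD_eq_zero hU hc (hf.differentiableOn (by simp)) (fun r hr i => ?_) hp hq
  have h1 := partialD_congr_on (f := fun r => f r * f r) (g := fun _ => 1) hU
    (fun r hr => by simp only [← sq, h r hr]) hr i
  rw [partialD_mul (diffAt hf hU hr) (diffAt hf hU hr), partialD_const] at h1
  have h2 : f r ≠ 0 := fun h0 => by simpa [h0] using h r hr
  have h3 : f r * partialD i f r = 0 := by linarith
  exact (mul_eq_zero.1 h3).resolve_left h2

theorem contDiffOn_apply_E2 (hφ : ContDiffOn ℝ ∞ φ U) (i : Fin 2) :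
    ContDiffOn ℝ ∞ (fun r => φ r i) U :=
  contDiffOn_euclidean.1 hφ i

theorem IsModel.mu (h : IsModel μ κ a b T ν) : μ = 0 ∨ μ = 1 :=
  h.curvature.imp And.left And.left

theorem IsRuledFrame.partialD_ruled_comp (h : IsRuledFrame μ univ κ a b T ν) {r : E2}
    (hφ : DifferentiableAt ℝ φ r) (i : Fin 2) : partialD i (fun r => ruled a b (φ r)) r
      = (partialD i (fun r => φ r 0) r * rulingSpeed μ (φ r 1)) • T (φ r 0)
        + partialD i (fun r => φ r 1) r • b (φ r 0) := by
  have hd : DifferentiableAt ℝ (ruled a b) (φ r) :=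
    (diffAt_comp_coord (h.da _ (mem_univ _))).add
      ((differentiable_coord 1 _).fun_smul (diffAt_comp_coord (h.db _ (mem_univ _))))
  rw [partialD_comp hd hφ, h.partialD_zero (mem_univ _), h.partialD_one (mem_univ _),
    ← partialD_apply hφ, ← partialD_apply hφ, smul_smul]

/-- Two models whose parametrizations differ by a local diffeomorphism differ by an isometry. -/
theorem IsModel.transition (h : IsModel μ κ a b T ν) (h' : IsModel μ' κ' a' b' T' ν')
    (hU : IsOpen U) (hc : Convex ℝ U) {q₀ : E2} (hq₀ : q₀ ∈ U) (hφ : ContDiffOn ℝ ∞ φ U)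
    (hm : ∀ q ∈ U, 0 < rulingSpeed μ (φ q 1)) (hm' : ∀ q ∈ U, 0 < rulingSpeed μ' (q 1))
    (hκ : ∀ q ∈ U, κ (φ q 0) ≠ 0) (hF : ∀ q ∈ U, ruled a' b' q = ruled a b (φ q)) :
    ∃ ε c δ d : ℝ, ε ^ 2 = 1 ∧ δ ^ 2 = 1 ∧ μ' = μ ∧ μ * δ = μ ∧ μ * d = 0 ∧
      ∀ q ∈ U, φ q 0 = ε * q 0 + c ∧ φ q 1 = δ * q 1 + d := by
  set σ : E2 → ℝ := fun r => φ r 0 with hσ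
  set τ : E2 → ℝ := fun r => φ r 1 with hτ
  have sσ : ContDiffOn ℝ ∞ σ U := contDiffOn_apply_E2 hφ 0
  have sτ : ContDiffOn ℝ ∞ τ U := contDiffOn_apply_E2 hφ 1
  have dcomp : ∀ {f : ℝ → E3} {f' : E3} {r : E2}, r ∈ U → HasDerivAt f f' (σ r) → ∀ i,
      partialD i (fun r => f (σ r)) r = partialD i σ r • f' := fun {f f' r} hr hf i => by
    rw [partialD_comp_real hf.differentiableAt (diffAt sσ hU hr), hf.deriv]
  have dcompd : ∀ {f : ℝ → E3} {f' : E3} {r : E2}, r ∈ U → HasDerivAt f f' (σ r) →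
      DifferentiableAt ℝ (fun r => f (σ r)) r := fun {f f' r} hr hf =>
    hf.differentiableAt.comp r (diffAt sσ hU hr)
  have hP : ∀ r ∈ U, ∀ i, partialD i (ruled a' b') r
      = (partialD i σ r * rulingSpeed μ (τ r)) • T (σ r) + partialD i τ r • b (σ r) := by
    intro r hr i
    rw [partialD_congr_on hU hF hr, h.frame.partialD_ruled_comp (diffAt hφ hU hr)]
  have E0 : ∀ r ∈ U, rulingSpeed μ' (r 1) • T' (r 0)
      = (partialD 0 σ r * rulingSpeed μ (τ r)) • T (σ r) + partialD 0 τ r • b (σ r) :=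
    fun r hr => by rw [← h'.frame.partialD_zero (mem_univ _), hP r hr]
  have E1 : ∀ r ∈ U, b' (r 0)
      = (partialD 1 σ r * rulingSpeed μ (τ r)) • T (σ r) + partialD 1 τ r • b (σ r) :=
    fun r hr => by rw [← h'.frame.partialD_one (mem_univ _), hP r hr]
  have fr := fun s => h.frame.frame (mem_univ s)
  have fr' := fun s => h'.frame.frame (mem_univ s)
  -- Differentiating ν ⟂ b' along the second ruling gives κ w (∂₁σ)² = 0. Thus κ ≠ 0 makes the
  -- asymptotic direction unique, and φ maps rulings to rulings.
  have hσ1 : ∀ r ∈ U, partialD 1 σ r = 0 := by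
    intro r hr
    have h1 : partialD 1 (fun r => (inner ℝ (ν (σ r)) (b' (r 0)) : ℝ)) r = 0 := by
      rw [partialD_congr_on (g := fun _ => 0) hU (fun r hr => ?_) hr, partialD_const]
      simp only
      rw [E1 r hr, inner_add_right, inner_smul_right, inner_smul_right, (fr _).wv, (fr _).wu]
      ring
    rw [partialD_inner (dcompd hr (h.frame.dν _ (mem_univ _)))
      (diffAt_comp_coord (h'.frame.db _ (mem_univ _))), dcomp hr (h.frame.dν _ (mem_univ _)),
      partialD_comp_coord_ne (h'.frame.db _ (mem_univ _)) zero_ne_one, E1 r hr] at h1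
    simp only [inner_smul_left, inner_neg_left, inner_add_right, inner_smul_right, (fr _).vv',
      (fr _).vu, inner_zero_right, RCLike.conj_to_real] at h1
    have h2 : κ (σ r) * rulingSpeed μ (τ r) * partialD 1 σ r ^ 2 = 0 := by linarith
    have h3 := (mul_eq_zero.1 h2).resolve_left (mul_ne_zero (hκ r hr) (hm r hr).ne')
    exact pow_eq_zero_iff two_ne_zero |>.1 h3
  have E1' : ∀ r ∈ U, b' (r 0) = partialD 1 τ r • b (σ r) := fun r hr => by
    rw [E1 r hr, hσ1 r hr, zero_mul, zero_smul, zero_add]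
  have hτ1 : ∀ r ∈ U, partialD 1 τ r ^ 2 = 1 := fun r hr => by
    have h1 := congrArg norm (E1' r hr)
    rw [norm_smul, (fr _).uu, (fr' _).uu, mul_one, Real.norm_eq_abs] at h1
    rw [← sq_abs, ← h1, one_pow]
  obtain ⟨δ, hδ⟩ : ∃ δ, partialD 1 τ q₀ = δ := ⟨_, rfl⟩
  have hδτ : ∀ r ∈ U, partialD 1 τ r = δ := fun r hr => by
    rw [← hδ]; exact eq_of_sq_eq_one hU hc (contDiffOn_partialD hU sτ 1) hτ1 hr hq₀
  have hδ2 : δ ^ 2 = 1 := by rw [← hδ]; exact hτ1 q₀ hq₀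
  have hδ0 : δ ≠ 0 := fun h0 => by simp [h0] at hδ2
  have E1'' : ∀ r ∈ U, b' (r 0) = δ • b (σ r) := fun r hr => by rw [E1' r hr, hδτ r hr]
  have hτ0 : ∀ r ∈ U, partialD 0 τ r = 0 := by
    intro r hr
    have h1 := congrArg (fun v => (inner ℝ v (b' (r 0)) : ℝ)) (E0 r hr)
    simp only [inner_smul_left, (fr' _).vu] at h1
    rw [E1'' r hr] at h1
    simp only [inner_add_left, inner_smul_left, inner_smul_right, (fr _).vu, (fr _).uu',
      RCLike.conj_to_real] at h1
    have h2 : δ * partialD 0 τ r = 0 := by linarith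
    exact (mul_eq_zero.1 h2).resolve_left hδ0
  have hτeq : ∀ r ∈ U, τ r = δ * r 1 + (τ q₀ - δ * q₀ 1) := by
    intro r hr
    have h1 := eq_of_partialD_eq_zero (f := fun r => τ r - δ * r 1) hU hc
      (fun r hr => ((diffAt sτ hU hr).sub
        ((differentiable_coord 1 r).const_mul δ)).differentiableWithinAt) (fun r hr i => ?_) hr hq₀
    · simp only at h1; linarith
    · rw [partialD_sub (diffAt sτ hU hr) ((differentiable_coord 1 r).const_mul δ),
        partialD_mul (differentiableAt_const _) (differentiable_coord 1 r), partialD_const,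
        partialD_coord]
      fin_cases i
      · simp [hτ0 r hr]
      · simp [hδτ r hr]
  have E0' : ∀ r ∈ U, rulingSpeed μ' (r 1) • T' (r 0)
      = (partialD 0 σ r * rulingSpeed μ (τ r)) • T (σ r) := fun r hr => by
    rw [E0 r hr, hτ0 r hr, zero_smul, add_zero]
  have hμT : ∀ r ∈ U, μ' • T' (r 0) = (δ * partialD 0 σ r * μ) • T (σ r) := fun r hr => by
    have h1 := partialD_congr_on hU E1'' hr 0
    rw [partialD_comp_coord_self (h'.frame.db _ (mem_univ _)),
      partialD_smul (differentiableAt_const _) (dcompd hr (h.frame.db _ (mem_univ _))),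
      dcomp hr (h.frame.db _ (mem_univ _)), partialD_const, zero_smul, add_zero, smul_smul,
      smul_smul] at h1
    exact h1
  have hN : ∀ r ∈ U, rulingSpeed μ' (r 1) ^ 2 = partialD 0 σ r ^ 2 * rulingSpeed μ (τ r) ^ 2 :=
    fun r hr => by
      have h1 := congrArg (fun v => ‖v‖ ^ 2) (E0' r hr)
      simp only [norm_smul, (fr _).vv, (fr' _).vv, mul_one, Real.norm_eq_abs, sq_abs] at h1
      rw [h1]; ring
  -- The vector T' is expressed through T twice: by the derivative of the surface across the
  -- rulings, and by the derivative of b' = δb. The quotient of the two relations involves only the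
  -- ruling speeds, and it separates cylinders from cones.
  have hrel : ∀ r ∈ U, μ' * rulingSpeed μ (τ r) = δ * μ * rulingSpeed μ' (r 1) := by
    intro r hr
    have h1 := congrArg (fun v => (inner ℝ v (T (σ r)) : ℝ)) (E0' r hr)
    have h2 := congrArg (fun v => (inner ℝ v (T (σ r)) : ℝ)) (hμT r hr)
    simp only [inner_smul_left, (fr _).vv', RCLike.conj_to_real] at h1 h2
    have hc0 : (inner ℝ (T' (r 0)) (T (σ r)) : ℝ) ≠ 0 := by
      intro h0
      rw [h0] at h1
      have h3 := hN r hr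
      have h4 : partialD 0 σ r * rulingSpeed μ (τ r) = 0 := by linarith
      have h5 : rulingSpeed μ' (r 1) ^ 2 = 0 := by rw [h3, ← mul_pow, h4]; norm_num
      exact (hm' r hr).ne' (pow_eq_zero_iff two_ne_zero |>.1 h5)
    apply mul_right_cancel₀ hc0
    linear_combination rulingSpeed μ (τ r) * h2 - δ * μ * h1
  have hfin : μ' = μ ∧ μ * δ = μ ∧ μ * (τ q₀ - δ * q₀ 1) = 0 := by
    have h1 := hrel q₀ hq₀
    have h2 := hm q₀ hq₀
    have h3 := hm' q₀ hq₀
    rcases h.mu with rfl | rfl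
    · have h4 : μ' * rulingSpeed 0 (τ q₀) = 0 := by rw [h1]; ring
      exact ⟨(mul_eq_zero.1 h4).resolve_right h2.ne', by ring, by ring⟩
    · rcases h'.mu with rfl | rfl
      · exfalso
        simp [rulingSpeed] at h1
        exact hδ0 h1.symm
      · simp only [rulingSpeed, sub_self, one_mul, zero_add, mul_one] at h1 h2 h3
        -- For cones both distances from the vertex are positive and satisfy τ = δt at the base
        -- point, so rulings cannot be reversed and no shift along them remains.
        have h4 : δ = 1 := by
          rcases mul_self_eq_one_iff.1 ((sq δ).symm.trans hδ2) with h | h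
          · exact h
          · exfalso
            rw [h] at h1
            have h2' : 0 < τ q₀ := h2
            linarith
        refine ⟨rfl, by rw [h4]; ring, ?_⟩
        rw [h1]; ring
  obtain ⟨rfl, hδμ, hdμ⟩ := hfin
  have hw : ∀ r ∈ U, rulingSpeed μ' (τ r) = rulingSpeed μ' (r 1) := fun r hr => by
    rw [hτeq r hr, rulingSpeed, rulingSpeed]
    linear_combination r 1 * hδμ + hdμ
  have hσ0 : ∀ r ∈ U, partialD 0 σ r ^ 2 = 1 := fun r hr => by
    have h1 := hN r hr
    rw [hw r hr] at h1
    have h2 := pow_ne_zero 2 (hm' r hr).ne'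
    apply mul_right_cancel₀ h2
    rw [← h1, one_mul]
  obtain ⟨ε, hε⟩ : ∃ ε, partialD 0 σ q₀ = ε := ⟨_, rfl⟩
  have hεσ : ∀ r ∈ U, partialD 0 σ r = ε := fun r hr => by
    rw [← hε]; exact eq_of_sq_eq_one hU hc (contDiffOn_partialD hU sσ 0) hσ0 hr hq₀
  refine ⟨ε, σ q₀ - ε * q₀ 0, δ, τ q₀ - δ * q₀ 1, by rw [← hε]; exact hσ0 q₀ hq₀, hδ2, rfl, hδμ,
    hdμ, fun r hr => ⟨?_, hτeq r hr⟩⟩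
  have h1 := eq_of_partialD_eq_zero (f := fun r => σ r - ε * r 0) hU hc
    (fun r hr => ((diffAt sσ hU hr).sub
      ((differentiable_coord 0 r).const_mul ε)).differentiableWithinAt) (fun r hr i => ?_) hr hq₀
  · simp only at h1; linarith
  · rw [partialD_sub (diffAt sσ hU hr) ((differentiable_coord 0 r).const_mul ε),
      partialD_mul (differentiableAt_const _) (differentiable_coord 0 r), partialD_const,
      partialD_coord]
    fin_cases i
    · simp [hεσ r hr]
    · simp [hσ1 r hr]

end Transition

/-! ### Isometries of the parameter plane acting on models. -/

section Isometries

variable {μ : ℝ} {κ κ' : ℝ → ℝ} {a b T ν a' b' T' ν' : ℝ → E3}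

/-- The affine maps of the coordinate plane which preserve the coordinate directions. -/
def coordChange (ε c δ d : ℝ) (q : E2) : E2 := !₂[ε * q 0 + c, δ * q 1 + d]

theorem contDiff_coordChange (ε c δ d : ℝ) : ContDiff ℝ ∞ (coordChange ε c δ d) := by
  rw [contDiff_euclidean]
  intro i
  fin_cases i
  · exact (contDiff_const.mul (contDiff_coord 0)).add contDiff_const
  · exact (contDiff_const.mul (contDiff_coord 1)).add contDiff_const

theorem injective_fderiv_coordChange {ε c δ d : ℝ} (hε : ε ≠ 0) (hδ : δ ≠ 0) (q : E2) :
    Function.Injective (fderiv ℝ (coordChange ε c δ d) q) := by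
  have hd := (contDiff_coordChange ε c δ d).differentiable (by simp) q
  have e0 : ∀ i, partialD i (coordChange ε c δ d) q 0 = ε * if (0 : Fin 2) = i then 1 else 0 := by
    intro i
    rw [← partialD_apply hd]
    change partialD i (fun r : E2 => ε * r 0 + c) q = _
    rw [partialD_add ((differentiable_coord 0 q).const_mul ε) (differentiableAt_const _),
      partialD_mul (differentiableAt_const _) (differentiable_coord 0 q), partialD_const,
      partialD_const, partialD_coord]
    ring
  have e1 : ∀ i, partialD i (coordChange ε c δ d) q 1 = δ * if (1 : Fin 2) = i then 1 else 0 := by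
    intro i
    rw [← partialD_apply hd]
    change partialD i (fun r : E2 => δ * r 1 + d) q = _
    rw [partialD_add ((differentiable_coord 1 q).const_mul δ) (differentiableAt_const _),
      partialD_mul (differentiableAt_const _) (differentiable_coord 1 q), partialD_const,
      partialD_const, partialD_coord]
    ring
  rw [injective_iff_map_eq_zero]
  intro v hv
  rw [fderiv_apply_eq] at hv
  have h0 := congrArg (fun u : E2 => u 0) hv
  have h1 := congrArg (fun u : E2 => u 1) hv
  simp [e0, e1, hε, hδ] at h0 h1
  exact ext_E2 h0 h1

/-- The image of a model under a coordinate change which is an isometry. -/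
theorem IsModel.isometry (h : IsModel μ κ a b T ν) {ε δ : ℝ} (c d : ℝ) (hε : ε ^ 2 = 1)
    (hδ : δ ^ 2 = 1) (hδμ : μ * δ = μ) (hdμ : μ * d = 0) :
    ∃ κ' a' b' T' ν', IsModel μ κ' a' b' T' ν' ∧ (∀ s, κ' s = ε * δ * κ (ε * s + c)) ∧
      ∀ q, ruled a' b' q = ruled a b (coordChange ε c δ d q) := by
  have hcomp : ∀ {f : ℝ → E3} {f' : E3} {s : ℝ}, HasDerivAt f f' (ε * s + c) →
      HasDerivAt (fun s => f (ε * s + c)) (ε • f') s := fun {f f' s} hf => by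
    have h1 : HasDerivAt (fun s => ε * s + c) ε s := by
      simpa using ((hasDerivAt_id s).const_mul ε).add_const c
    exact HasDerivAt.scomp s hf h1
  have hf := h.frame
  -- Reversing the curve changes T by ε and reversing the rulings changes b by δ. Since ν = b × T,
  -- both signs enter ν and κ.
  refine ⟨fun s => ε * δ * κ (ε * s + c), fun s => a (ε * s + c) + d • b (ε * s + c),
    fun s => δ • b (ε * s + c), fun s => ε • T (ε * s + c), fun s => (ε * δ) • ν (ε * s + c),
    ⟨(h.curvature.comp_isometry (mul_self_eq_one_iff.1 ((sq ε).symm.trans hε)) c).const_mul _, ?_⟩,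
    fun s => rfl, fun q => ?_⟩
  · have habs : ∀ {x : ℝ}, x ^ 2 = 1 → |x| = 1 := fun {x} hx => by
      rcases mul_self_eq_one_iff.1 ((sq x).symm.trans hx) with rfl | rfl <;> simp
    refine ⟨fun s _ => ?_, fun s _ => ?_, fun s _ => ?_, fun s _ => ?_, fun s _ => ?_,
      fun s _ => ?_, fun s _ => ?_, fun s _ => ?_⟩
    · rw [norm_smul, hf.bb _ (mem_univ _), Real.norm_eq_abs, habs hδ, one_mul]
    · rw [norm_smul, hf.TT _ (mem_univ _), Real.norm_eq_abs, habs hε, one_mul]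
    · rw [inner_smul_left, inner_smul_right, hf.bT _ (mem_univ _)]; simp
    · rw [cross_smul_left, cross_smul_right, hf.cross_eq _ (mem_univ _), smul_smul, mul_comm]
    · refine ((hcomp (hf.da _ (mem_univ _))).add
        ((hcomp (hf.db _ (mem_univ _))).const_smul d)).congr_deriv ?_
      simp only [smul_smul, ← add_smul]
      congr 1
      linear_combination ε * hdμ
    · refine ((hcomp (hf.db _ (mem_univ _))).const_smul δ).congr_deriv ?_
      simp only [smul_smul]
      congr 1
      linear_combination ε * hδμ
    · refine ((hcomp (hf.dT _ (mem_univ _))).const_smul ε).congr_deriv ?_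
      simp only [smul_smul, smul_sub]
      congr 2
      · linear_combination κ (ε * s + c) * ε ^ 2 * (-hδ)
      · linear_combination μ * hε - hδμ
    · refine ((hcomp (hf.dν _ (mem_univ _))).const_smul (ε * δ)).congr_deriv ?_
      simp only [smul_smul, smul_neg]
      congr 2
      ring
  · simp only [ruled, coordChange, Matrix.cons_val_zero, Matrix.cons_val_one]
    module

/-- Two models which agree on an open set are equal. -/
theorem IsModel.eq_of_eqOn (h : IsModel μ κ a b T ν) (h' : IsModel μ κ' a' b' T' ν')
    {q₀ : E2} {r : ℝ} (hr : 0 < r) (hm : ∀ q ∈ Metric.ball q₀ r, 0 < rulingSpeed μ (q 1))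
    (hF : EqOn (ruled a b) (ruled a' b') (Metric.ball q₀ r)) : ruled a b = ruled a' b' := by
  set I := Ioo (q₀ 0 - r) (q₀ 0 + r) with hI
  have hmem : ∀ s ∈ I, (!₂[s, q₀ 1] : E2) ∈ Metric.ball q₀ r := fun s hs =>
    horizontal_mem_ball.2 hs
  have hs₀ : q₀ 0 ∈ I := ⟨by linarith, by linarith⟩
  have hf := h.frame
  have hf' := h'.frame
  have eb : EqOn b b' I := fun s hs => by
    have h1 := partialD_congr_on Metric.isOpen_ball hF (hmem s hs) 1
    rw [hf.partialD_one (mem_univ _), hf'.partialD_one (mem_univ _)] at h1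
    simpa using h1
  have eT : EqOn T T' I := fun s hs => by
    have h1 := partialD_congr_on Metric.isOpen_ball hF (hmem s hs) 0
    rw [hf.partialD_zero (mem_univ _), hf'.partialD_zero (mem_univ _)] at h1
    have h2 := smul_right_injective E3 (hm _ (hmem s hs)).ne' h1
    simpa using h2
  have ea : EqOn a a' I := fun s hs => by
    have h1 := hF (hmem s hs)
    simp only [ruled, Matrix.cons_val_zero, Matrix.cons_val_one, eb hs] at h1
    exact add_right_cancel h1
  have eκ : EqOn κ κ' I := fun s hs => by
    have hν : ν s = ν' s := by
      rw [← hf.cross_eq s (mem_univ _), ← hf'.cross_eq s (mem_univ _), eb hs, eT hs]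
    have h1 : κ s • ν s - μ • b s = κ' s • ν' s - μ • b' s :=
      ((hf.dT s (mem_univ _)).congr_of_eventuallyEq
        ((eT.symm).eventuallyEq_of_mem (isOpen_Ioo.mem_nhds hs))).unique (hf'.dT s (mem_univ _))
    rw [hν, eb hs, sub_left_inj] at h1
    have h2 := congrArg (fun v => (inner ℝ v (ν' s) : ℝ)) h1
    simp only [inner_smul_left, (hf'.frame (mem_univ s)).ww', RCLike.conj_to_real, mul_one] at h2
    exact h2
  -- The curvatures agree on an interval, hence everywhere by analyticity; frames with the same
  -- curvature and initial values are then equal.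
  obtain rfl : κ = κ' := h.curvature.eq h'.curvature
    (eκ.eventuallyEq_of_mem (isOpen_Ioo.mem_nhds hs₀))
  obtain ⟨h1, h2⟩ := hf.eqOn isOpen_univ isPreconnected_univ hf' (mem_univ (q₀ 0)) (ea hs₀)
    (eb hs₀) (eT hs₀)
  ext1 q
  rw [ruled, ruled, h1 (mem_univ _), h2 (mem_univ _)]

end Isometries

/-! ### From local models to one model for the connected surface. -/

section Gluing

variable {μ μ' : ℝ} {κ κ' : ℝ → ℝ} {a b T ν a' b' T' ν' : ℝ → E3} {U : Set E2} {φ : E2 → E2}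

/-- Uniqueness for a second-order linear equation: a nontrivial κ has only simple zeros. -/
theorem IsModelCurvature.eq_zero_of_deriv (h : IsModelCurvature μ κ) {s : ℝ} (h0 : κ s = 0)
    (h1 : deriv κ s = 0) : ∀ t, κ t = 0 := by
  rcases h with ⟨-, c₁, c₂, h⟩ | ⟨-, c₁, c₂, h⟩
  · have hd : HasDerivAt κ c₁ s := by
      rw [show κ = fun s => c₁ * s + c₂ from funext h]
      simpa using ((hasDerivAt_id s).const_mul c₁).add_const c₂
    rw [hd.deriv] at h1
    rw [h, h1] at h0
    intro t
    rw [h, h1]; linarith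
  · have hd : HasDerivAt κ (c₁ * -Real.sin s + c₂ * Real.cos s) s := by
      rw [show κ = fun s => c₁ * Real.cos s + c₂ * Real.sin s from funext h]
      exact ((Real.hasDerivAt_cos s).const_mul c₁).add ((Real.hasDerivAt_sin s).const_mul c₂)
    rw [hd.deriv] at h1
    rw [h] at h0
    have e := Real.sin_sq_add_cos_sq s
    have e1 : c₁ = 0 := by linear_combination Real.cos s * h0 - Real.sin s * h1 - c₁ * e
    have e2 : c₂ = 0 := by linear_combination Real.sin s * h0 + Real.cos s * h1 - c₂ * e
    intro t
    rw [h, e1, e2]; ring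

/-- Two models which have an open piece in common differ by a coordinate change. -/
theorem IsModel.exists_coordChange (h : IsModel μ κ a b T ν) (hκ : ¬∀ s, κ s = 0)
    (h' : IsModel μ' κ' a' b' T' ν') (hU : IsOpen U) {q₀ : E2} (hq₀ : q₀ ∈ U)
    (hφ : ContDiffOn ℝ ∞ φ U) (hm : ∀ q ∈ U, 0 < rulingSpeed μ (φ q 1))
    (hm' : ∀ q ∈ U, 0 < rulingSpeed μ' (q 1)) (hF : ∀ q ∈ U, ruled a' b' q = ruled a b (φ q)) :
    ∃ ε c δ d : ℝ, ε ≠ 0 ∧ δ ≠ 0 ∧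
      (∀ q, rulingSpeed μ (coordChange ε c δ d q 1) = rulingSpeed μ' (q 1)) ∧
      ∀ q, ruled a' b' q = ruled a b (coordChange ε c δ d q) := by
  have hκd : Differentiable ℝ κ := h.curvature.contDiff.differentiable (by simp)
  have sσ : ContDiffOn ℝ ∞ (fun r => φ r 0) U := contDiffOn_apply_E2 hφ 0
  -- If κ vanished along the whole overlap, then, κ' being nonzero at zeros of κ, the first
  -- component of φ would have zero differential at q₀. Both partial derivatives of the second model
  -- would be parallel to b, but they are orthogonal and nonzero.
  obtain ⟨q₁, hq₁, hκ₁⟩ : ∃ q ∈ U, κ (φ q 0) ≠ 0 := by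
    by_contra! hcon
    have hσ : ∀ i, partialD i (fun r => φ r 0) q₀ = 0 := fun i => by
      have h1 := partialD_congr_on (f := fun r => κ (φ r 0)) (g := fun _ => 0) hU hcon hq₀ i
      rw [partialD_comp_real (φ := fun r => φ r 0) (hκd _) (diffAt sσ hU hq₀), partialD_const,
        smul_eq_mul] at h1
      exact (mul_eq_zero.1 h1).resolve_right
        fun h2 => hκ (h.curvature.eq_zero_of_deriv (hcon q₀ hq₀) h2)
    have hP := fun i => partialD_congr_on hU hF hq₀ i
    have e0 := hP 0
    have e1 := hP 1
    rw [h.frame.partialD_ruled_comp (diffAt hφ hU hq₀), hσ, zero_mul, zero_smul, zero_add] at e0 e1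
    rw [h'.frame.partialD_zero (mem_univ _)] at e0
    rw [h'.frame.partialD_one (mem_univ _)] at e1
    have f := h.frame.frame (mem_univ (φ q₀ 0))
    have f' := h'.frame.frame (mem_univ (q₀ 0))
    have h0 := (hm' q₀ hq₀).ne'
    have h1 : partialD 0 (fun r => φ r 1) q₀ ≠ 0 := fun h1 => by
      rw [h1, zero_smul, smul_eq_zero] at e0
      have := f'.vv
      rw [e0.resolve_left h0] at this
      simp at this
    have h2 : partialD 1 (fun r => φ r 1) q₀ ≠ 0 := fun h1 => by
      rw [h1, zero_smul] at e1
      have := f'.uu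
      rw [e1] at this
      simp at this
    have h3 := congrArg (fun v => (inner ℝ v (b' (q₀ 0)) : ℝ)) e0
    simp only [inner_smul_left, f'.vu] at h3
    rw [e1] at h3
    simp only [inner_smul_right, f.uu', mul_zero, mul_one] at h3
    exact mul_ne_zero h1 h2 h3.symm
  have hU₁ : IsOpen {q | q ∈ U ∧ κ (φ q 0) ≠ 0} :=
    (h.curvature.contDiff.continuous.comp_continuousOn sσ.continuousOn).isOpen_inter_preimage hU
      isOpen_ne
  obtain ⟨r, hr, hball⟩ := Metric.isOpen_iff.1 hU₁ q₁ ⟨hq₁, hκ₁⟩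
  obtain ⟨ε, c, δ, d, hε, hδ, rfl, hδμ, hdμ, heq⟩ := h.transition h' Metric.isOpen_ball
    (convex_ball q₁ r) (Metric.mem_ball_self hr) (hφ.mono fun q hq => (hball hq).1)
    (fun q hq => hm q (hball hq).1) (fun q hq => hm' q (hball hq).1) (fun q hq => (hball hq).2)
    (fun q hq => hF q (hball hq).1)
  obtain ⟨κ₂, a₂, b₂, T₂, ν₂, h₂, -, hG⟩ := h.isometry c d hε hδ hδμ hdμ
  have h3 := h'.eq_of_eqOn h₂ hr (fun q hq => hm' q (hball hq).1) (fun q hq => by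
    rw [hF q (hball hq).1, hG]
    congr 1
    exact ext_E2 (heq q hq).1 (heq q hq).2)
  refine ⟨ε, c, δ, d, fun h0 => by simp [h0] at hε, fun h0 => by simp [h0] at hδ, fun q => ?_,
    fun q => by rw [h3, hG]⟩
  simp only [rulingSpeed, coordChange, Matrix.cons_val_one, Matrix.cons_val_fin_one]
  linear_combination q 1 * hδμ + hdμ

variable {M : Type*} [TopologicalSpace M] [ChartedSpace E2 M] {x : M → E3}

theorem contDiffOn_transition {e e' : OpenPartialHomeomorph M E2}
    (he : e ∈ IsManifold.maximalAtlas (𝓡 2) ∞ M) (he' : e' ∈ IsManifold.maximalAtlas (𝓡 2) ∞ M) :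
    ContDiffOn ℝ ∞ (e' ∘ e.symm) (e.symm ≫ₕ e').source := by
  have hs : ∀ q ∈ (e.symm ≫ₕ e').source, q ∈ e.target ∧ e.symm q ∈ e'.source := fun q hq => by
    rwa [OpenPartialHomeomorph.trans_source] at hq
  exact ((contMDiffOn_of_mem_maximalAtlas he').comp
    ((contMDiffOn_symm_of_mem_maximalAtlas he).mono fun q hq => (hs q hq).1)
    fun q hq => (hs q hq).2).contDiffOn

theorem partialD_chart {e : OpenPartialHomeomorph M E2} {v p : E3}
    (hx : IsSmoothImmersion x) (he : e ∈ IsManifold.maximalAtlas (𝓡 2) ∞ M) {q : E2}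
    (hq : q ∈ e.target) (i : Fin 2) :
    partialD i (fun q => (inner ℝ (x (e.symm q) - p) v : ℝ)) q
      = inner ℝ (partialD i (x ∘ e.symm) q) v := by
  have hd : DifferentiableAt ℝ (fun q => x (e.symm q)) q :=
    diffAt (contDiffOn_param hx he) e.open_target hq
  rw [partialD_inner (hd.sub_const p) (differentiableAt_const v), partialD_const, inner_zero_right,
    add_zero]
  rw [partialD_sub hd (differentiableAt_const p), partialD_const, sub_zero]
  rfl

variable [IsManifold (𝓡 2) ∞ M]

/-- A surface with model charts around each point, one of which is not totally geodesic, is an open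
part of a single model. -/
theorem IsModel.isOpenPartOf [PreconnectedSpace M]
    (hx : ∀ m : M, ∃ (μ : ℝ) (κ : ℝ → ℝ) (a b T ν : ℝ → E3), IsModel μ κ a b T ν ∧
      ∃ e ∈ IsManifold.maximalAtlas (𝓡 2) ∞ M, m ∈ e.source ∧ e.target ⊆ modelDomain μ ∧
        ∀ u ∈ e.source, x u = ruled a b (e u))
    (h : IsModel μ κ a b T ν) (hκ : ¬∀ s, κ s = 0) {m₀ : M}
    (hm₀ : ∃ e ∈ IsManifold.maximalAtlas (𝓡 2) ∞ M, m₀ ∈ e.source ∧ e.target ⊆ modelDomain μ ∧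
      ∀ u ∈ e.source, x u = ruled a b (e u)) : IsOpenPartOf x (ruled a b) (modelDomain μ) := by
  set S : Set M := {m | ∃ e ∈ IsManifold.maximalAtlas (𝓡 2) ∞ M, m ∈ e.source ∧
    e.target ⊆ modelDomain μ ∧ ∀ u ∈ e.source, x u = ruled a b (e u)} with hS
  have hopen : IsOpen S := by
    rw [isOpen_iff_mem_nhds]
    rintro m ⟨e, he, hm, h1, h2⟩
    exact mem_of_superset (e.open_source.mem_nhds hm) fun u hu => ⟨e, he, hu, h1, h2⟩
  have hclosed : IsClosed S := by
    rw [← closure_subset_iff_isClosed]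
    intro m hm
    obtain ⟨μ', κ', a', b', T', ν', h', e', he', hm', hD', hx'⟩ := hx m
    obtain ⟨m₁, hm₁, e, he, hm₁e, hD, hxe⟩ :=
      mem_closure_iff_nhds.1 hm _ (e'.open_source.mem_nhds hm')
    -- The model around a limit point m overlaps the given one near m₁, hence is a reparametrization
    -- of it. Composing its chart with the coordinate change puts m in S.
    obtain ⟨ε, c, δ, d, hε, hδ, hw, hG⟩ := h.exists_coordChange hκ h'
      (U := (e'.symm ≫ₕ e).source) (φ := e ∘ e'.symm) (e'.symm ≫ₕ e).open_source (q₀ := e' m₁)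
      (by simp [hm₁, hm₁e]) (contDiffOn_transition he' he)
      (fun q hq => by
        simp at hq
        exact hD (e.map_source hq.2))
      (fun q hq => by
        simp at hq
        exact hD' hq.1)
      (fun q hq => by
        simp at hq
        rw [Function.comp_apply, ← hxe _ hq.2, hx' _ (e'.map_target hq.1), e'.right_inv hq.1])
    obtain ⟨e₂, he₂, hm₂, h3, h4, -⟩ := exists_chart_forward he' hm' isOpen_univ
      (contDiff_coordChange ε c δ d).contDiffOn (mem_univ _)
      (injective_fderiv_coordChange hε hδ _) (W := modelDomain μ)
      ((isOpen_modelDomain μ).mem_nhds (by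
        change 0 < rulingSpeed μ _
        rw [hw]
        exact hD' (e'.map_source hm')))
    exact ⟨e₂, he₂, hm₂, h4, fun u hu => by rw [(h3 u hu).2.2, hx' u (h3 u hu).1, hG]⟩
  have huniv : S = univ := IsClopen.eq_univ ⟨hclosed, hopen⟩ ⟨m₀, hm₀⟩
  intro m
  have hm : m ∈ S := huniv ▸ mem_univ m
  exact hm

/-- An immersed surface whose points lie in a plane is an open part of this plane. -/
theorem isOpenPartOfPlane_of_inner (hx : IsSmoothImmersion x) {p v w n : E3} (hf : IsFrame v w n)
    (h : ∀ m, (inner ℝ (x m - p) n : ℝ) = 0) : IsOpenPartOfPlane x := by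
  refine ⟨p, v, w, ?_, fun m => ?_⟩
  · refine ⟨fun i => ?_, fun i j hij => ?_⟩
    · fin_cases i
      · exact hf.uu
      · exact hf.vv
    · fin_cases i <;> fin_cases j
      · exact (hij rfl).elim
      · exact hf.uv
      · exact hf.vu
      · exact (hij rfl).elim
  set e := chartAt E2 m with he_def
  have he : e ∈ IsManifold.maximalAtlas (𝓡 2) ∞ M := IsManifold.chart_mem_maximalAtlas m
  have hm : m ∈ e.source := mem_chart_source E2 m
  -- Cartesian coordinates in the plane serve as the chart: dx has no component along n, so these
  -- two components determine it.
  set φ : E2 → E2 := fun q => !₂[inner ℝ (x (e.symm q) - p) v, inner ℝ (x (e.symm q) - p) w]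
    with hφ_def
  have hy := contDiffOn_param hx he
  have hφ : ContDiffOn ℝ ∞ φ e.target := by
    rw [contDiffOn_euclidean]
    intro i
    fin_cases i
    · exact (hy.sub contDiffOn_const).inner ℝ contDiffOn_const
    · exact (hy.sub contDiffOn_const).inner ℝ contDiffOn_const
  have hinj : Function.Injective (fderiv ℝ φ (e m)) := by
    rw [injective_iff_map_eq_zero]
    intro ξ hξ
    have hq := e.map_source hm
    have hd := diffAt hφ e.open_target hq
    rw [fderiv_apply_eq] at hξ
    have h0 := congrArg (fun u : E2 => u 0) hξ
    have h1 := congrArg (fun u : E2 => u 1) hξ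
    simp only [PiLp.add_apply, PiLp.smul_apply, ← partialD_apply hd, smul_eq_mul,
      PiLp.zero_apply] at h0 h1
    simp only [hφ_def, Matrix.cons_val_zero, Matrix.cons_val_one, Matrix.cons_val_fin_one,
      partialD_chart hx he hq] at h0 h1
    have h2 : ∀ i, (inner ℝ (partialD i (x ∘ e.symm) (e m)) n : ℝ) = 0 := fun i => by
      rw [← partialD_chart (p := p) hx he hq]
      simp only [h, partialD_const]
    apply (injective_iff_map_eq_zero _).1 (injective_fderiv_param hx he hq)
    rw [fderiv_apply_eq]
    set A := partialD 0 (x ∘ e.symm) (e m)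
    set B := partialD 1 (x ∘ e.symm) (e m)
    rw [hf.expand (ξ 0 • A + ξ 1 • B)]
    simp only [inner_add_left, inner_smul_left, RCLike.conj_to_real]
    rw [h0, h1, h2, h2]
    simp
  obtain ⟨e', he', hm', h1, -, -⟩ := exists_chart_forward he hm e.open_target hφ (e.map_source hm)
    hinj univ_mem
  refine ⟨e', he', hm', subset_univ _, fun u hu => ?_⟩
  rw [(h1 u hu).2.2]
  have h2 := hf.expand (x u - p)
  rw [h, zero_smul, add_zero] at h2
  simp only [hφ_def, Matrix.cons_val_zero, Matrix.cons_val_one, Matrix.cons_val_fin_one,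
    e.left_inv (h1 u hu).1]
  rw [add_assoc, ← h2, add_sub_cancel]

/-- A model with vanishing curvature lies in a plane. -/
theorem IsModel.inner_eq (h : IsModel μ κ a b T ν) (hκ : ∀ s, κ s = 0) (p q : E2) (s : ℝ) :
    (inner ℝ (ruled a b p) (ν s) : ℝ) = inner ℝ (ruled a b q) (ν s) := by
  have hν : ∀ t, ν t = ν s := fun t =>
    eq_of_hasDerivAt_zero isOpen_univ isPreconnected_univ
      (fun r _ => (h.frame.dν r (mem_univ r)).congr_deriv (by simp [hκ])) (mem_univ t) (mem_univ s)
  have hb : ∀ t, (inner ℝ (b t) (ν s) : ℝ) = 0 := fun t => by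
    rw [← hν t]; exact (h.frame.frame (mem_univ t)).uw
  have hT : ∀ t, (inner ℝ (T t) (ν s) : ℝ) = 0 := fun t => by
    rw [← hν t]; exact (h.frame.frame (mem_univ t)).vw
  have ha : ∀ t, (inner ℝ (a t) (ν s) : ℝ) = inner ℝ (a 0) (ν s) := fun t =>
    eq_of_hasDerivAt_zero (f := fun t => (inner ℝ (a t) (ν s) : ℝ)) isOpen_univ
      isPreconnected_univ (fun r _ => (hasDerivAt_inner (h.frame.da r (mem_univ r))
        (hasDerivAt_const r (ν s))).congr_deriv (by simp [inner_smul_left, hT]))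
      (mem_univ t) (mem_univ 0)
  simp only [ruled, inner_add_left, inner_smul_left, hb, ha (p 0), ha (q 0), mul_zero]

/-- A surface with model charts of vanishing curvature is an open part of a plane. -/
theorem isOpenPartOfPlane_of_models [ConnectedSpace M] (himm : IsSmoothImmersion x)
    (hx : ∀ m : M, ∃ (μ : ℝ) (κ : ℝ → ℝ) (a b T ν : ℝ → E3), (IsModel μ κ a b T ν ∧ ∀ s, κ s = 0) ∧
      ∃ e ∈ IsManifold.maximalAtlas (𝓡 2) ∞ M, m ∈ e.source ∧ e.target ⊆ modelDomain μ ∧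
        ∀ u ∈ e.source, x u = ruled a b (e u)) : IsOpenPartOfPlane x := by
  obtain ⟨m₀⟩ := (inferInstance : Nonempty M)
  obtain ⟨μ₀, κ₀, a₀, b₀, T₀, ν₀, ⟨h₀, hκ₀⟩, e₀, he₀, hm₀, -, hx₀⟩ := hx m₀
  set n := ν₀ 0 with hn
  have hf := h₀.frame.frame (mem_univ 0)
  -- Requiring the equation on a neighbourhood makes S open and allows differentiation at its
  -- points. Then n is normal to any model piece meeting S, and by constancy of that model's normal
  -- the equation holds on the whole piece.
  set S : Set M := {m | ∀ᶠ u in 𝓝 m, (inner ℝ (x u - x m₀) n : ℝ) = 0} with hS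
  have hopen : IsOpen S := isOpen_iff_mem_nhds.2 fun m hm => hm.eventually_nhds
  have hclosed : IsClosed S := by
    rw [← closure_subset_iff_isClosed]
    intro m hm
    obtain ⟨μ', κ', a', b', T', ν', ⟨h', hκ'⟩, e, he, hme, hD, hxe⟩ := hx m
    obtain ⟨m₁, hm₁, hm₁S⟩ := mem_closure_iff_nhds.1 hm _ (e.open_source.mem_nhds hme)
    have hq := e.map_source hm₁
    have hev : (fun q => (inner ℝ (x (e.symm q) - x m₀) n : ℝ)) =ᶠ[𝓝 (e m₁)] fun _ => 0 :=
      (e.continuousAt_symm hq).tendsto.eventually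
        (p := fun u => (inner ℝ (x u - x m₀) n : ℝ) = 0) (by rw [e.left_inv hm₁]; exact hm₁S)
    have hY : ∀ q ∈ e.target, (x ∘ e.symm) q = ruled a' b' q := fun q hq => by
      rw [Function.comp_apply, hxe _ (e.map_target hq), e.right_inv hq]
    have hperp : ∀ i, (inner ℝ (partialD i (ruled a' b') (e m₁)) n : ℝ) = 0 := fun i => by
      rw [← partialD_congr_on e.open_target hY hq, ← partialD_chart (p := x m₀) himm he hq,
        partialD_congr hev, partialD_const]
    have f' := h'.frame.frame (mem_univ (e m₁ 0))
    have p0 := hperp 0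
    have p1 := hperp 1
    rw [h'.frame.partialD_zero (mem_univ _), inner_smul_left] at p0
    rw [h'.frame.partialD_one (mem_univ _)] at p1
    have p0' := (mul_eq_zero.1 p0).resolve_left (hD hq : 0 < rulingSpeed μ' (e m₁ 1)).ne'
    have hn' := f'.expand n
    rw [real_inner_comm, p1, real_inner_comm, p0', zero_smul, zero_smul, zero_add, zero_add] at hn'
    have hz : ∀ u ∈ e.source, (inner ℝ (x u - x m₀) n : ℝ) = 0 := fun u hu => by
      have h1 : (inner ℝ (x m₁ - x m₀) n : ℝ) = 0 := hm₁S.self_of_nhds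
      have h2 : (inner ℝ (x u) n : ℝ) = inner ℝ (x m₁) n := by
        rw [hn', inner_smul_right, inner_smul_right, hxe u hu, hxe m₁ hm₁,
          h'.inner_eq hκ' (e u) (e m₁)]
      rw [inner_sub_left] at h1 ⊢
      rw [h2, h1]
    exact mem_of_superset (e.open_source.mem_nhds hme) hz
  have hm₀S : m₀ ∈ S := mem_of_superset (e₀.open_source.mem_nhds hm₀) fun u hu => by
    change (inner ℝ (x u - x m₀) n : ℝ) = 0
    rw [inner_sub_left, hx₀ u hu, hx₀ m₀ hm₀, h₀.inner_eq hκ₀ (e₀ u) (e₀ m₀), sub_self]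
  have huniv : S = univ := IsClopen.eq_univ ⟨hclosed, hopen⟩ ⟨m₀, hm₀S⟩
  refine isOpenPartOfPlane_of_inner himm (p := x m₀) hf fun m => ?_
  have : m ∈ S := huniv ▸ mem_univ m
  exact Eventually.self_of_nhds (p := fun u => (inner ℝ (x u - x m₀) n : ℝ) = 0) this

/-- The flat surfaces with harmonic mean curvature are open parts of planes or of models. -/
theorem isOpenPartOf_of_harmonic [ConnectedSpace M] (hx : IsSmoothImmersion x) (hflat : IsFlat x)
    (hharm : HasHarmonicMeanCurvature x) : IsOpenPartOfPlane x ∨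
      ∃ (μ : ℝ) (κ : ℝ → ℝ) (a b T ν : ℝ → E3), IsModel μ κ a b T ν ∧ (¬∀ s, κ s = 0) ∧
        IsOpenPartOf x (ruled a b) (modelDomain μ) := by
  have hloc := exists_model_chart hx hflat hharm
  by_cases hex : ∃ m : M, ∃ (μ : ℝ) (κ : ℝ → ℝ) (a b T ν : ℝ → E3), (IsModel μ κ a b T ν ∧
      ¬∀ s, κ s = 0) ∧ ∃ e ∈ IsManifold.maximalAtlas (𝓡 2) ∞ M, m ∈ e.source ∧
        e.target ⊆ modelDomain μ ∧ ∀ u ∈ e.source, x u = ruled a b (e u)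
  · obtain ⟨m, μ, κ, a, b, T, ν, ⟨h, hκ⟩, he⟩ := hex
    exact Or.inr ⟨μ, κ, a, b, T, ν, h, hκ, h.isOpenPartOf hloc hκ he⟩
  · refine Or.inl (isOpenPartOfPlane_of_models hx fun m => ?_)
    obtain ⟨μ, κ, a, b, T, ν, h, he⟩ := hloc m
    refine ⟨μ, κ, a, b, T, ν, ⟨h, ?_⟩, he⟩
    by_contra hκ
    exact hex ⟨m, μ, κ, a, b, T, ν, ⟨h, hκ⟩, he⟩

end Gluing

/-! ### Identification of models with the surfaces of the list. -/

section Classification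

variable {M : Type*} [TopologicalSpace M] [ChartedSpace E2 M] {x : M → E3}
variable {μ : ℝ} {κ : ℝ → ℝ} {a b T ν : ℝ → E3}

/-- Open parts of a parametrized surface are open parts of the reparametrized surface. -/
theorem IsOpenPartOf.of_comp [IsManifold (𝓡 2) ∞ M] {F F' : E2 → E3} {D D' : Set E2}
    (h : IsOpenPartOf x F D) {G : E2 → E2} (hG : ContDiff ℝ ∞ G)
    (hG' : ∀ q, Function.Injective (fderiv ℝ G q)) (hD' : IsOpen D') (hm : MapsTo G D D') (hF : EqOn F (F' ∘ G) D) : IsOpenPartOf x F' D' := by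
  intro m
  obtain ⟨e, he, hme, hD, hx⟩ := h m
  have hq := hD (e.map_source hme)
  obtain ⟨e', he', hm', h1, h2, -⟩ := exists_chart_forward he hme isOpen_univ hG.contDiffOn
    (mem_univ _) (hG' _) (hD'.mem_nhds (hm hq))
  exact ⟨e', he', hm', h2, fun u hu => by
    rw [(h1 u hu).2.2, hx u (h1 u hu).1, hF (hD (e.map_source (h1 u hu).1))]; rfl⟩

theorem modelDomain_zero : modelDomain 0 = univ := by
  ext q; simp [modelDomain, rulingSpeed]

theorem modelDomain_one : modelDomain 1 = {q | 0 < q 1} := by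
  ext q; simp [modelDomain, rulingSpeed]

theorem IsModel.directrix_eq (h : IsModel 1 κ a b T ν) (s : ℝ) : a s = a 0 :=
  eq_of_hasDerivAt_zero isOpen_univ isPreconnected_univ
    (fun t _ => (h.frame.da t (mem_univ t)).congr_deriv (by simp)) (mem_univ s) (mem_univ 0)

theorem IsModel.ruling_eq (h : IsModel 0 κ a b T ν) (s : ℝ) : b s = b 0 :=
  eq_of_hasDerivAt_zero isOpen_univ isPreconnected_univ
    (fun t _ => (h.frame.db t (mem_univ t)).congr_deriv (by simp)) (mem_univ s) (mem_univ 0)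

/-- These are the coefficients of c₁ cos + c₂ sin after shifting the parameter by θ. Hence every
nontrivial solution can be written with two nonzero constants: π/4 serves when one of them vanishes,
and 0 otherwise. -/
theorem exists_cos_add_sin_ne_zero {c₁ c₂ : ℝ} (h : c₁ ≠ 0 ∨ c₂ ≠ 0) :
    ∃ θ, c₁ * Real.cos θ + c₂ * Real.sin θ ≠ 0 ∧ c₂ * Real.cos θ - c₁ * Real.sin θ ≠ 0 := by
  by_cases h1 : c₁ = 0
  · have h2 := h.resolve_left (not_not.2 h1)
    exact ⟨Real.pi / 4, by simp [h1, h2], by simp [h1, h2]⟩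
  by_cases h2 : c₂ = 0
  · exact ⟨Real.pi / 4, by simp [h1, h2], by simp [h1, h2]⟩
  · exact ⟨0, by simp [h1], by simp [h2]⟩

/-- The models with `μ = 1` are cones. -/
theorem IsModel.isOpenPartOfHarmonicCone [IsManifold (𝓡 2) ∞ M] (h : IsModel 1 κ a b T ν)
    (hκ : ¬∀ s, κ s = 0) (hx : IsOpenPartOf x (ruled a b) (modelDomain 1)) :
    IsOpenPartOfHarmonicCone x := by
  obtain ⟨-, c₁, c₂, hc⟩ := h.curvature.resolve_left fun h0 => one_ne_zero h0.1
  have hc0 : c₁ ≠ 0 ∨ c₂ ≠ 0 := by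
    by_contra! h0
    exact hκ fun s => by rw [hc, h0.1, h0.2]; ring
  obtain ⟨θ, h1, h2⟩ := exists_cos_add_sin_ne_zero hc0
  obtain ⟨κ', a', b', T', ν', h', hκ', hG⟩ := h.isometry (ε := 1) (δ := 1) θ 0 (by norm_num)
    (by norm_num) (by norm_num) (by norm_num)
  have hx' : IsOpenPartOf x (ruled a' b') (modelDomain 1) := by
    refine hx.of_comp (G := coordChange 1 (-θ) 1 0) (contDiff_coordChange _ _ _ _)
      (injective_fderiv_coordChange one_ne_zero one_ne_zero) (isOpen_modelDomain 1)
      (fun q hq => ?_) (fun q _ => ?_)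
    · simpa [modelDomain, coordChange] using hq
    · rw [Function.comp_apply, hG]
      congr 1
      apply ext_E2 <;> simp [coordChange]
  have hb := (h'.frame.contDiffOn isOpen_univ h'.curvature.contDiff.contDiffOn).2.1
  have hdb : deriv b' = T' := funext fun s => by
    simpa using (h'.frame.db s (mem_univ s)).deriv
  have fr := fun s => h'.frame.frame (mem_univ s)
  refine ⟨a' 0, b', ⟨⟨contDiffOn_univ.1 hb, fun s => ?_⟩, fun s => h'.frame.bb s (mem_univ s),
    _, _, h1, h2, fun s => ?_⟩, ?_⟩
  · rw [hdb]; exact (fr s).vv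
  · rw [sphericalCurvature, hdb, (h'.frame.dT s (mem_univ s)).deriv,
      h'.frame.cross_eq s (mem_univ s), inner_sub_left, inner_smul_left, inner_smul_left,
      (fr s).ww', (fr s).uw, hκ', hc, one_mul, Real.cos_add, Real.sin_add]
    simp only [RCLike.conj_to_real]
    ring_nf
  · rw [← modelDomain_one]
    convert hx' using 1
    ext1 q
    rw [cone, ruled, h'.directrix_eq (q 0)]

theorem IsModel.isFrame_cylinder (h : IsModel 0 κ a b T ν) (s : ℝ) : IsFrame (T s) (ν s) (b 0) := by
  rw [← h.ruling_eq s]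
  have f := h.frame.frame (mem_univ s)
  exact ⟨f.vv, f.ww, f.uu, f.vw, f.vu, f.wu⟩

/-- The models with `μ = 0` and nonconstant curvature are Cornu cylinders. -/
theorem IsModel.isOpenPartOfCornuCylinder (h : IsModel 0 κ a b T ν) {c₁ c₂ : ℝ} (hc₁ : c₁ ≠ 0)
    (hκ : ∀ s, κ s = c₁ * s + c₂) (hx : IsOpenPartOf x (ruled a b) (modelDomain 0)) :
    IsOpenPartOfCornuCylinder x := by
  have f := h.isFrame_cylinder 0
  have dT : ∀ s, HasDerivAt T (κ s • ν s) s := fun s => by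
    simpa using h.frame.dT s (mem_univ s)
  have dν := fun s => h.frame.dν s (mem_univ s)
  have da : ∀ s, HasDerivAt (fun s => a s - a 0) (T s) s := fun s => by
    simpa using (h.frame.da s (mem_univ s)).sub_const (a 0)
  have hin : ∀ {u u' : ℝ → E3} {s : ℝ} (w : E3), HasDerivAt u (u' s) s →
      HasDerivAt (fun s => (inner ℝ (u s) w : ℝ)) ((fun s => (inner ℝ (u' s) w : ℝ)) s) s :=
    fun {u u' s} w hu => by simpa using hasDerivAt_inner hu (hasDerivAt_const s w)
  have ha := (h.frame.contDiffOn isOpen_univ h.curvature.contDiff.contDiffOn).1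
  rw [contDiffOn_univ] at ha
  -- The plane curve is the directrix in the coordinates of the initial frame (T 0, ν 0); it stays
  -- in this plane because T ⟂ b and b is constant.
  set γ : ℝ → E2 := fun s => !₂[inner ℝ (a s - a 0) (T 0), inner ℝ (a s - a 0) (ν 0)] with hγ
  have hγ1 : deriv γ = fun s => !₂[inner ℝ (T s) (T 0), inner ℝ (T s) (ν 0)] := funext fun s =>
    (hasDerivAt_E2 (f' := fun s => inner ℝ (T s) (T 0)) (g' := fun s => inner ℝ (T s) (ν 0))
      (hin (T 0) (da s)) (hin (ν 0) (da s))).deriv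
  have hγ2 : deriv (deriv γ) = fun s => !₂[inner ℝ (κ s • ν s) (T 0), inner ℝ (κ s • ν s) (ν 0)] :=
    funext fun s => by
      rw [hγ1]
      exact (hasDerivAt_E2 (f' := fun s => inner ℝ (κ s • ν s) (T 0))
        (g' := fun s => inner ℝ (κ s • ν s) (ν 0)) (hin (u' := fun s => κ s • ν s) (T 0) (dT s))
        (hin (u' := fun s => κ s • ν s) (ν 0) (dT s))).deriv
  have hTb : ∀ s, (inner ℝ (T s) (b 0) : ℝ) = 0 := fun s => (h.isFrame_cylinder s).uw
  have hab : ∀ s, (inner ℝ (a s - a 0) (b 0) : ℝ) = 0 := fun s => by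
    rw [eq_of_hasDerivAt_zero (f := fun s => (inner ℝ (a s - a 0) (b 0) : ℝ)) isOpen_univ
      isPreconnected_univ (fun t _ => (hin (b 0) (da t)).congr_deriv (hTb t)) (mem_univ s)
      (mem_univ 0)]
    simp
  -- The pair (T, ν) keeps determinant 1 in the basis (T 0, ν 0), so the signed curvature of γ is κ
  -- and not -κ.
  have hdet : ∀ s, (inner ℝ (T s) (T 0) * inner ℝ (ν s) (ν 0)
      - inner ℝ (T s) (ν 0) * inner ℝ (ν s) (T 0) : ℝ) = 1 := fun s => by
    rw [eq_of_hasDerivAt_zero (f := fun s => (inner ℝ (T s) (T 0) * inner ℝ (ν s) (ν 0)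
      - inner ℝ (T s) (ν 0) * inner ℝ (ν s) (T 0) : ℝ)) isOpen_univ
      isPreconnected_univ (fun t _ => ?_) (mem_univ s) (mem_univ 0)]
    · rw [f.uu', f.vv', f.uv]; ring
    · refine (((hin (u' := fun s => κ s • ν s) (T 0) (dT t)).mul
        (hin (u' := fun s => -(κ s • T s)) (ν 0) (dν t))).sub
        ((hin (u' := fun s => κ s • ν s) (ν 0) (dT t)).mul
        (hin (u' := fun s => -(κ s • T s)) (T 0) (dν t)))).congr_deriv ?_
      simp only [inner_smul_left, inner_neg_left, RCLike.conj_to_real]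
      ring
  refine ⟨a 0, f.basis, γ, ⟨⟨?_, fun s => ?_⟩, c₁, c₂, hc₁, fun s => ?_⟩, ?_⟩
  · rw [contDiff_euclidean]
    intro i
    fin_cases i
    · exact (ha.sub contDiff_const).inner ℝ contDiff_const
    · exact (ha.sub contDiff_const).inner ℝ contDiff_const
  · have h1 := f.inner_expand (T s) (T s)
    rw [(h.isFrame_cylinder s).uu', hTb] at h1
    rw [hγ1, EuclideanSpace.norm_eq, Real.sqrt_eq_one, Fin.sum_univ_two]
    simp only [Matrix.cons_val_zero, Matrix.cons_val_one, Matrix.cons_val_fin_one, Real.norm_eq_abs,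
      sq_abs]
    linear_combination -h1
  · rw [planarCurvature, hγ2, hγ1, ← hκ]
    simp only [Matrix.cons_val_zero, Matrix.cons_val_one, Matrix.cons_val_fin_one, inner_smul_left,
      RCLike.conj_to_real]
    linear_combination κ s * hdet s
  · rw [← modelDomain_zero]
    convert hx using 1
    ext1 q
    have h1 := f.expand (a (q 0) - a 0)
    rw [hab, zero_smul, add_zero] at h1
    rw [rightCylinder, ruled, f.basis_zero, f.basis_one, f.basis_two, h.ruling_eq (q 0)]
    simp only [hγ, Matrix.cons_val_zero, Matrix.cons_val_one, Matrix.cons_val_fin_one]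
    rw [add_assoc (a 0), ← h1, add_sub_cancel]

/-- The models with `μ = 0` and constant curvature are circular cylinders. -/
theorem IsModel.isOpenPartOfCircularCylinder [IsManifold (𝓡 2) ∞ M] (h : IsModel 0 κ a b T ν)
    {k : ℝ} (hk : k ≠ 0) (hκ : ∀ s, κ s = k) (hx : IsOpenPartOf x (ruled a b) (modelDomain 0)) :
    IsOpenPartOfCircularCylinder x := by
  have f := h.isFrame_cylinder 0
  set P : E3 := a 0 + k⁻¹ • ν 0 with hP
  have hks : ∀ s : ℝ, HasDerivAt (fun s => k * s) k s := fun s => by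
    simpa using (hasDerivAt_id s).const_mul k
  -- The circle about P with angle ks solves the Frenet equations with constant curvature k and the
  -- same initial values, so uniqueness identifies the directrix with it.
  have hcir : IsRuledFrame 0 univ κ
      (fun s => P + k⁻¹ • (Real.sin (k * s) • T 0 - Real.cos (k * s) • ν 0)) (fun _ => b 0)
      (fun s => Real.cos (k * s) • T 0 + Real.sin (k * s) • ν 0)
      (fun s => Real.cos (k * s) • ν 0 - Real.sin (k * s) • T 0) := by
    refine isRuledFrame_of_hasDerivAt (s₀ := 0) (fun s => ?_) (fun s => ?_) (fun s => ?_)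
      (fun s => ?_) ?_ ?_
    · refine ((((hks s).sin.smul_const (T 0)).sub ((hks s).cos.smul_const (ν 0))).const_smul
        k⁻¹ |>.const_add P).congr_deriv ?_
      simp only [smul_sub, smul_smul, sub_zero, one_smul]
      rw [show k⁻¹ * (Real.cos (k * s) * k) = Real.cos (k * s) by field_simp,
        show k⁻¹ * (-Real.sin (k * s) * k) = -Real.sin (k * s) by field_simp]
      module
    · simpa using hasDerivAt_const s (b 0)
    · refine (((hks s).cos.smul_const (T 0)).add ((hks s).sin.smul_const (ν 0))).congr_deriv ?_
      rw [hκ]; module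
    · refine (((hks s).cos.smul_const (ν 0)).sub ((hks s).sin.smul_const (T 0))).congr_deriv ?_
      rw [hκ]; module
    · simpa using h.frame.frame (mem_univ 0)
    · simpa using h.frame.cross_eq 0 (mem_univ 0)
  obtain ⟨h1, -⟩ := h.frame.eqOn isOpen_univ isPreconnected_univ hcir (mem_univ 0)
    (by simp [hP]) rfl (by simp)
  have hk' : |k| ≠ 0 := abs_ne_zero.2 hk
  have hσ : (|k|⁻¹ * k) ^ 2 = 1 := by
    rw [mul_pow, inv_pow, sq_abs, inv_mul_cancel₀ (pow_ne_zero 2 hk)]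
  have hσ' : |k|⁻¹ * (|k|⁻¹ * k) = k⁻¹ := by
    rw [← mul_assoc, ← mul_inv, abs_mul_abs_self, mul_inv, inv_mul_cancel_right₀ hk]
  have hσn : ‖|k|⁻¹ * k‖ = 1 := by
    rw [norm_mul, norm_inv, Real.norm_eq_abs, Real.norm_eq_abs, abs_abs, inv_mul_cancel₀ hk']
  -- The number |k|⁻¹k is the sign of k. It is absorbed in the axes so that the radius |k|⁻¹ is
  -- positive while the angle remains ks.
  have f' : IsFrame (-((|k|⁻¹ * k) • ν 0)) ((|k|⁻¹ * k) • T 0) (b 0) :=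
    ⟨by rw [norm_neg, norm_smul, hσn, f.vv, mul_one], by rw [norm_smul, hσn, f.uu, mul_one], f.ww,
      by rw [inner_neg_left, inner_smul_left, inner_smul_right, f.vu]; simp,
      by rw [inner_neg_left, inner_smul_left, f.vw]; simp,
      by rw [inner_smul_left, f.uw]; simp⟩
  refine ⟨P, f'.basis, |k|⁻¹, by positivity, hx.of_comp (contDiff_coordChange k 0 1 0)
    (injective_fderiv_coordChange hk one_ne_zero) isOpen_univ (mapsTo_univ _ _) fun q _ => ?_⟩
  rw [Function.comp_apply, rightCylinder, ruled, f'.basis_zero, f'.basis_one, f'.basis_two,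
    h1 (mem_univ _), h.ruling_eq (q 0)]
  simp only [coordChange, Matrix.cons_val_zero, Matrix.cons_val_one, Matrix.cons_val_fin_one,
    ← hσ', add_zero, one_mul]
  module

/-- The models with nonvanishing curvature are circular cylinders, Cornu cylinders and cones. -/
theorem IsModel.classification [IsManifold (𝓡 2) ∞ M] (h : IsModel μ κ a b T ν)
    (hκ : ¬∀ s, κ s = 0) (hx : IsOpenPartOf x (ruled a b) (modelDomain μ)) :
    IsOpenPartOfCircularCylinder x ∨ IsOpenPartOfCornuCylinder x ∨ IsOpenPartOfHarmonicCone x := by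
  rcases h.mu with rfl | rfl
  · obtain ⟨-, c₁, c₂, hc⟩ := h.curvature.resolve_right fun h0 => zero_ne_one h0.1
    by_cases h1 : c₁ = 0
    · have hc' : ∀ s, κ s = c₂ := fun s => by rw [hc, h1]; ring
      exact Or.inl (h.isOpenPartOfCircularCylinder
        (fun h2 => hκ fun s => by rw [hc', h2]) hc' hx)
    · exact Or.inr (Or.inl (h.isOpenPartOfCornuCylinder h1 hc hx))
  · exact Or.inr (Or.inr (h.isOpenPartOfHarmonicCone hκ hx))

end Classification

/-! ### The surfaces of the list as models. -/

section CurvesToModels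

variable {μ : ℝ} {κ : ℝ → ℝ} {a b T T' : ℝ → E3}

theorem cross_cross (u v w : E3) :
    cross u (cross v w) = (inner ℝ u w : ℝ) • v - (inner ℝ u v : ℝ) • w := by
  apply ext_E3 <;>
    simp only [cross_zero, cross_one, cross_two, inner_E3, PiLp.sub_apply, PiLp.smul_apply,
      smul_eq_mul] <;> ring

/-- The ruled frame of a directrix and a field of rulings. -/
theorem isRuledFrame_of_curve (hb : ∀ s, ‖b s‖ = 1) (hT : ∀ s, ‖T s‖ = 1)
    (hbT : ∀ s, (inner ℝ (b s) (T s) : ℝ) = 0) (da : ∀ s, HasDerivAt a ((1 - μ) • T s) s)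
    (db : ∀ s, HasDerivAt b (μ • T s) s) (dT : ∀ s, HasDerivAt T (T' s) s)
    (hκ : ∀ s, (inner ℝ (T' s) (cross (b s) (T s)) : ℝ) = κ s) :
    IsRuledFrame μ univ κ a b T (fun s => cross (b s) (T s)) := by
  have f := fun s => IsFrame.of_cross (hb s) (hT s) (hbT s)
  have h1 : ∀ s, (inner ℝ (T' s) (T s) : ℝ) = 0 := fun s => by
    have h := (hasDerivAt_inner (dT s) (dT s)).unique
      ((hasDerivAt_const s 1).congr_of_eventuallyEq (.of_forall fun t => (f t).vv'))
    rw [real_inner_comm] at h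
    linarith
  have h2 : ∀ s, (inner ℝ (T' s) (b s) : ℝ) = -μ := fun s => by
    have h := (hasDerivAt_inner (db s) (dT s)).unique
      ((hasDerivAt_const s 0).congr_of_eventuallyEq (.of_forall fun t => hbT t))
    rw [real_inner_comm, inner_smul_left, (f s).vv'] at h
    simp only [RCLike.conj_to_real] at h
    linarith
  -- Differentiating |T| = 1 and b ⟂ T fixes the components of T' along T and b; κ is the remaining
  -- one.
  have hT' : ∀ s, T' s = κ s • cross (b s) (T s) - μ • b s := fun s => by
    conv_lhs => rw [(f s).expand (T' s), h1, h2, hκ]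
    module
  refine ⟨fun s _ => hb s, fun s _ => hT s, fun s _ => hbT s, fun s _ => rfl, fun s _ => da s,
    fun s _ => db s, fun s _ => hT' s ▸ dT s, fun s _ => ?_⟩
  refine (hasDerivAt_cross (db s) (dT s)).congr_deriv ?_
  rw [hT', sub_eq_add_neg, ← neg_smul, cross_add_right, cross_smul_right, cross_smul_right,
    cross_smul_left, cross_self, cross_self, cross_cross, hbT, (f s).uu']
  module

variable {p : E3}

/-- Planes are models. -/
theorem isModel_plane {v w : E3} (hvw : Orthonormal ℝ ![v, w]) :
    ∃ κ a b T ν, IsModel 0 κ a b T ν ∧ ruled a b = fun q => p + q 0 • v + q 1 • w := by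
  have hv : ‖v‖ = 1 := hvw.1 0
  have hw : ‖w‖ = 1 := hvw.1 1
  have hwv : (inner ℝ w v : ℝ) = 0 := hvw.2 (i := 1) (j := 0) (by simp)
  refine ⟨fun _ => 0, fun s => p + s • v, fun _ => w, fun _ => v, _, ⟨Or.inl ⟨rfl, 0, 0, by simp⟩,
    isRuledFrame_of_curve (T' := fun _ => 0) (fun _ => hw) (fun _ => hv) (fun _ => hwv)
      (fun s => ?_) (fun s => ?_) (fun s => hasDerivAt_const s v) (fun s => inner_zero_left _)⟩,
    rfl⟩
  · simpa using ((hasDerivAt_id s).smul_const v).const_add p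
  · simpa using hasDerivAt_const s w

/-- Cylinders over planar curves with affine curvature function are models. -/
theorem isModel_rightCylinder (B : OrthonormalBasis (Fin 3) ℝ E3) {γ : ℝ → E2}
    (hγ : IsUnitSpeed γ) (hκ : IsModelCurvature 0 (planarCurvature γ)) :
    ∃ κ a b T ν, IsModel 0 κ a b T ν ∧ ruled a b = rightCylinder p B γ := by
  have hB : ∀ i j, (inner ℝ (B i) (B j) : ℝ) = if i = j then 1 else 0 :=
    orthonormal_iff_ite.1 B.orthonormal
  have f : IsFrame (B 2) (B 0) (B 1) :=
    ⟨B.orthonormal.1 2, B.orthonormal.1 0, B.orthonormal.1 1, by simp [hB], by simp [hB],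
      by simp [hB]⟩
  -- The orthonormal basis may be negatively oriented. Then the curvature of the model is the
  -- opposite of that of γ, which still solves the same equation.
  obtain ⟨η, hη, h1⟩ : ∃ η : ℝ, η ^ 2 = 1 ∧ cross (B 2) (B 0) = η • B 1 := by
    rcases f.cross_eq with h | h
    · exact ⟨1, by norm_num, by rw [h, one_smul]⟩
    · exact ⟨-1, by norm_num, by rw [h, neg_one_smul]⟩
  have h2 : cross (B 2) (B 1) = -(η • B 0) := by
    have h3 : B 1 = η • cross (B 2) (B 0) := by rw [h1, smul_smul, ← sq, hη, one_smul]
    rw [h3, cross_smul_right, cross_cross, f.uv, f.uu']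
    module
  have d1 : ∀ s, HasDerivAt γ (deriv γ s) s := fun s =>
    (hγ.1.differentiable (by simp) s).hasDerivAt
  have d2 : ∀ s, HasDerivAt (deriv γ) (deriv (deriv γ) s) s := fun s =>
    ((contDiff_infty_iff_deriv.1 hγ.1).2.differentiable (by simp) s).hasDerivAt
  have hn : ∀ s, deriv γ s 0 ^ 2 + deriv γ s 1 ^ 2 = 1 := fun s => by
    have h := hγ.2 s
    rw [EuclideanSpace.norm_eq, Real.sqrt_eq_one, Fin.sum_univ_two] at h
    simpa using h
  refine ⟨fun s => η * planarCurvature γ s, fun s => p + (γ s 0 • B 0 + γ s 1 • B 1), fun _ => B 2,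
    fun s => deriv γ s 0 • B 0 + deriv γ s 1 • B 1, _, ⟨hκ.const_mul η,
    isRuledFrame_of_curve (T' := fun s => deriv (deriv γ) s 0 • B 0 + deriv (deriv γ) s 1 • B 1)
      (fun _ => f.uu) (fun s => ?_) (fun s => ?_) (fun s => ?_) (fun s => ?_) (fun s => ?_)
      (fun s => ?_)⟩, ?_⟩
  · rw [← pow_left_inj₀ (norm_nonneg _) zero_le_one two_ne_zero, ← real_inner_self_eq_norm_sq]
    simp only [inner_add_left, inner_add_right, inner_smul_left, inner_smul_right, f.vv', f.ww',
      f.vw, f.wv, RCLike.conj_to_real]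
    linear_combination hn s
  · simp [inner_add_right, inner_smul_right, f.uv, f.uw]
  · simpa using ((((hasDerivAt_ofLp (d1 s) 0).smul_const (B 0)).add
      ((hasDerivAt_ofLp (d1 s) 1).smul_const (B 1))).const_add p)
  · simpa using hasDerivAt_const s (B 2)
  · exact ((hasDerivAt_ofLp (d2 s) 0).smul_const (B 0)).add
      ((hasDerivAt_ofLp (d2 s) 1).smul_const (B 1))
  · rw [cross_add_right, cross_smul_right, cross_smul_right, h1, h2, planarCurvature]
    simp only [inner_add_left, inner_add_right, inner_neg_right, inner_smul_left, inner_smul_right,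
      f.vv', f.ww', f.vw, f.wv, RCLike.conj_to_real]
    ring
  · ext1 q
    rw [ruled, rightCylinder]
    abel

/-- Cones over harmonic spherical curves are models. -/
theorem isModel_cone {β : ℝ → E3} (hβ : IsHarmonicSphericalCurve β) :
    ∃ κ a b T ν, IsModel 1 κ a b T ν ∧ ruled a b = cone p β := by
  obtain ⟨⟨hs, h1⟩, h2, c₁, c₂, -, -, hκ⟩ := hβ
  have d1 : ∀ s, HasDerivAt β (deriv β s) s := fun s =>
    (hs.differentiable (by simp) s).hasDerivAt
  have d2 : ∀ s, HasDerivAt (deriv β) (deriv (deriv β) s) s := fun s =>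
    ((contDiff_infty_iff_deriv.1 hs).2.differentiable (by simp) s).hasDerivAt
  refine ⟨sphericalCurvature β, fun _ => p, β, deriv β, _, ⟨Or.inr ⟨rfl, c₁, c₂, hκ⟩,
    isRuledFrame_of_curve h2 h1 (fun s => ?_) (fun s => ?_) (fun s => ?_) d2 (fun s => rfl)⟩, rfl⟩
  · have h := (hasDerivAt_inner (d1 s) (d1 s)).unique
      ((hasDerivAt_const s 1).congr_of_eventuallyEq (.of_forall fun t => by
        simp [h2]))
    rw [real_inner_comm (β s)] at h
    linarith
  · simpa using hasDerivAt_const s p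
  · simpa using d1 s

/-- The circular cylinder is parametrized by the angle; models need arclength, which replaces the
angle by s/r. -/
theorem isUnitSpeed_circle {r : ℝ} (hr : 0 < r) :
    IsUnitSpeed (fun s => (!₂[r * Real.cos (r⁻¹ * s), r * Real.sin (r⁻¹ * s)] : E2)) ∧
      ∀ s, planarCurvature (fun s => (!₂[r * Real.cos (r⁻¹ * s), r * Real.sin (r⁻¹ * s)] : E2)) s
        = r⁻¹ := by
  have hks : ∀ s : ℝ, HasDerivAt (fun s => r⁻¹ * s) r⁻¹ s := fun s => by
    simpa using (hasDerivAt_id s).const_mul r⁻¹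
  have e1 : deriv (fun s => (!₂[r * Real.cos (r⁻¹ * s), r * Real.sin (r⁻¹ * s)] : E2))
      = fun s => !₂[-Real.sin (r⁻¹ * s), Real.cos (r⁻¹ * s)] := funext fun s => by
    refine (hasDerivAt_E2 (f' := fun s => -Real.sin (r⁻¹ * s)) (g' := fun s => Real.cos (r⁻¹ * s))
      (((hks s).cos.const_mul r).congr_deriv ?_) (((hks s).sin.const_mul r).congr_deriv ?_)).deriv
    · field_simp
    · field_simp
  have e2 : deriv (fun s => (!₂[-Real.sin (r⁻¹ * s), Real.cos (r⁻¹ * s)] : E2))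
      = fun s => !₂[-(Real.cos (r⁻¹ * s) * r⁻¹), -Real.sin (r⁻¹ * s) * r⁻¹] := funext fun s =>
    (hasDerivAt_E2 (f' := fun s => -(Real.cos (r⁻¹ * s) * r⁻¹))
      (g' := fun s => -Real.sin (r⁻¹ * s) * r⁻¹) (hks s).sin.neg (hks s).cos).deriv
  have hc : ContDiff ℝ ∞ (fun s : ℝ => r⁻¹ * s) := contDiff_const.mul contDiff_id
  refine ⟨⟨?_, fun s => ?_⟩, fun s => ?_⟩
  · rw [contDiff_euclidean]
    intro i
    fin_cases i
    · exact contDiff_const.mul (Real.contDiff_cos.comp hc)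
    · exact contDiff_const.mul (Real.contDiff_sin.comp hc)
  · rw [e1, EuclideanSpace.norm_eq, Real.sqrt_eq_one, Fin.sum_univ_two]
    simp
  · rw [planarCurvature, e1, e2]
    simp only [Matrix.cons_val_zero, Matrix.cons_val_one, Matrix.cons_val_fin_one]
    linear_combination r⁻¹ * Real.sin_sq_add_cos_sq (r⁻¹ * s)

variable {M : Type*} [TopologicalSpace M] [ChartedSpace E2 M] [IsManifold (𝓡 2) ∞ M] {x : M → E3}

/-- The surfaces of the classification are open parts of models. -/
theorem exists_isModel (h : IsOpenPartOfPlane x ∨ IsOpenPartOfCircularCylinder x ∨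
    IsOpenPartOfCornuCylinder x ∨ IsOpenPartOfHarmonicCone x) :
    ∃ (μ : ℝ) (κ : ℝ → ℝ) (a b T ν : ℝ → E3), IsModel μ κ a b T ν ∧
      IsOpenPartOf x (ruled a b) (modelDomain μ) := by
  rcases h with ⟨p, v, w, hvw, hx⟩ | ⟨p, B, r, hr, hx⟩ | ⟨p, B, γ, ⟨hγ, c₁, c₂, -, hκ⟩, hx⟩ |
    ⟨p, β, hβ, hx⟩
  · obtain ⟨κ, a, b, T, ν, h, hF⟩ := isModel_plane (p := p) hvw
    exact ⟨0, κ, a, b, T, ν, h, by rwa [hF, modelDomain_zero]⟩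
  · obtain ⟨h1, h2⟩ := isUnitSpeed_circle hr
    obtain ⟨κ, a, b, T, ν, h, hF⟩ := isModel_rightCylinder (p := p) B h1
      (Or.inl ⟨rfl, 0, r⁻¹, fun s => by rw [h2]; ring⟩)
    refine ⟨0, κ, a, b, T, ν, h, hx.of_comp (contDiff_coordChange r 0 1 0)
      (injective_fderiv_coordChange hr.ne' one_ne_zero) (isOpen_modelDomain 0) (fun q _ => ?_)
      (fun q _ => ?_)⟩
    · rw [modelDomain_zero]; exact mem_univ _
    · rw [hF]
      simp [rightCylinder, coordChange, inv_mul_cancel_left₀ hr.ne']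
  · obtain ⟨κ, a, b, T, ν, h, hF⟩ := isModel_rightCylinder (p := p) B hγ (Or.inl ⟨rfl, c₁, c₂, hκ⟩)
    exact ⟨0, κ, a, b, T, ν, h, by rwa [hF, modelDomain_zero]⟩
  · obtain ⟨κ, a, b, T, ν, h, hF⟩ := isModel_cone (p := p) hβ
    exact ⟨1, κ, a, b, T, ν, h, by rwa [hF, modelDomain_one]⟩

end CurvesToModels

/-! ### Invariance of Δα = 0 under changes of coordinates. -/

section ChangeOfCoordinates

variable {F y : E2 → E3} {U V : Set E2} {φ : E2 → E2} {q : E2}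

theorem contDiffOn_firstForm (hV : IsOpen V) (hF : ContDiffOn ℝ ∞ F V) (i j : Fin 2) :
    ContDiffOn ℝ ∞ (fun q => firstForm F q i j) V :=
  (contDiffOn_partialD hV hF i).inner ℝ (contDiffOn_partialD hV hF j)

theorem contDiffOn_det_firstForm (hV : IsOpen V) (hF : ContDiffOn ℝ ∞ F V) :
    ContDiffOn ℝ ∞ (fun q => (firstForm F q).det) V := by
  simp only [Matrix.det_fin_two]
  have h := contDiffOn_firstForm hV hF
  exact ((h 0 0).mul (h 1 1)).sub ((h 0 1).mul (h 1 0))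

theorem det_firstForm_pos (hc : cross (partialD 0 F q) (partialD 1 F q) ≠ 0) :
    0 < (firstForm F q).det := by
  rw [det_firstForm]
  exact pow_pos (norm_pos_iff.2 hc) 2

theorem contDiffOn_inv_firstForm (hV : IsOpen V) (hF : ContDiffOn ℝ ∞ F V)
    (hc : ∀ q ∈ V, cross (partialD 0 F q) (partialD 1 F q) ≠ 0) (i j : Fin 2) :
    ContDiffOn ℝ ∞ (fun q => (firstForm F q)⁻¹ i j) V := by
  have h := contDiffOn_firstForm hV hF
  have hd := (contDiffOn_det_firstForm hV hF).inv fun q hq => (det_firstForm_pos (hc q hq)).ne'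
  simp only [Matrix.inv_def, Ring.inverse_eq_inv', Matrix.smul_apply, smul_eq_mul,
    Matrix.adjugate_fin_two]
  refine hd.mul ?_
  fin_cases i <;> fin_cases j
  · exact h 1 1
  · exact (h 0 1).neg
  · exact (h 1 0).neg
  · exact h 0 0

theorem contDiffOn_meanCurvature (hV : IsOpen V) (hF : ContDiffOn ℝ ∞ F V)
    (hc : ∀ q ∈ V, cross (partialD 0 F q) (partialD 1 F q) ≠ 0) :
    ContDiffOn ℝ ∞ (meanCurvature F) V := by
  have h1 := contDiffOn_inv_firstForm hV hF hc
  have h2 : ∀ i j, ContDiffOn ℝ ∞ (fun q => secondForm F q i j) V := fun i j =>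
    (contDiffOn_partialD hV (contDiffOn_partialD hV hF j) i).inner ℝ
      (contDiffOn_unitNormal hV hF hc)
  unfold meanCurvature
  simp only [Matrix.trace_fin_two, Matrix.mul_apply, Fin.sum_univ_two]
  exact contDiffOn_const.mul ((((h1 0 0).mul (h2 0 0)).add ((h1 0 1).mul (h2 1 0))).add
    (((h1 1 0).mul (h2 0 1)).add ((h1 1 1).mul (h2 1 1))))

/-- The transposed Jacobian matrix of a map of the plane. -/
noncomputable def jacobian (φ : E2 → E2) (q : E2) : Matrix (Fin 2) (Fin 2) ℝ :=
  Matrix.of fun i k => partialD i φ q k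

theorem jacobian_apply (φ : E2 → E2) (q : E2) (i k : Fin 2) :
    jacobian φ q i k = partialD i φ q k := rfl

theorem contDiffOn_jacobian (hU : IsOpen U) (hφ : ContDiffOn ℝ ∞ φ U) (i k : Fin 2) :
    ContDiffOn ℝ ∞ (fun q => jacobian φ q i k) U :=
  contDiffOn_apply_E2 (contDiffOn_partialD hU hφ i) k

theorem partialD_jacobian (hU : IsOpen U) (hφ : ContDiffOn ℝ ∞ φ U) (hq : q ∈ U) (i j k : Fin 2) :
    partialD i (fun q => jacobian φ q j k) q = partialD j (fun q => jacobian φ q i k) q := by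
  simp only [jacobian_apply]
  rw [partialD_apply (diffAt (contDiffOn_partialD hU hφ j) hU hq),
    partialD_apply (diffAt (contDiffOn_partialD hU hφ i) hU hq), partialD_comm hU hφ hq]

/-- The data of a change of coordinates `y = F ∘ φ` of a parametrized surface. -/
structure IsReparam (F y : E2 → E3) (φ : E2 → E2) (V U : Set E2) : Prop where
  openV : IsOpen V
  openU : IsOpen U
  smoothF : ContDiffOn ℝ ∞ F V
  smoothφ : ContDiffOn ℝ ∞ φ U
  mapsTo : MapsTo φ U V
  eqOn : EqOn y (fun q => F (φ q)) U
  regular : ∀ q ∈ V, cross (partialD 0 F q) (partialD 1 F q) ≠ 0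

namespace IsReparam

theorem partialD_comp' {G : Type*} [NormedAddCommGroup G] [NormedSpace ℝ G]
    (h : IsReparam F y φ V U) {f : E2 → G} (hf : ContDiffOn ℝ ∞ f V) (hq : q ∈ U) (i : Fin 2) :
    partialD i (fun q => f (φ q)) q = jacobian φ q i 0 • partialD 0 f (φ q)
      + jacobian φ q i 1 • partialD 1 f (φ q) :=
  partialD_comp (diffAt hf h.openV (h.mapsTo hq)) (diffAt h.smoothφ h.openU hq) i

theorem partialD_eq (h : IsReparam F y φ V U) (hq : q ∈ U) (i : Fin 2) :
    partialD i y q = jacobian φ q i 0 • partialD 0 F (φ q)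
      + jacobian φ q i 1 • partialD 1 F (φ q) := by
  rw [partialD_congr_on h.openU h.eqOn hq, h.partialD_comp' h.smoothF hq]

theorem cross_eq (h : IsReparam F y φ V U) (hq : q ∈ U) :
    cross (partialD 0 y q) (partialD 1 y q)
      = (jacobian φ q).det • cross (partialD 0 F (φ q)) (partialD 1 F (φ q)) := by
  rw [h.partialD_eq hq, h.partialD_eq hq, Matrix.det_fin_two]
  simp only [cross_add_left, cross_add_right, cross_smul_left, cross_smul_right, cross_self]
  rw [cross_anticomm (partialD 0 F (φ q)) (partialD 1 F (φ q))]
  module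

theorem firstForm_eq (h : IsReparam F y φ V U) (hq : q ∈ U) :
    firstForm y q = jacobian φ q * firstForm F (φ q) * (jacobian φ q).transpose := by
  ext i j
  simp only [firstForm, Matrix.of_apply, Matrix.mul_apply, Fin.sum_univ_two,
    Matrix.transpose_apply, h.partialD_eq hq, inner_add_left, inner_add_right, inner_smul_left,
    inner_smul_right, RCLike.conj_to_real]
  ring

variable {ε : ℝ}

/-- The factor ε is the sign of the Jacobian: the vector product scales by the determinant, and
normalization leaves only its sign. -/
theorem unitNormal_eq (h : IsReparam F y φ V U) (hq : q ∈ U)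
    (hε : (jacobian φ q).det = ε * |(jacobian φ q).det|) (h0 : (jacobian φ q).det ≠ 0) :
    unitNormal y q = ε • unitNormal F (φ q) := by
  rw [unitNormal, unitNormal, h.cross_eq hq, norm_smul, Real.norm_eq_abs, mul_inv, smul_smul,
    smul_smul]
  congr 1
  have h1 := abs_ne_zero.2 h0
  rw [mul_right_comm, mul_comm _ ((jacobian φ q).det)]
  nth_rewrite 1 [hε]
  field_simp

theorem secondForm_eq (h : IsReparam F y φ V U) (hq : q ∈ U)
    (hε : (jacobian φ q).det = ε * |(jacobian φ q).det|) (h0 : (jacobian φ q).det ≠ 0) :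
    secondForm y q
      = ε • (jacobian φ q * secondForm F (φ q) * (jacobian φ q).transpose) := by
  have dJ := fun i k => diffAt (contDiffOn_jacobian h.openU h.smoothφ i k) h.openU hq
  have hFk := fun k => contDiffOn_partialD h.openV h.smoothF k
  have dF : ∀ k, DifferentiableAt ℝ (fun q => partialD k F (φ q)) q := fun k =>
    (diffAt (hFk k) h.openV (h.mapsTo hq)).comp q (diffAt h.smoothφ h.openU hq)
  have hperp : ∀ k, (inner ℝ (partialD k F (φ q)) (unitNormal F (φ q)) : ℝ) = 0 := fun k =>
    inner_partialD_unitNormal k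
  ext i j
  have h2 : partialD i (partialD j y) q = _ :=
    partialD_congr_on h.openU (fun r hr => h.partialD_eq hr j) hq i
  rw [partialD_add ((dJ j 0).fun_smul (dF 0)) ((dJ j 1).fun_smul (dF 1)),
    partialD_smul (dJ j 0) (dF 0), partialD_smul (dJ j 1) (dF 1), h.partialD_comp' (hFk 0) hq,
    h.partialD_comp' (hFk 1) hq] at h2
  simp only [secondForm, Matrix.of_apply, Matrix.smul_apply, Matrix.mul_apply, Fin.sum_univ_two,
    Matrix.transpose_apply, smul_eq_mul]
  rw [h2, h.unitNormal_eq hq hε h0]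
  simp only [inner_add_left, inner_smul_left, inner_smul_right, hperp, RCLike.conj_to_real]
  ring

/-- With J the Jacobian, g becomes JgJᵀ and h becomes εJhJᵀ, so g⁻¹h is conjugated by Jᵀ up to the
sign ε, and the trace sees only ε. -/
theorem meanCurvature_eq (h : IsReparam F y φ V U) (hq : q ∈ U)
    (hε : (jacobian φ q).det = ε * |(jacobian φ q).det|) (h0 : (jacobian φ q).det ≠ 0) :
    meanCurvature y q = ε * meanCurvature F (φ q) := by
  have hu : IsUnit (jacobian φ q).det := isUnit_iff_ne_zero.2 h0
  have hu' : IsUnit (jacobian φ q).transpose.det := by rwa [Matrix.det_transpose]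
  rw [meanCurvature, meanCurvature, h.firstForm_eq hq, h.secondForm_eq hq hε h0, mul_smul_comm,
    Matrix.trace_smul, smul_eq_mul, Matrix.mul_inv_rev, Matrix.mul_inv_rev]
  have e : (jacobian φ q).transpose⁻¹ * ((firstForm F (φ q))⁻¹ * (jacobian φ q)⁻¹)
      * (jacobian φ q * secondForm F (φ q) * (jacobian φ q).transpose)
      = (jacobian φ q).transpose⁻¹ * (((firstForm F (φ q))⁻¹ * secondForm F (φ q))
        * (jacobian φ q).transpose) := by
    simp only [Matrix.mul_assoc]
    rw [Matrix.nonsing_inv_mul_cancel_left _ _ hu]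
  rw [e, Matrix.trace_mul_comm, Matrix.mul_assoc, Matrix.mul_nonsing_inv _ hu', Matrix.mul_one]
  ring

/-- The coefficients of the gradient density in two coordinate systems. -/
theorem gradient_eq (h : IsReparam F y φ V U) {f f' : E2 → ℝ} (hf : ContDiffOn ℝ ∞ f V)
    (hf' : ∀ q ∈ U, f' q = ε * f (φ q)) (hq : q ∈ U)
    (hε : (jacobian φ q).det = ε * |(jacobian φ q).det|) (h0 : (jacobian φ q).det ≠ 0)
    (i : Fin 2) :
    √(firstForm y q).det * ∑ j, (firstForm y q)⁻¹ i j * partialD j f' q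
      = ∑ k, (jacobian φ q).transpose.adjugate i k *
        (√(firstForm F (φ q)).det * ∑ j, (firstForm F (φ q))⁻¹ k j * partialD j f (φ q)) := by
  have hu : IsUnit (jacobian φ q).det := isUnit_iff_ne_zero.2 h0
  have hgrad : (fun j => partialD j f' q)
      = ε • Matrix.mulVec (jacobian φ q) (fun k => partialD k f (φ q)) := by
    ext j
    have hd : DifferentiableAt ℝ (fun q => f (φ q)) q :=
      (diffAt hf h.openV (h.mapsTo hq)).comp q (diffAt h.smoothφ h.openU hq)
    rw [partialD_congr_on h.openU hf' hq, partialD_mul (differentiableAt_const ε) hd,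
      partialD_const, h.partialD_comp' hf hq]
    change _ = ε * ∑ k, jacobian φ q j k * partialD k f (φ q)
    rw [Fin.sum_univ_two, zero_mul, add_zero, smul_eq_mul, smul_eq_mul]
  have hdet : √(firstForm y q).det = |(jacobian φ q).det| * √(firstForm F (φ q)).det := by
    rw [h.firstForm_eq hq, Matrix.det_mul, Matrix.det_mul, Matrix.det_transpose, mul_right_comm,
      ← sq, Real.sqrt_mul (sq_nonneg _), Real.sqrt_sq_eq_abs]
  -- The sign ε of the function and |det J| of the area density combine to det J. What remains is
  -- the adjugate, which is polynomial in J and can be differentiated without denominators.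
  have hadj : (jacobian φ q).transpose.adjugate
      = (ε * |(jacobian φ q).det|) • (jacobian φ q).transpose⁻¹ := by
    rw [← hε, Matrix.inv_def, Matrix.det_transpose, Ring.inverse_eq_inv', smul_smul,
      mul_inv_cancel₀ h0, one_smul]
  have hL : ∑ j, (firstForm y q)⁻¹ i j * partialD j f' q
      = Matrix.mulVec (firstForm y q)⁻¹ (fun j => partialD j f' q) i := rfl
  have hR : ∀ k, ∑ j, (firstForm F (φ q))⁻¹ k j * partialD j f (φ q)
      = Matrix.mulVec (firstForm F (φ q))⁻¹ (fun j => partialD j f (φ q)) k := fun k => rfl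
  have hE : Matrix.mulVec (firstForm y q)⁻¹ (fun j => partialD j f' q)
      = ε • Matrix.mulVec (jacobian φ q).transpose⁻¹ (Matrix.mulVec (firstForm F (φ q))⁻¹
        (fun j => partialD j f (φ q))) := by
    rw [hgrad, h.firstForm_eq hq, Matrix.mul_inv_rev, Matrix.mul_inv_rev, Matrix.mulVec_smul,
      Matrix.mulVec_mulVec, Matrix.mulVec_mulVec, Matrix.mul_assoc, Matrix.mul_assoc,
      Matrix.nonsing_inv_mul _ hu, Matrix.mul_one]
  rw [hL, hE, hadj, hdet]
  simp only [hR, Pi.smul_apply, Matrix.smul_apply, smul_eq_mul]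
  generalize Matrix.mulVec (firstForm F (φ q))⁻¹ (fun j => partialD j f (φ q)) = w
  simp only [Matrix.mulVec, dotProduct, Fin.sum_univ_two]
  ring

/-- The condition `Δ α = 0` does not depend on the coordinates. -/
theorem laplace_meanCurvature_eq_zero (h : IsReparam F y φ V U)
    (h0 : ∀ q ∈ U, (jacobian φ q).det ≠ 0) (hq : q ∈ U)
    (hF : laplace F (meanCurvature F) (φ q) = 0) : laplace y (meanCurvature y) q = 0 := by
  set ε : ℝ := (jacobian φ q).det / |(jacobian φ q).det| with hε
  have hdetc : ContDiffOn ℝ ∞ (fun q => (jacobian φ q).det) U := by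
    simp only [Matrix.det_fin_two]
    have hJ := contDiffOn_jacobian h.openU h.smoothφ
    exact ((hJ 0 0).mul (hJ 1 1)).sub ((hJ 0 1).mul (hJ 1 0))
  -- On this neighbourhood of q the determinant keeps its sign, so ε is a constant there.
  have hU' : IsOpen (U ∩ {r | 0 < (jacobian φ q).det * (jacobian φ r).det}) :=
    (continuousOn_const.mul hdetc.continuousOn).isOpen_inter_preimage h.openU isOpen_Ioi
  set U' := U ∩ {r | 0 < (jacobian φ q).det * (jacobian φ r).det} with hU'def
  have hqU' : q ∈ U' := ⟨hq, mul_self_pos.2 (h0 q hq)⟩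
  have h' : IsReparam F y φ V U' :=
    ⟨h.openV, hU', h.smoothF, h.smoothφ.mono inter_subset_left, fun r hr => h.mapsTo hr.1,
      fun r hr => h.eqOn hr.1, h.regular⟩
  have hεU : ∀ r ∈ U', (jacobian φ r).det = ε * |(jacobian φ r).det| := fun r hr => by
    have h1 : 0 < (jacobian φ q).det * (jacobian φ r).det := hr.2
    rcases pos_and_pos_or_neg_and_neg_of_mul_pos h1 with ⟨h2, h3⟩ | ⟨h2, h3⟩
    · rw [hε, abs_of_pos h2, abs_of_pos h3, div_self h2.ne', one_mul]
    · rw [hε, abs_of_neg h2, abs_of_neg h3, div_neg, div_self h2.ne, neg_one_mul, neg_neg]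
  have hα := contDiffOn_meanCurvature h.openV h.smoothF h.regular
  set W : Fin 2 → E2 → ℝ := fun k p => √(firstForm F p).det *
    ∑ j, (firstForm F p)⁻¹ k j * partialD j (meanCurvature F) p with hW
  have hWs : ∀ k, ContDiffOn ℝ ∞ (W k) V := fun k => by
    have h1 := contDiffOn_inv_firstForm h.openV h.smoothF h.regular
    simp only [hW, Fin.sum_univ_two]
    exact ((contDiffOn_det_firstForm h.openV h.smoothF).sqrt
      fun p hp => (det_firstForm_pos (h.regular p hp)).ne').mul
      (((h1 k 0).mul (contDiffOn_partialD h.openV hα 0)).add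
        ((h1 k 1).mul (contDiffOn_partialD h.openV hα 1)))
  have hdiv : partialD 0 (W 0) (φ q) + partialD 1 (W 1) (φ q) = 0 := by
    rw [laplace, neg_eq_zero, Fin.sum_univ_two] at hF
    exact (mul_eq_zero.1 hF).resolve_left (inv_ne_zero (Real.sqrt_ne_zero'.2
      (det_firstForm_pos (h.regular _ (h.mapsTo hq)))))
  have hgrad : ∀ i, ∀ r ∈ U', √(firstForm y r).det *
      ∑ j, (firstForm y r)⁻¹ i j * partialD j (meanCurvature y) r
      = (jacobian φ r).transpose.adjugate i 0 * W 0 (φ r)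
        + (jacobian φ r).transpose.adjugate i 1 * W 1 (φ r) := fun i r hr => by
    rw [h'.gradient_eq hα (fun r hr => h'.meanCurvature_eq hr (hεU r hr) (h0 r hr.1)) hr
      (hεU r hr) (h0 r hr.1), Fin.sum_univ_two]
  simp only [Matrix.adjugate_fin_two] at hgrad
  have dJ := fun i k => diffAt (contDiffOn_jacobian h.openU h.smoothφ i k) h.openU hq
  have dW : ∀ k, DifferentiableAt ℝ (fun q => W k (φ q)) q := fun k =>
    (diffAt (hWs k) h.openV (h.mapsTo hq)).comp q (diffAt h.smoothφ h.openU hq)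
  have e0 := partialD_congr_on hU' (hgrad 0) hqU' 0
  have e1 := partialD_congr_on hU' (hgrad 1) hqU' 1
  simp only [Matrix.of_apply, Matrix.cons_val_zero, Matrix.cons_val_one, Matrix.cons_val_fin_one,
    Matrix.cons_val', Matrix.transpose_apply] at e0 e1
  rw [partialD_add ((dJ 1 1).fun_mul (dW 0)) ((dJ 1 0).fun_neg.fun_mul (dW 1)),
    partialD_mul (dJ 1 1) (dW 0), partialD_mul (dJ 1 0).fun_neg (dW 1), partialD_neg,
    h.partialD_comp' (hWs 0) hq, h.partialD_comp' (hWs 1) hq] at e0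
  rw [partialD_add ((dJ 0 1).fun_neg.fun_mul (dW 0)) ((dJ 0 0).fun_mul (dW 1)),
    partialD_mul (dJ 0 1).fun_neg (dW 0), partialD_mul (dJ 0 0) (dW 1), partialD_neg,
    h.partialD_comp' (hWs 0) hq, h.partialD_comp' (hWs 1) hq] at e1
  -- By symmetry of second derivatives the adjugate is divergence-free (Piola's identity). The
  -- divergence of the transformed gradient density is thus det J times the original one, which
  -- vanishes by `hdiv`.
  rw [laplace, Fin.sum_univ_two, e0, e1, partialD_jacobian h.openU h.smoothφ hq 0 1 1,
    partialD_jacobian h.openU h.smoothφ hq 0 1 0]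
  have hz : ∀ A B : ℝ, B = 0 → -(A * B) = 0 := fun A B hB => by rw [hB, mul_zero, neg_zero]
  apply hz
  simp only [smul_eq_mul]
  linear_combination (jacobian φ q 0 0 * jacobian φ q 1 1
    - jacobian φ q 0 1 * jacobian φ q 1 0) * hdiv

end IsReparam

end ChangeOfCoordinates

/-! ### Models, and hence their open parts, have harmonic mean curvature. -/

section Harmonicity

variable {μ : ℝ} {κ : ℝ → ℝ} {a b T ν : ℝ → E3}

theorem IsModelCurvature.deriv_deriv (h : IsModelCurvature μ κ) (s : ℝ) :
    deriv (deriv κ) s + μ ^ 2 * κ s = 0 := by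
  rcases h with ⟨rfl, c₁, c₂, h⟩ | ⟨rfl, c₁, c₂, h⟩
  · obtain rfl : κ = fun s => c₁ * s + c₂ := funext h
    have h1 : deriv (fun s => c₁ * s + c₂) = fun _ => c₁ := funext fun s => by
      have : HasDerivAt (fun s => c₁ * s + c₂) c₁ s := by
        simpa using ((hasDerivAt_id s).const_mul c₁).add_const c₂
      exact this.deriv
    rw [h1, deriv_const]; ring
  · obtain rfl : κ = fun s => c₁ * Real.cos s + c₂ * Real.sin s := funext h
    have h1 : deriv (fun s => c₁ * Real.cos s + c₂ * Real.sin s)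
        = fun s => c₁ * -Real.sin s + c₂ * Real.cos s := funext fun s =>
      (((Real.hasDerivAt_cos s).const_mul c₁).add ((Real.hasDerivAt_sin s).const_mul c₂)).deriv
    have h2 : HasDerivAt (fun s => c₁ * -Real.sin s + c₂ * Real.cos s)
        (c₁ * -Real.cos s + c₂ * -Real.sin s) s :=
      ((Real.hasDerivAt_sin s).neg.const_mul c₁).add ((Real.hasDerivAt_cos s).const_mul c₂)
    rw [h1, h2.deriv]; ring

theorem IsModel.laplace_eq_zero (h : IsModel μ κ a b T ν) {q : E2} (hq : q ∈ modelDomain μ) :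
    laplace (ruled a b) (meanCurvature (ruled a b)) q = 0 := by
  rw [h.frame.laplace_eq isOpen_univ h.curvature.contDiff.contDiffOn (isOpen_modelDomain μ)
    (fun q hq => ⟨mem_univ _, hq⟩) (eqOn_refl _ _) hq, h.curvature.deriv_deriv, zero_div]

theorem IsModel.contDiff_ruled (h : IsModel μ κ a b T ν) : ContDiff ℝ ∞ (ruled a b) := by
  obtain ⟨ha, hb, -⟩ := h.frame.contDiffOn isOpen_univ h.curvature.contDiff.contDiffOn
  rw [contDiffOn_univ] at ha hb
  exact (ha.comp (contDiff_coord 0)).add ((contDiff_coord 1).smul (hb.comp (contDiff_coord 0)))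

theorem IsModel.cross_ne_zero (h : IsModel μ κ a b T ν) {q : E2} (hq : q ∈ modelDomain μ) :
    cross (partialD 0 (ruled a b) q) (partialD 1 (ruled a b) q) ≠ 0 := by
  rw [h.frame.partialD_zero (mem_univ _), h.frame.partialD_one (mem_univ _), cross_smul_left,
    cross_anticomm, h.frame.cross_eq _ (mem_univ _)]
  have h1 : ν (q 0) ≠ 0 := fun h0 => by
    have := (h.frame.frame (mem_univ (q 0))).ww
    simp [h0] at this
  exact smul_ne_zero (ne_of_gt hq) (neg_ne_zero.2 h1)

variable {M : Type*} [TopologicalSpace M] [ChartedSpace E2 M] {x : M → E3}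

/-- Open parts of models have harmonic mean curvature. -/
theorem IsModel.hasHarmonicMeanCurvature (h : IsModel μ κ a b T ν) (himm : IsSmoothImmersion x)
    (hx : IsOpenPartOf x (ruled a b) (modelDomain μ)) : HasHarmonicMeanCurvature x := by
  intro e he q hq
  obtain ⟨e₁, he₁, hm, hD, hxe⟩ := hx (e.symm q)
  have hs : ∀ r ∈ (e.symm ≫ₕ e₁).source, r ∈ e.target ∧ e.symm r ∈ e₁.source := fun r hr => by
    rwa [OpenPartialHomeomorph.trans_source] at hr
  have hR : IsReparam (ruled a b) (x ∘ e.symm) (e₁ ∘ e.symm) (modelDomain μ)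
      (e.symm ≫ₕ e₁).source :=
    ⟨isOpen_modelDomain μ, (e.symm ≫ₕ e₁).open_source, h.contDiff_ruled.contDiffOn,
      contDiffOn_transition he he₁, fun r hr => hD (e₁.map_source (hs r hr).2),
      fun r hr => hxe _ (hs r hr).2, fun r hr => h.cross_ne_zero hr⟩
  have hqU : q ∈ (e.symm ≫ₕ e₁).source := by
    rw [OpenPartialHomeomorph.trans_source]; exact ⟨hq, hm⟩
  refine hR.laplace_meanCurvature_eq_zero (fun r hr h0 => ?_) hqU
    (h.laplace_eq_zero (hR.mapsTo hqU))
  have h1 := cross_partialD_ne_zero (injective_fderiv_param himm he (hs r hr).1)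
  rw [hR.cross_eq hr, h0, zero_smul] at h1
  exact h1 rfl

end Harmonicity

end FlatSurface

end Auxiliary

theorem mainTheorem6 {M : Type*} [TopologicalSpace M] [T2Space M] [SecondCountableTopology M]
    [ConnectedSpace M] [ChartedSpace (EuclideanSpace ℝ (Fin 2)) M] [IsManifold (𝓡 2) ∞ M]
    (x : M → EuclideanSpace ℝ (Fin 3)) (hx : FlatSurface.IsSmoothImmersion x)
    (hflat : FlatSurface.IsFlat x) :
    FlatSurface.HasHarmonicMeanCurvature x ↔
      FlatSurface.IsOpenPartOfPlane x ∨ FlatSurface.IsOpenPartOfCircularCylinder x ∨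
        FlatSurface.IsOpenPartOfCornuCylinder x ∨ FlatSurface.IsOpenPartOfHarmonicCone x := by
  constructor
  · intro hharm
    rcases FlatSurface.isOpenPartOf_of_harmonic hx hflat hharm with
      h | ⟨μ, κ, a, b, T, ν, h, hκ, hx'⟩
    · exact Or.inl h
    · exact Or.inr (h.classification hκ hx')
  · intro h
    obtain ⟨μ, κ, a, b, T, ν, h, hx'⟩ := FlatSurface.exists_isModel h
    exact h.hasHarmonicMeanCurvature hx hx'
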